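/- Assume the Orthogonal Vectors Hypothesis (OVH): for every $\varepsilon>0$ there is a $c>0$ such that no algorithm decides, given two sets $A,B\subseteq\{0,1\}^d$ with $|A|=|B|=n$ and $d=\lceil c\log n\rceil$, whether there are $a\in A$, $b\in B$ with $\langle a,b\rangle=0$ in time $O(n^{2-\varepsilon})$. For a polygonal curve (a finite sequence of points, its vertices, joined by segments) the complexity is the number of its vertices; $d_F$ denotes the continuous Fréchet distance $d_F(P,Q)=\inf_{f,g}\sup_{t\in[0,1]}\|P(f(t))-Q(g(t))\|_2$ over monotone surjections $f,g$ of $[0,1]$. An $\alpha$-ANN for planar curves with parameters $n,m,k$ preprocesses a set $\mathcal P$ of $n$ polygonal curves in $\mathbb R^2$ of complexity $m$ and a threshold $\delta>0$ into a data structure that, for every query curve $Q$ in $\mathbb R^2$ of complexity $k$, returns some $P'\in\mathcal P$ with $d_F(P',Q)\le\alpha\delta$ if some $P\in\mathcal P$ has $d_F(P,Q)\le\delta$; returns "no" if all $P\in\mathcal P$ have $d_F(P,Q)\ge\alpha\delta$; and otherwise returns either some $P'\in\mathcal P$ with $d_F(P',Q)\le\alpha\delta$ or "no". The model of computation, in OVH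 and below, is the deterministic word RAM with words of $O(\log s)$ bits on inputs of size $s$ (here $s=nd$, respectively $s=nm$). The coordinates of the curves and $\delta$ are fractions $a/b$ of integers with $|a|\le (nm)^{\rho}$ and $1\le b\le (nm)^{\rho}$ for a constant $\rho\ge 1$. Then for all $\varepsilon,\varepsilon'>0$ and every exponent $\beta>0$ there is a $c>0$ such that for every function $k=k(n)$ with $k\in\omega(1)\cap o(\log n)$ and every integer $\rho\ge 1$ there is no $(3-\varepsilon)$-ANN for the continuous Fréchet distance that, for all $n\ge 1$ with $k(n)\ge 2$, stores $n$ two-dimensional curves of complexity $m=\lceil k\cdot n^{c/k}\rceil$ and supports query curves of complexity $k$ with preprocessing time $O(n^{\beta})$ and query time $O(n^{1-\varepsilon'})$. -/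

import Mathlib

open Filter Asymptotics
open scoped Topology ENNReal

/-! ### A word random-access machine

A machine has finitely many integer registers and finitely many random-access memory banks
(a program is a finite object and mentions finitely many of them); programs are structured.
Every elementary operation costs one unit of time, and every number that is written
has to fit into a machine word, that is, to have absolute value at most `W`. -/

/-- The binary operations of the machine (division and remainder are integer division,
the last three are bitwise in two's complement). -/
inductive RamOp where
  | add | sub | mul | div | mod | and | or | xor

/-- The value of a binary operation. -/
def RamOp.eval : RamOp → ℤ → ℤ → ℤ
  | .add, a, b => a + b
  | .sub, a, b => a - b
  | .mul, a, b => a * b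
  | .div, a, b => a / b
  | .mod, a, b => a % b
  | .and, a, b => Int.land a b
  | .or, a, b => Int.lor a b
  | .xor, a, b => Int.xor a b

/-- Programs. Registers and memory banks are numbered by natural numbers. -/
inductive RamProg where
  /-- do nothing -/
  | skip
  /-- `r := z` -/
  | const (r : ℕ) (z : ℤ)
  /-- `r := s op t` -/
  | op (o : RamOp) (r s t : ℕ)
  /-- `r := bank[s]` (indirect addressing through register `s`) -/
  | load (r bank s : ℕ)
  /-- `bank[s] := t` (indirect addressing through register `s`) -/
  | store (bank s t : ℕ)
  /-- first `p`, then `q` -/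
  | seq (p q : RamProg)
  /-- if register `r` is positive then `p` else `q` -/
  | ite (r : ℕ) (p q : RamProg)
  /-- while register `r` is positive do `p` -/
  | loop (r : ℕ) (p : RamProg)

/-- A configuration: the contents of the registers and of the memory banks. -/
structure RamState where
  reg : ℕ → ℤ
  mem : ℕ → ℤ → ℤ

/-- Write `z` into register `r`. -/
def RamState.setReg (σ : RamState) (r : ℕ) (z : ℤ) : RamState :=
  { σ with reg := Function.update σ.reg r z }

/-- Write `z` into cell `a` of bank `b`. -/
def RamState.setMem (σ : RamState) (b : ℕ) (a z : ℤ) : RamState :=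
  { σ with mem := Function.update σ.mem b (Function.update (σ.mem b) a z) }

/-- `RamExec W p σ t τ`: the program `p`, started in `σ`, halts after exactly `t` steps in `τ`,
and all numbers that it writes on the way have absolute value at most `W`. -/
inductive RamExec (W : ℤ) : RamProg → RamState → ℕ → RamState → Prop
  | skip (σ : RamState) : RamExec W .skip σ 1 σ
  | const (σ : RamState) (r : ℕ) (z : ℤ) (h : |z| ≤ W) :
      RamExec W (.const r z) σ 1 (σ.setReg r z)
  | op (σ : RamState) (o : RamOp) (r s t : ℕ) (h : |o.eval (σ.reg s) (σ.reg t)| ≤ W) :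
      RamExec W (.op o r s t) σ 1 (σ.setReg r (o.eval (σ.reg s) (σ.reg t)))
  | load (σ : RamState) (r b s : ℕ) (h : |σ.mem b (σ.reg s)| ≤ W) :
      RamExec W (.load r b s) σ 1 (σ.setReg r (σ.mem b (σ.reg s)))
  | store (σ : RamState) (b s t : ℕ) (h : |σ.reg t| ≤ W) :
      RamExec W (.store b s t) σ 1 (σ.setMem b (σ.reg s) (σ.reg t))
  | seq {p q : RamProg} {σ τ υ : RamState} {t u : ℕ}
      (hp : RamExec W p σ t τ) (hq : RamExec W q τ u υ) : RamExec W (.seq p q) σ (t + u) υ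
  | ite_pos {r : ℕ} {p q : RamProg} {σ τ : RamState} {t : ℕ} (h : 0 < σ.reg r)
      (hp : RamExec W p σ t τ) : RamExec W (.ite r p q) σ (t + 1) τ
  | ite_neg {r : ℕ} {p q : RamProg} {σ τ : RamState} {t : ℕ} (h : ¬ 0 < σ.reg r)
      (hq : RamExec W q σ t τ) : RamExec W (.ite r p q) σ (t + 1) τ
  | loop_done {r : ℕ} {p : RamProg} {σ : RamState} (h : ¬ 0 < σ.reg r) :
      RamExec W (.loop r p) σ 1 σ
  | loop_step {r : ℕ} {p : RamProg} {σ τ υ : RamState} {t u : ℕ} (h : 0 < σ.reg r)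
      (hp : RamExec W p σ t τ) (hl : RamExec W (.loop r p) τ u υ) :
      RamExec W (.loop r p) σ (t + u + 1) υ

/-- The largest absolute value of a machine word for inputs of size `s`: words have
`O(log s)` bits, with the constant `κ`. -/
def wordBound (κ s : ℕ) : ℤ := ((s : ℤ) + 2) ^ κ

/-- The content of a memory bank that holds a matrix row by row, starting at address `0`:
entry `(i, j)` is at address `i * m + j`; all other cells hold `0`. -/
def memTable {n m : ℕ} (f : Fin n → Fin m → ℤ) : ℤ → ℤ := fun a =>
  if h : 0 ≤ a ∧ a.toNat < n * m then
    f (finProdFinEquiv.symm ⟨a.toNat, h.2⟩).1 (finProdFinEquiv.symm ⟨a.toNat, h.2⟩).2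
  else 0

/-! ### The Orthogonal Vectors Hypothesis -/

/-- `a ∈ A` and `b ∈ B` with `⟨a, b⟩ = 0` exist. -/
def HasOrthogonalPair {n d : ℕ} (A B : Fin n → Fin d → Bool) : Prop :=
  ∃ i j, ∑ l, (A i l).toNat * (B j l).toNat = 0

/-- The input configuration for an OV instance: `n` and `d` in registers `0` and `1`,
the entries of the vectors in banks `0` and `1`. -/
def ovInit {n d : ℕ} (A B : Fin n → Fin d → Bool) : RamState where
  reg r := match r with
    | 0 => n
    | 1 => d
    | _ => 0
  mem b := match b with
    | 0 => memTable fun i l => ((A i l).toNat : ℤ)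
    | 1 => memTable fun i l => ((B i l).toNat : ℤ)
    | _ => fun _ => 0

/-- The program `p`, on words of `O(log (n * d))` bits with constant `κ`, decides in at most `T`
steps every OV instance that consists of two sets of `n` vectors in `{0,1}^d`; the answer
`1` (yes) or `0` (no) is left in register `0`. -/
def DecidesOV (p : RamProg) (κ n d : ℕ) (T : ℝ) : Prop :=
  ∀ A B : Fin n → Fin d → Bool, Function.Injective A → Function.Injective B →
    ∃ (t : ℕ) (τ : RamState), RamExec (wordBound κ (n * d)) p (ovInit A B) t τ ∧ (t : ℝ) ≤ T ∧
      (HasOrthogonalPair A B → τ.reg 0 = 1) ∧ (¬ HasOrthogonalPair A B → τ.reg 0 = 0)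

/-- The Orthogonal Vectors Hypothesis: for all `ε > 0` there is `c > 0` such that no algorithm
solves OV with `|A| = |B| = n` and `d = c log n` in time `O(n ^ (2 - ε))`. -/
def OVH : Prop :=
  ∀ ε : ℝ, 0 < ε → ∃ c : ℝ, 0 < c ∧
    ¬ ∃ (p : RamProg) (κ : ℕ) (C : ℝ), ∀ n : ℕ, 1 ≤ n →
      DecidesOV p κ n ⌈c * Real.log n⌉₊ (C * (n : ℝ) ^ (2 - ε))

/-! ### Polygonal curves and the continuous Fréchet distance -/

/-- The vertex with index `i` (counted from `0`; the last one for larger `i`). -/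
def curveVertex {E : Type*} [Zero E] {m : ℕ} (p : Fin m → E) (i : ℕ) : E :=
  if h : min i (m - 1) < m then p ⟨min i (m - 1), h⟩ else 0

/-- The polygonal curve with vertices `p 0, …, p (m - 1)` as a function on `[0,1]`: at time
`i / (m - 1)` it is at `p i`, and in between it is affine. -/
noncomputable def polygonalCurve {E : Type*} [AddCommGroup E] [Module ℝ E] {m : ℕ}
    (p : Fin m → E) (t : unitInterval) : E :=
  let s : ℝ := (t : ℝ) * ((m - 1 : ℕ) : ℝ)
  AffineMap.lineMap (curveVertex p ⌊s⌋₊) (curveVertex p (⌊s⌋₊ + 1)) (s - (⌊s⌋₊ : ℝ))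

/-- The continuous Fréchet distance of two curves on `[0,1]`: the infimum, over all pairs of
monotone surjections `f`, `g` of `[0,1]`, of the largest distance of `P (f t)` and `Q (g t)`. -/
noncomputable def frechetDist {E : Type*} [PseudoEMetricSpace E] (P Q : unitInterval → E) :
    ℝ≥0∞ :=
  ⨅ (f : unitInterval → unitInterval) (g : unitInterval → unitInterval)
    (_ : Monotone f ∧ Function.Surjective f) (_ : Monotone g ∧ Function.Surjective g),
    ⨆ t : unitInterval, edist (P (f t)) (Q (g t))

/-! ### Approximate near neighbor data structures for planar curves -/

/-- A point of the plane with rational coordinates, given by numerators and denominators. -/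
structure RatPoint where
  num : Fin 2 → ℤ
  den : Fin 2 → ℕ
  den_pos : ∀ i, 0 < den i

/-- The point in the Euclidean plane. -/
noncomputable def RatPoint.toPlane (p : RatPoint) : EuclideanSpace ℝ (Fin 2) :=
  WithLp.toLp 2 fun i => (p.num i : ℝ) / (p.den i : ℝ)

/-- All numerators and denominators have absolute value at most `R`. -/
def RatPoint.Bounded (R : ℕ) (p : RatPoint) : Prop :=
  ∀ i, |p.num i| ≤ (R : ℤ) ∧ p.den i ≤ R

/-- The points of the Euclidean plane in a sequence of rational points. -/
noncomputable def planeVertices {m : ℕ} (P : Fin m → RatPoint) :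
    Fin m → EuclideanSpace ℝ (Fin 2) :=
  fun j => (P j).toPlane

/-- The Fréchet distance of the two polygonal curves with the given vertices. -/
noncomputable def curveDist {m k : ℕ} (P : Fin m → RatPoint) (Q : Fin k → RatPoint) : ℝ≥0∞ :=
  frechetDist (polygonalCurve (planeVertices P)) (polygonalCurve (planeVertices Q))

/-- `out` is a correct answer of an `α`-approximate near neighbor data structure for the input
curves `P`, the threshold `δ` and the query `Q`: the index of an input curve, or `-1` for
the answer "no". -/
def IsANNAnswer {n m k : ℕ} (α δ : ℝ) (P : Fin n → Fin m → RatPoint) (Q : Fin k → RatPoint)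
    (out : ℤ) : Prop :=
  ((∃ i, curveDist (P i) Q ≤ ENNReal.ofReal δ) →
    ∃ i : Fin n, out = (i : ℕ) ∧ curveDist (P i) Q ≤ ENNReal.ofReal (α * δ)) ∧
  ((∀ i, ENNReal.ofReal (α * δ) ≤ curveDist (P i) Q) → out = -1) ∧
  ((¬ ∃ i, curveDist (P i) Q ≤ ENNReal.ofReal δ) →
    (¬ ∀ i, ENNReal.ofReal (α * δ) ≤ curveDist (P i) Q) →
    out = -1 ∨ ∃ i : Fin n, out = (i : ℕ) ∧ curveDist (P i) Q ≤ ENNReal.ofReal (α * δ))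

/-- The input configuration for the preprocessing: `n`, `m`, `k` and the numerator and
denominator of `δ` in registers `0` to `4`, and the numerators and denominators of the first and
of the second coordinates of the vertices in banks `0` to `3`. -/
def annInit {n m : ℕ} (k : ℕ) (P : Fin n → Fin m → RatPoint) (δnum δden : ℕ) : RamState where
  reg r := match r with
    | 0 => n
    | 1 => m
    | 2 => k
    | 3 => δnum
    | 4 => δden
    | _ => 0
  mem b := match b with
    | 0 => memTable fun i j => (P i j).num 0
    | 1 => memTable fun i j => ((P i j).den 0 : ℤ)
    | 2 => memTable fun i j => (P i j).num 1
    | 3 => memTable fun i j => ((P i j).den 1 : ℤ)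
    | _ => fun _ => 0

/-- The configuration `σ` with a query curve placed into banks `4` to `7`, which are reserved for
that purpose; the registers and all other banks keep their contents. -/
def loadQuery {k : ℕ} (σ : RamState) (Q : Fin k → RatPoint) : RamState where
  reg := σ.reg
  mem b := match b with
    | 4 => memTable fun (_ : Fin 1) j => (Q j).num 0
    | 5 => memTable fun (_ : Fin 1) j => ((Q j).den 0 : ℤ)
    | 6 => memTable fun (_ : Fin 1) j => (Q j).num 1
    | 7 => memTable fun (_ : Fin 1) j => ((Q j).den 1 : ℤ)
    | b => σ.mem b

/-- The programs `pre` and `qry`, on words of `O(log (n * m))` bits with constant `κ`, form an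
`α`-ANN data structure that stores `n` planar curves of complexity `m` and supports queries of
complexity `k`, with preprocessing time at most `Tpre` and query time at most `Tqry`.
Numerators and denominators of all input numbers are at most `(n * m) ^ ρ`. The preprocessing
turns every set of `n` curves and every threshold `δ > 0` into a configuration `σ`, from which
the query program answers every query; the answer is left in register `0`. -/
def IsPlanarANN (pre qry : RamProg) (κ ρ : ℕ) (α : ℝ) (n m k : ℕ) (Tpre Tqry : ℝ) : Prop :=
  ∀ (P : Fin n → Fin m → RatPoint) (δnum δden : ℕ),
    (∀ i j, (P i j).Bounded ((n * m) ^ ρ)) →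
    Function.Injective (fun i => planeVertices (P i)) →
    0 < δnum → 0 < δden → δnum ≤ (n * m) ^ ρ → δden ≤ (n * m) ^ ρ →
    ∃ (t : ℕ) (σ : RamState),
      RamExec (wordBound κ (n * m)) pre (annInit k P δnum δden) t σ ∧ (t : ℝ) ≤ Tpre ∧
      ∀ Q : Fin k → RatPoint, (∀ j, (Q j).Bounded ((n * m) ^ ρ)) →
        ∃ (u : ℕ) (τ : RamState),
          RamExec (wordBound κ (n * m)) qry (loadQuery σ Q) u τ ∧ (u : ℝ) ≤ Tqry ∧
          IsANNAnswer α ((δnum : ℝ) / (δden : ℝ)) P Q (τ.reg 0)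

set_option linter.constructorNameAsVariable false
set_option linter.unusedSimpArgs false

/-! ### Absolute values of the results of machine operations -/

/-! A data structure as in the statement would give an algorithm for orthogonal vectors that is
faster than the hypothesis allows by a power of `N`.

Geometry. Cut the `d` coordinates into `K = (k - 2) / 3` blocks of length `len`. A vector `α`
becomes a comb with vertices `(±1, L j)`: the number `j` is read as a block number together with a
possible content of that block, and tooth `j` points to the right iff this content is orthogonal to
the block of `α`. The comb is thus a truth table with about `K * 2 ^ len` relevant teeth. A vector
`β` becomes a curve that climbs along `x = 0` and makes an excursion to `x = 2` and back at each of
the `K` positions spelled by its own blocks. If all selected teeth point to the right, moving along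
both curves at equal heights keeps the distance at most `1`. If a selected tooth points to the left,
the point of the comb that is matched with the tip of the excursion is close to `x = -1` or at a
different height, and the distance is at least `3 L / √(4 + L²)`, which exceeds `3 - ε` for large
`L` (`curveDist_le_one`, `tooth_of_curveDist_lt`, `toothSum_blockPos_eq_zero_iff`).

Parameters. Let `r` be the integer part of the `(q σ)`-th root of `N`, and `n = r ^ σ`. If `q ≥ β`,
preprocessing `n` curves takes time `O(N)`; if `σ ε' ≥ 3`, a query takes time `O(n / r ^ 3)`. The
first set is covered by about `N / n` groups of `n` vectors; each group gets a data structure, which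
is asked for all vectors of the second set. As `k` tends to infinity and is `o(log n)`, a suitable
`c` makes the truth table fit into `m` teeth while `k` and `m` stay below `r` (`eventually_params`,
`combOk_of_log_le`). The function `k` is arbitrary and need not be computable, so all `r ^ 2` pairs
of candidates for `k` and `m` are tried. The total time is of order `r ^ 2 * (N / n) * N * (n / r ^
3) = N ^ 2 / r` (`reductionCost_le`).

Wrong candidates are harmless: the programs of the data structure are simulated with a clock and a
test of the word length, every answer is verified by computing an inner product, and all changes of
the simulated memory are logged and undone. Soundness therefore assumes nothing about the data
structure, and completeness comes from the one right pair (`sim_spec`, `undo_ends`,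
`queryStep_ends`, `search_ends`).

Both ends of the reduction are concrete machine programs. The algorithm is written in a small
structured language, verified with the rules for `Ends`, and compiled with constant overhead
(`HRun.comp_exec`). -/

theorem Int.abs_le_two_mul_of_bitwise {c M : ℤ} {u v : ℕ} (hM : 1 ≤ M) (hu : (u : ℤ) ≤ M)
    (hv : (v : ℤ) ≤ M)
    (h : ∃ w : ℕ, (∀ j, u < 2 ^ j → v < 2 ^ j → w < 2 ^ j) ∧ (c = w ∨ c = Int.negSucc w)) :
    |c| ≤ 2 * M := by
  obtain ⟨w, hw, hc⟩ := h
  lift M to ℕ using by lia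
  have hM0 : M ≠ 0 := by rintro rfl; simp at hM
  have h1 : M < 2 ^ (Nat.log2 M + 1) := Nat.lt_log2_self
  have h2 : 2 ^ Nat.log2 M ≤ M := Nat.log2_self_le hM0
  have h3 := hw (Nat.log2 M + 1) (by lia) (by lia)
  rw [pow_succ] at h3
  rcases hc with rfl | rfl
  · rw [abs_of_nonneg (by lia)]; lia
  · rw [Int.negSucc_eq, abs_neg, abs_of_nonneg (by lia)]; lia

/-- Writing an integer as `u` or `-u - 1` with `u` natural, the three operations reduce to and, or,
xor and difference of natural numbers. These stay below every power of two above both arguments, and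
the least power of two above `M` is at most `2 * M`. -/
theorem Int.abs_bitwise_le {a b M : ℤ} (hM : 1 ≤ M) (ha : |a| ≤ M) (hb : |b| ≤ M) :
    |Int.land a b| ≤ 2 * M ∧ |Int.lor a b| ≤ 2 * M ∧ |Int.xor a b| ≤ 2 * M := by
  have hld : ∀ {x y j : ℕ}, x < 2 ^ j → y < 2 ^ j → Nat.ldiff x y < 2 ^ j :=
    fun hx hy => Nat.bitwise_lt_two_pow hx hy
  have hand : ∀ {x y j : ℕ}, x < 2 ^ j → y < 2 ^ j → x &&& y < 2 ^ j :=
    fun _ hy => Nat.and_lt_two_pow _ hy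
  have hor : ∀ {x y j : ℕ}, x < 2 ^ j → y < 2 ^ j → x ||| y < 2 ^ j :=
    fun hx hy => Nat.or_lt_two_pow hx hy
  have hxor : ∀ {x y j : ℕ}, x < 2 ^ j → y < 2 ^ j → x ^^^ y < 2 ^ j :=
    fun hx hy => Nat.xor_lt_two_pow hx hy
  rw [abs_le] at ha hb
  rcases a with u | u <;> rcases b with v | v <;>
    simp only [Int.ofNat_eq_natCast, Int.negSucc_eq] at ha hb <;>
    refine ⟨?_, ?_, ?_⟩ <;>
    refine Int.abs_le_two_mul_of_bitwise (u := u) (v := v) hM (by lia) (by lia) ?_ <;>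
    first
      | exact ⟨_, fun _ => hand, Or.inl rfl⟩
      | exact ⟨_, fun _ => hand, Or.inr rfl⟩
      | exact ⟨_, fun _ => hor, Or.inl rfl⟩
      | exact ⟨_, fun _ => hor, Or.inr rfl⟩
      | exact ⟨_, fun _ => hxor, Or.inl rfl⟩
      | exact ⟨_, fun _ => hxor, Or.inr rfl⟩
      | exact ⟨_, fun _ => hld, Or.inl rfl⟩
      | exact ⟨_, fun _ => hld, Or.inr rfl⟩
      | exact ⟨_, fun _ h1 h2 => hld h2 h1, Or.inl rfl⟩
      | exact ⟨_, fun _ h1 h2 => hld h2 h1, Or.inr rfl⟩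

/-- A single product bound for all operations, so that exponents of bounds simply add up along an
expression. -/
theorem RamOp.abs_eval_le (o : RamOp) {a b A B : ℤ} (hA : 1 ≤ A) (hB : 1 ≤ B) (ha : |a| ≤ A)
    (hb : |b| ≤ B) : |o.eval a b| ≤ 2 * (A * B) := by
  have hAB : A ≤ A * B := by nlinarith
  have hBA : B ≤ A * B := by nlinarith
  have hbit := Int.abs_bitwise_le (M := A * B) (by lia) (ha.trans hAB) (hb.trans hBA)
  cases o with
  | add => exact (abs_add_le a b).trans (by lia)
  | sub => exact (abs_sub a b).trans (by lia)
  | mul =>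
    rw [RamOp.eval, abs_mul]
    have := mul_le_mul ha hb (abs_nonneg b) (by lia)
    lia
  | div => exact (Int.abs_ediv_le_abs a b).trans (by lia)
  | mod =>
    rcases eq_or_ne b 0 with rfl | h
    · rw [RamOp.eval, Int.emod_zero]; lia
    · rw [RamOp.eval, abs_of_nonneg (Int.emod_nonneg a h)]
      have := Int.emod_lt_abs a h
      lia
  | and => exact hbit.1
  | or => exact hbit.2.1
  | xor => exact hbit.2.2

/-! ### A language with variables and expressions -/

/-- Program variables. -/
inductive PVar where
  | N | d | r | n | m | k | K | len | S | W | H | G | g | h | a | nm | l | acc | i | j | idx | b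
  | v | q | x | y | z | clk | top | mark | ans | dl | pw | NN
  deriving DecidableEq

/-- The register that holds a variable. -/
def PVar.ix : PVar → ℕ
  | .N => 0 | .d => 1 | .r => 2 | .n => 3 | .m => 4 | .k => 5 | .K => 6 | .len => 7 | .S => 8
  | .W => 9 | .H => 10 | .G => 11 | .g => 12 | .h => 13 | .a => 14 | .nm => 15 | .l => 16
  | .acc => 17 | .i => 18 | .j => 19 | .idx => 20 | .b => 21 | .v => 22 | .q => 23 | .x => 24
  | .y => 25 | .z => 26 | .clk => 27 | .top => 28 | .mark => 29 | .ans => 30 | .dl => 31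
  | .pw => 32 | .NN => 33

/-- The variable that is held by a register. -/
def PVar.ofIx (i : ℕ) : PVar :=
  [PVar.N, .d, .r, .n, .m, .k, .K, .len, .S, .W, .H, .G, .g, .h, .a, .nm, .l, .acc, .i, .j, .idx,
    .b, .v, .q, .x, .y, .z, .clk, .top, .mark, .ans, .dl, .pw, .NN].getD i .N

theorem PVar.ofIx_ix (v : PVar) : PVar.ofIx v.ix = v := by cases v <;> rfl

theorem PVar.ix_injective : Function.Injective PVar.ix :=
  Function.LeftInverse.injective PVar.ofIx_ix

theorem PVar.ix_lt (v : PVar) : v.ix < 64 := by cases v <;> decide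

/-- The values of the variables and the contents of the memory banks. -/
structure St where
  reg : PVar → ℤ
  mem : ℕ → ℤ → ℤ

/-- Assignment to a variable. -/
def St.set (s : St) (v : PVar) (z : ℤ) : St := ⟨Function.update s.reg v z, s.mem⟩

/-- Assignment to a memory cell. -/
def St.put (s : St) (b : ℕ) (a z : ℤ) : St :=
  ⟨s.reg, Function.update s.mem b (Function.update (s.mem b) a z)⟩

@[simp] theorem St.set_reg (s : St) (v w : PVar) (z : ℤ) :
    (s.set v z).reg w = if w = v then z else s.reg w := by
  simp [St.set, Function.update_apply]

@[simp] theorem St.set_mem (s : St) (v : PVar) (z : ℤ) : (s.set v z).mem = s.mem := rfl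

@[simp] theorem St.put_reg (s : St) (b : ℕ) (a z : ℤ) : (s.put b a z).reg = s.reg := rfl

@[simp] theorem St.put_mem (s : St) (b b' : ℕ) (a z : ℤ) :
    (s.put b a z).mem b' = if b' = b then Function.update (s.mem b) a z else s.mem b' := by
  simp [St.put, Function.update_apply]

/-- All values of variables and all contents of memory cells are at most `X`. -/
def St.Bdd (X : ℤ) (s : St) : Prop := (∀ v, |s.reg v| ≤ X) ∧ ∀ b a, |s.mem b a| ≤ X

/-- The machine configuration `σ` holds the variables and the memory banks of `s`. -/
def St.Matches (s : St) (σ : RamState) : Prop := (∀ v : PVar, σ.reg v.ix = s.reg v) ∧ σ.mem = s.mem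

/-- Expressions. -/
inductive Ex where
  | lit (z : ℤ)
  | var (v : PVar)
  | bin (o : RamOp) (e f : Ex)
  | get (b : ℕ) (e : Ex)

/-- The value of an expression. -/
def Ex.val : Ex → St → ℤ
  | .lit z, _ => z
  | .var v, s => s.reg v
  | .bin o e f, s => o.eval (e.val s) (f.val s)
  | .get b e, s => s.mem b (e.val s)

@[simp] theorem Ex.val_lit (z : ℤ) (s : St) : (Ex.lit z).val s = z := rfl

@[simp] theorem Ex.val_var (v : PVar) (s : St) : (Ex.var v).val s = s.reg v := rfl

@[simp] theorem Ex.val_bin (o : RamOp) (e f : Ex) (s : St) :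
    (Ex.bin o e f).val s = o.eval (e.val s) (f.val s) := rfl

@[simp] theorem Ex.val_get (b : ℕ) (e : Ex) (s : St) : (Ex.get b e).val s = s.mem b (e.val s) := rfl

/-- A number that bounds the literals, the degree and the running time of an expression. -/
def Ex.mag : Ex → ℕ
  | .lit z => z.natAbs + 1
  | .var _ => 2
  | .bin _ e f => e.mag + f.mag + 2
  | .get _ e => e.mag + 1

/-- Code that evaluates an expression into register `t`. -/
def Ex.comp : Ex → ℕ → RamProg
  | .lit z, t => .const t z
  | .var v, t => .seq (.const t 0) (.op .add t v.ix t)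
  | .bin o e f, t => .seq (e.comp t) (.seq (f.comp (t + 1)) (.op o t t (t + 1)))
  | .get b e, t => .seq (e.comp t) (.load t b t)

theorem Ex.one_le_mag (e : Ex) : 1 ≤ e.mag := by cases e <;> simp [Ex.mag]

/-- Since `2 ≤ X ^ 2`, the bound `2 * X ^ a * X ^ b` for an operation is at most `X ^ (a + b + 2)`.
So a proof about a program only has to bound what is finally written by `X`; intermediate results
stay below a fixed power of `X`. -/
theorem Ex.abs_val_le {X : ℤ} (hX : 2 ≤ X) {s : St} (hs : s.Bdd X) (e : Ex)
    (he : (e.mag : ℤ) ≤ X) : |e.val s| ≤ X ^ e.mag := by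
  have h1 : (1 : ℤ) ≤ X := by lia
  induction e with
  | lit z =>
    have : X ≤ X ^ (Ex.lit z).mag := le_self_pow₀ h1 (by simp [Ex.mag])
    simp only [Ex.mag] at he
    rw [Ex.val, Int.abs_eq_natAbs]
    lia
  | var v => exact (hs.1 v).trans (le_self_pow₀ h1 (by simp [Ex.mag]))
  | bin o e f ihe ihf =>
    simp only [Ex.mag] at he
    have h2 := o.abs_eval_le (one_le_pow₀ h1) (one_le_pow₀ h1) (ihe (by lia)) (ihf (by lia))
    have h3 : (2 : ℤ) ≤ X ^ 2 := by nlinarith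
    have h4 : (0 : ℤ) ≤ X ^ e.mag * X ^ f.mag := by positivity
    rw [Ex.val, Ex.mag, pow_add, pow_add, mul_comm _ (X ^ 2)]
    nlinarith
  | get b e ih => exact (hs.2 b _).trans (le_self_pow₀ h1 (by simp [Ex.mag]))

/-! ### Compilation of expressions and instructions. -/

theorem RamState.setReg_reg (σ : RamState) (r r' : ℕ) (z : ℤ) :
    (σ.setReg r z).reg r' = if r' = r then z else σ.reg r' := by
  simp [RamState.setReg, Function.update_apply]

/-- The registers from `t` on serve as an evaluation stack. As `64 ≤ t`, they do not collide with
the registers of variables, and the first operand in `t` survives the evaluation of the second one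
in `t + 1`. -/
theorem Ex.comp_exec {X W : ℤ} (hX : 2 ≤ X) {s : St} (hs : s.Bdd X) (e : Ex) {t : ℕ} (ht : 64 ≤ t)
    (hW : X ^ e.mag ≤ W) (he : (e.mag : ℤ) ≤ X) {σ : RamState} (hσ : s.Matches σ) :
    ∃ (u : ℕ) (τ : RamState), RamExec W (e.comp t) σ u τ ∧ u ≤ e.mag ∧ τ.reg t = e.val s ∧
      (∀ v < t, τ.reg v = σ.reg v) ∧ τ.mem = σ.mem := by
  have h1 : (1 : ℤ) ≤ X := by lia
  induction e generalizing t σ with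
  | lit z =>
    exact ⟨1, _, .const σ t z (((Ex.lit z).abs_val_le hX hs he).trans hW), by simp [Ex.mag],
      by simp [RamState.setReg_reg], fun v hv => by simp [RamState.setReg_reg, hv.ne], rfl⟩
  | var v =>
    have hv : v.ix ≠ t := by have := v.ix_lt; lia
    have h0 : |RamOp.add.eval ((σ.setReg t 0).reg v.ix) ((σ.setReg t 0).reg t)| ≤ W := by
      simpa [RamState.setReg_reg, hv, RamOp.eval, hσ.1] using
        ((Ex.var v).abs_val_le hX hs he).trans hW
    refine ⟨2, _, .seq (.const σ t 0 ?_) (.op _ .add t v.ix t h0), by simp [Ex.mag],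
      by simp [RamState.setReg_reg, hv, RamOp.eval, hσ.1],
      fun w hw => by simp [RamState.setReg_reg, hw.ne], rfl⟩
    rw [abs_zero]
    exact (by positivity : 0 ≤ X ^ (Ex.var v).mag).trans hW
  | bin o e f ihe ihf =>
    have hval := ((Ex.bin o e f).abs_val_le hX hs he).trans hW
    simp only [Ex.mag] at he hW
    have hle : X ^ e.mag ≤ W := (pow_le_pow_right₀ h1 (by lia)).trans hW
    have hlf : X ^ f.mag ≤ W := (pow_le_pow_right₀ h1 (by lia)).trans hW
    obtain ⟨u, τ, hu, hut, hτt, hτ, hτm⟩ := ihe ht hle (by lia) hσ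
    have hm : s.Matches τ := ⟨fun v => by
      rw [hτ _ (by have := v.ix_lt; lia), hσ.1], by rw [hτm, hσ.2]⟩
    obtain ⟨u', υ, hu', hut', hυt, hυ, hυm⟩ := ihf (t := t + 1) (by lia) hlf (by lia) hm
    have h0 : |o.eval (υ.reg t) (υ.reg (t + 1))| ≤ W := by
      rw [hυt, hυ t (by lia), hτt]; exact hval
    refine ⟨u + (u' + 1), _, .seq hu (.seq hu' (.op υ o t t (t + 1) h0)), by simp [Ex.mag]; lia,
      ?_, fun w hw => ?_, ?_⟩
    · simp only [RamState.setReg_reg, if_true]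
      rw [hυt, hυ t (by lia), hτt]; rfl
    · rw [RamState.setReg_reg, if_neg hw.ne, hυ w (by lia), hτ w hw]
    · change υ.mem = _
      rw [hυm, hτm]
  | get b e ih =>
    have hval := ((Ex.get b e).abs_val_le hX hs he).trans hW
    simp only [Ex.mag] at he hW
    have hle : X ^ e.mag ≤ W := (pow_le_pow_right₀ h1 (by lia)).trans hW
    obtain ⟨u, τ, hu, hut, hτt, hτ, hτm⟩ := ih ht hle (by lia) hσ
    have h0 : |τ.mem b (τ.reg t)| ≤ W := by rw [hτt, hτm, hσ.2]; exact hval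
    refine ⟨u + 1, _, .seq hu (.load τ t b t h0), by simp [Ex.mag]; lia, ?_, fun w hw => ?_, hτm⟩
    · simp only [RamState.setReg_reg, if_true]
      rw [hτt, hτm, hσ.2]; rfl
    · rw [RamState.setReg_reg, if_neg hw.ne, hτ w hw]

/-- Simple instructions: assignments to a variable and to a memory cell. -/
inductive Ins where
  | asg (v : PVar) (e : Ex)
  | sto (b : ℕ) (e f : Ex)

/-- The effect of an instruction. -/
@[simp] def Ins.run : Ins → St → St
  | .asg v e, s => s.set v (e.val s)
  | .sto b e f, s => s.put b (e.val s) (f.val s)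

/-- The value that an instruction writes is at most `X`. -/
@[simp] def Ins.Ok (X : ℤ) : Ins → St → Prop
  | .asg _ e, s => |e.val s| ≤ X
  | .sto _ _ f, s => |f.val s| ≤ X

/-- A number that bounds the literals, the degrees and the running time of an instruction. -/
def Ins.mag : Ins → ℕ
  | .asg _ e => e.mag + 2
  | .sto _ e f => e.mag + f.mag + 1

/-- The code of an instruction. -/
def Ins.comp : Ins → RamProg
  | .asg v e => .seq (e.comp 64) (.seq (.const 65 0) (.op .add v.ix 64 65))
  | .sto b e f => .seq (e.comp 64) (.seq (f.comp 65) (.store b 64 65))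

theorem Ins.run_bdd {X : ℤ} {s : St} (hs : s.Bdd X) (i : Ins) (hi : i.Ok X s) :
    (i.run s).Bdd X := by
  cases i with
  | asg v e =>
    refine ⟨fun w => ?_, hs.2⟩
    simp only [Ins.run, St.set_reg]
    split_ifs
    · exact hi
    · exact hs.1 w
  | sto b e f =>
    refine ⟨hs.1, fun b' a => ?_⟩
    simp only [Ins.run, St.put_mem]
    split_ifs
    · rw [Function.update_apply]
      split_ifs
      · exact hi
      · exact hs.2 b a
    · exact hs.2 b' a

theorem Ins.comp_exec {X W : ℤ} (hX : 2 ≤ X) {s : St} (hs : s.Bdd X) (i : Ins) (hok : i.Ok X s)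
    (hW : X ^ i.mag ≤ W) (hi : (i.mag : ℤ) ≤ X) {σ : RamState} (hσ : s.Matches σ) :
    ∃ (u : ℕ) (τ : RamState), RamExec W i.comp σ u τ ∧ u ≤ i.mag ∧ (i.run s).Matches τ := by
  have h1 : (1 : ℤ) ≤ X := by lia
  cases i with
  | asg v e =>
    simp only [Ins.mag] at hW hi
    have hXW : X ≤ W := (le_self_pow₀ h1 (by lia)).trans hW
    obtain ⟨u, τ, hu, hut, hτt, hτ, hτm⟩ := e.comp_exec hX hs le_rfl
      ((pow_le_pow_right₀ h1 (by lia)).trans hW) (by lia) hσ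
    have h0 : RamOp.add.eval ((τ.setReg 65 0).reg 64) ((τ.setReg 65 0).reg 65) = e.val s := by
      simp [RamState.setReg_reg, RamOp.eval, hτt]
    refine ⟨u + (1 + 1), _, .seq hu (.seq (.const τ 65 0 (by rw [abs_zero]; lia))
      (.op _ .add v.ix 64 65 (by rw [h0]; exact hok.trans hXW))), by simp [Ins.mag]; lia,
      fun w => ?_, ?_⟩
    · rw [h0]
      simp only [RamState.setReg_reg, Ins.run, St.set_reg, PVar.ix_injective.eq_iff]
      split_ifs with h2 h3
      · rfl
      · have := w.ix_lt; lia
      · rw [hτ _ w.ix_lt, hσ.1]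
    · change τ.mem = s.mem
      rw [hτm, hσ.2]
  | sto b e f =>
    simp only [Ins.mag] at hW hi
    have hXW : X ≤ W := (le_self_pow₀ h1 (by lia)).trans hW
    obtain ⟨u, τ, hu, hut, hτt, hτ, hτm⟩ := e.comp_exec hX hs le_rfl
      ((pow_le_pow_right₀ h1 (by lia)).trans hW) (by lia) hσ
    have hm : s.Matches τ := ⟨fun v => by rw [hτ _ v.ix_lt, hσ.1], by rw [hτm, hσ.2]⟩
    obtain ⟨u', υ, hu', hut', hυt, hυ, hυm⟩ := f.comp_exec hX hs (t := 65) (by lia)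
      ((pow_le_pow_right₀ h1 (by lia)).trans hW) (by lia) hm
    have h64 : υ.reg 64 = e.val s := by rw [hυ 64 (by lia), hτt]
    refine ⟨u + (u' + 1), _, .seq hu (.seq hu' (.store υ b 64 65
      (by rw [hυt]; exact le_trans hok hXW))), by simp [Ins.mag]; lia, fun w => ?_, ?_⟩
    · change υ.reg w.ix = s.reg w
      rw [hυ _ (by have := w.ix_lt; lia), hm.1]
    · simp only [RamState.setMem, h64, hυt, hυm, hm.2, Ins.run, St.put]

/-- Programs of the language. -/
inductive Cmd where
  | block (l : List Ins)
  | seq (p q : Cmd)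
  | ite (e : Ex) (p q : Cmd)
  | loop (e : Ex) (p : Cmd)

infixr:60 " ;; " => Cmd.seq

/-- The effect of a list of instructions. -/
@[simp] def runIns : List Ins → St → St
  | [], s => s
  | i :: l, s => runIns l (i.run s)

/-- All values that a list of instructions writes are at most `X`. -/
@[simp] def OkIns (X : ℤ) : List Ins → St → Prop
  | [], _ => True
  | i :: l, s => i.Ok X s ∧ OkIns X l (i.run s)

/-- A number that bounds the literals, the degrees, and the running times of simple steps. -/
def Cmd.mag : Cmd → ℕ
  | .block l => (l.map Ins.mag).sum + 1
  | .seq p q => p.mag + q.mag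
  | .ite e p q => e.mag + p.mag + q.mag + 1
  | .loop e p => e.mag + p.mag + 1

/-- The code of a list of instructions. -/
def compIns : List Ins → RamProg
  | [] => .skip
  | i :: l => .seq i.comp (compIns l)

/-- The machine code of a program. -/
def Cmd.comp : Cmd → RamProg
  | .block l => compIns l
  | .seq p q => .seq p.comp q.comp
  | .ite e p q => .seq (e.comp 64) (.ite 64 p.comp q.comp)
  | .loop e p => .seq (e.comp 64) (.loop 64 (.seq p.comp (e.comp 64)))

/-- `HRun X c s T s'`: the program `c` turns `s` into `s'` in `T` steps, and all values that it
writes are at most `X`. -/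
inductive HRun (X : ℤ) : Cmd → St → ℕ → St → Prop
  | block {l : List Ins} {s : St} (h : OkIns X l s) : HRun X (.block l) s 1 (runIns l s)
  | seq {p q : Cmd} {s s' s'' : St} {t u : ℕ} (hp : HRun X p s t s') (hq : HRun X q s' u s'') :
      HRun X (.seq p q) s (t + u) s''
  | ite_pos {e : Ex} {p q : Cmd} {s s' : St} {t : ℕ} (h : 0 < e.val s) (hp : HRun X p s t s') :
      HRun X (.ite e p q) s (t + 1) s'
  | ite_neg {e : Ex} {p q : Cmd} {s s' : St} {t : ℕ} (h : ¬ 0 < e.val s) (hq : HRun X q s t s') :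
      HRun X (.ite e p q) s (t + 1) s'
  | loop_done {e : Ex} {p : Cmd} {s : St} (h : ¬ 0 < e.val s) : HRun X (.loop e p) s 1 s
  | loop_step {e : Ex} {p : Cmd} {s s' s'' : St} {t u : ℕ} (h : 0 < e.val s)
      (hp : HRun X p s t s') (hl : HRun X (.loop e p) s' u s'') :
      HRun X (.loop e p) s (t + u + 1) s''

/-! ### Compilation of structured programs. -/

theorem runIns_bdd {X : ℤ} {l : List Ins} {s : St} (hs : s.Bdd X) (hl : OkIns X l s) :
    (runIns l s).Bdd X := by
  induction l generalizing s with
  | nil => exact hs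
  | cons i l ih => exact ih (i.run_bdd hs hl.1) hl.2

theorem HRun.bdd {X : ℤ} {c : Cmd} {s s' : St} {T : ℕ} (h : HRun X c s T s') (hs : s.Bdd X) :
    s'.Bdd X := by
  induction h with
  | block h => exact runIns_bdd hs h
  | seq _ _ ih ih' => exact ih' (ih hs)
  | ite_pos _ _ ih => exact ih hs
  | ite_neg _ _ ih => exact ih hs
  | loop_done => exact hs
  | loop_step _ _ _ ih ih' => exact ih' (ih hs)

theorem compIns_exec {X W : ℤ} (hX : 2 ≤ X) {l : List Ins} {s : St} (hs : s.Bdd X)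
    (hok : OkIns X l s) (hW : X ^ (Cmd.block l).mag ≤ W) (hi : ((Cmd.block l).mag : ℤ) ≤ X)
    {σ : RamState} (hσ : s.Matches σ) :
    ∃ (u : ℕ) (τ : RamState), RamExec W (compIns l) σ u τ ∧ u ≤ (Cmd.block l).mag ∧
      (runIns l s).Matches τ := by
  have h1 : (1 : ℤ) ≤ X := by lia
  induction l generalizing s σ with
  | nil => exact ⟨1, σ, .skip σ, by simp [Cmd.mag], hσ⟩
  | cons i l ih =>
    simp only [Cmd.mag, List.map_cons, List.sum_cons] at *
    obtain ⟨u, τ, hu, hut, hτ⟩ := i.comp_exec hX hs hok.1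
      ((pow_le_pow_right₀ h1 (by lia)).trans hW) (by lia) hσ
    obtain ⟨u', υ, hu', hut', hυ⟩ := ih (i.run_bdd hs hok.1) hok.2
      ((pow_le_pow_right₀ h1 (by lia)).trans hW) (by lia) hτ
    exact ⟨u + u', υ, .seq hu hu', by lia, hυ⟩

theorem St.Matches.of_frame {s : St} {σ τ : RamState} (hσ : s.Matches σ)
    (hr : ∀ v < 64, τ.reg v = σ.reg v) (hm : τ.mem = σ.mem) : s.Matches τ :=
  ⟨fun v => by rw [hr _ v.ix_lt, hσ.1], by rw [hm, hσ.2]⟩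

/-- The machine code of a program is correct. -/
theorem HRun.comp_exec {X W : ℤ} (hX : 2 ≤ X) {c : Cmd} {s s' : St} {T : ℕ}
    (h : HRun X c s T s') (hs : s.Bdd X) (hW : X ^ c.mag ≤ W) (hc : (c.mag : ℤ) ≤ X)
    {σ : RamState} (hσ : s.Matches σ) :
    ∃ (u : ℕ) (τ : RamState), RamExec W c.comp σ u τ ∧ u ≤ c.mag * T ∧ s'.Matches τ := by
  have h1 : (1 : ℤ) ≤ X := by lia
  induction h generalizing σ with
  | block h =>
    obtain ⟨u, τ, hu, hut, hτ⟩ := compIns_exec hX hs h hW hc hσ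
    exact ⟨u, τ, hu, by lia, hτ⟩
  | seq hp hq ih ih' =>
    simp only [Cmd.mag] at *
    obtain ⟨u, τ, hu, hut, hτ⟩ := ih hs ((pow_le_pow_right₀ h1 (by lia)).trans hW) (by lia) hσ
    obtain ⟨u', υ, hu', hut', hυ⟩ := ih' (hp.bdd hs) ((pow_le_pow_right₀ h1 (by lia)).trans hW)
      (by lia) hτ
    exact ⟨u + u', υ, .seq hu hu', by nlinarith, hυ⟩
  | @ite_pos e p q s s' t h hp ih =>
    simp only [Cmd.mag] at *
    obtain ⟨u, τ, hu, hut, hτt, hτ, hτm⟩ := e.comp_exec hX hs le_rfl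
      ((pow_le_pow_right₀ h1 (by lia)).trans hW) (by lia) hσ
    obtain ⟨u', υ, hu', hut', hυ⟩ := ih hs ((pow_le_pow_right₀ h1 (by lia)).trans hW)
      (by lia) (hσ.of_frame hτ hτm)
    exact ⟨u + (u' + 1), υ, .seq hu (.ite_pos (by rwa [hτt]) hu'), by nlinarith, hυ⟩
  | @ite_neg e p q s s' t h hp ih =>
    simp only [Cmd.mag] at *
    obtain ⟨u, τ, hu, hut, hτt, hτ, hτm⟩ := e.comp_exec hX hs le_rfl
      ((pow_le_pow_right₀ h1 (by lia)).trans hW) (by lia) hσ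
    obtain ⟨u', υ, hu', hut', hυ⟩ := ih hs ((pow_le_pow_right₀ h1 (by lia)).trans hW)
      (by lia) (hσ.of_frame hτ hτm)
    exact ⟨u + (u' + 1), υ, .seq hu (.ite_neg (by rwa [hτt]) hu'), by nlinarith, hυ⟩
  | @loop_done e p s h =>
    simp only [Cmd.mag] at *
    obtain ⟨u, τ, hu, hut, hτt, hτ, hτm⟩ := e.comp_exec hX hs le_rfl
      ((pow_le_pow_right₀ h1 (by lia)).trans hW) (by lia) hσ
    exact ⟨u + 1, τ, .seq hu (.loop_done (by rwa [hτt])), by lia, hσ.of_frame hτ hτm⟩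
  | @loop_step e p s s' s'' t u h hp hl ih ih' =>
    simp only [Cmd.mag] at *
    obtain ⟨u0, τ, hu, hut, hτt, hτ, hτm⟩ := e.comp_exec hX hs le_rfl
      ((pow_le_pow_right₀ h1 (by lia)).trans hW) (by lia) hσ
    obtain ⟨u', υ, hu', hut', hυ⟩ := ih hs ((pow_le_pow_right₀ h1 (by lia)).trans hW)
      (by lia) (hσ.of_frame hτ hτm)
    obtain ⟨u'', φ, hu'', hut'', hφ⟩ := ih' (hp.bdd hs) hW hc hυ
    -- The induction hypothesis runs the complete code of the loop, which starts by evaluating the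
    -- condition. Splitting this off attaches the evaluation to the body just executed, as the
    -- machine loop requires.
    cases hu'' with
    | @seq _ _ _ ψ _ t1 t2 he hloop =>
      exact ⟨u0 + ((u' + t1) + t2 + 1), φ,
        .seq hu (.loop_step (by rwa [hτt]) (.seq hu' he) hloop), by nlinarith, hφ⟩

/-! ### Variables and banks that a program does not change -/

/-- The instruction assigns to the variable. -/
@[simp] def Ins.WritesVar : Ins → PVar → Prop
  | .asg v _, w => w = v
  | .sto _ _ _, _ => False

/-- The instruction stores into the bank. -/
@[simp] def Ins.WritesBank : Ins → ℕ → Prop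
  | .asg _ _, _ => False
  | .sto b _ _, b' => b' = b

/-- The program assigns to the variable. -/
@[simp] def Cmd.WritesVar : Cmd → PVar → Prop
  | .block l, v => ∃ i ∈ l, i.WritesVar v
  | .seq p q, v => p.WritesVar v ∨ q.WritesVar v
  | .ite _ p q, v => p.WritesVar v ∨ q.WritesVar v
  | .loop _ p, v => p.WritesVar v

/-- The program stores into the bank. -/
@[simp] def Cmd.WritesBank : Cmd → ℕ → Prop
  | .block l, b => ∃ i ∈ l, i.WritesBank b
  | .seq p q, b => p.WritesBank b ∨ q.WritesBank b
  | .ite _ p q, b => p.WritesBank b ∨ q.WritesBank b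
  | .loop _ p, b => p.WritesBank b

/-- Variables and banks that the program does not write are the same. -/
def Frame (c : Cmd) (s s' : St) : Prop :=
  (∀ v, ¬ c.WritesVar v → s'.reg v = s.reg v) ∧ ∀ b, ¬ c.WritesBank b → s'.mem b = s.mem b

theorem runIns_frame (l : List Ins) (s : St) : Frame (.block l) s (runIns l s) := by
  induction l generalizing s with
  | nil => exact ⟨fun _ _ => rfl, fun _ _ => rfl⟩
  | cons i l ih =>
    have h := ih (i.run s)
    refine ⟨fun v hv => ?_, fun b hb => ?_⟩
    · simp only [Cmd.WritesVar, List.mem_cons, exists_eq_or_imp, not_or] at hv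
      rw [runIns, h.1 v hv.2]
      cases i <;> simp_all
    · simp only [Cmd.WritesBank, List.mem_cons, exists_eq_or_imp, not_or] at hb
      rw [runIns, h.2 b hb.2]
      cases i <;> simp_all

/-- What a run leaves unchanged is read off the syntax of the program, so invariants need not list
it. -/
theorem HRun.frame {X : ℤ} {c : Cmd} {s s' : St} {T : ℕ} (h : HRun X c s T s') :
    Frame c s s' := by
  induction h with
  | block h => exact runIns_frame _ _
  | seq _ _ ih ih' =>
    exact ⟨fun v hv => by
      simp only [Cmd.WritesVar, not_or] at hv; rw [ih'.1 v hv.2, ih.1 v hv.1],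
      fun v hv => by simp only [Cmd.WritesBank, not_or] at hv; rw [ih'.2 v hv.2, ih.2 v hv.1]⟩
  | ite_pos _ _ ih =>
    exact ⟨fun v hv => by simp only [Cmd.WritesVar, not_or] at hv; rw [ih.1 v hv.1],
      fun v hv => by simp only [Cmd.WritesBank, not_or] at hv; rw [ih.2 v hv.1]⟩
  | ite_neg _ _ ih =>
    exact ⟨fun v hv => by simp only [Cmd.WritesVar, not_or] at hv; rw [ih.1 v hv.2],
      fun v hv => by simp only [Cmd.WritesBank, not_or] at hv; rw [ih.2 v hv.2]⟩
  | loop_done => exact ⟨fun _ _ => rfl, fun _ _ => rfl⟩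
  | loop_step _ _ _ ih ih' =>
    exact ⟨fun v hv => by rw [ih'.1 v hv]; exact ih.1 v hv,
      fun v hv => by rw [ih'.2 v hv]; exact ih.2 v hv⟩

/-! ### Rules for total correctness with running time -/

/-- Started in `s`, the program halts after at most `T` steps in a configuration with `Q`. -/
def Ends (X : ℤ) (c : Cmd) (s : St) (T : ℕ) (Q : St → Prop) : Prop :=
  s.Bdd X → ∃ (t : ℕ) (s' : St), t ≤ T ∧ HRun X c s t s' ∧ Q s'

theorem Ends.of_bdd {X : ℤ} {c : Cmd} {s : St} {T : ℕ} {Q : St → Prop}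
    (h : s.Bdd X → Ends X c s T Q) : Ends X c s T Q := fun hs => h hs hs

/-- Boundedness and the frame hold for every run; they are supplied here as extra premises and never
have to be part of a postcondition. -/
theorem Ends.mono {X : ℤ} {c : Cmd} {s : St} {T T' : ℕ} {Q Q' : St → Prop}
    (h : Ends X c s T Q) (hT : T ≤ T') (hQ : ∀ s', s'.Bdd X → Frame c s s' → Q s' → Q' s') :
    Ends X c s T' Q' := fun hs => by
  obtain ⟨t, s', ht, hr, hq⟩ := h hs
  exact ⟨t, s', ht.trans hT, hr, hQ s' (hr.bdd hs) hr.frame hq⟩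

theorem Ends.block {X : ℤ} {l : List Ins} {s : St} {Q : St → Prop}
    (h : s.Bdd X → OkIns X l s) (hQ : Q (runIns l s)) : Ends X (.block l) s 1 Q :=
  fun hs => ⟨1, _, le_rfl, .block (h hs), hQ⟩

theorem Ends.seq {X : ℤ} {p q : Cmd} {s : St} {T U : ℕ} {R Q : St → Prop}
    (hp : Ends X p s T R)
    (hq : ∀ s', s'.Bdd X → Frame p s s' → R s' → Ends X q s' U Q) :
    Ends X (p ;; q) s (T + U) Q := fun hs => by
  obtain ⟨t, s', ht, hr, hR⟩ := hp hs
  obtain ⟨u, s'', hu, hr', hQ⟩ := hq s' (hr.bdd hs) hr.frame hR (hr.bdd hs)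
  exact ⟨t + u, s'', add_le_add ht hu, .seq hr hr', hQ⟩

theorem Ends.block_seq {X : ℤ} {l : List Ins} {q : Cmd} {s : St} {U : ℕ} {Q : St → Prop}
    (h : s.Bdd X → OkIns X l s) (hq : (runIns l s).Bdd X → Ends X q (runIns l s) U Q) :
    Ends X (.block l ;; q) s (1 + U) Q :=
  (Ends.block (Q := fun s' => s' = runIns l s) h rfl).seq fun _ hb _ hs => by
    subst hs; exact hq hb

theorem Ends.ite {X : ℤ} {e : Ex} {p q : Cmd} {s : St} {T : ℕ} {Q : St → Prop}
    (hp : 0 < e.val s → Ends X p s T Q) (hq : ¬ 0 < e.val s → Ends X q s T Q) :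
    Ends X (.ite e p q) s (T + 1) Q := fun hs => by
  by_cases h : 0 < e.val s
  · obtain ⟨t, s', ht, hr, hQ⟩ := hp h hs
    exact ⟨t + 1, s', by lia, .ite_pos h hr, hQ⟩
  · obtain ⟨t, s', ht, hr, hQ⟩ := hq h hs
    exact ⟨t + 1, s', by lia, .ite_neg h hr, hQ⟩

theorem Ends.loop_done {X : ℤ} {e : Ex} {p : Cmd} {s : St} {Q : St → Prop}
    (h : ¬ 0 < e.val s) (hQ : Q s) : Ends X (.loop e p) s 1 Q :=
  fun _ => ⟨1, s, le_rfl, .loop_done h, hQ⟩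

theorem Ends.loop_step {X : ℤ} {e : Ex} {p : Cmd} {s : St} {T U : ℕ} {R Q : St → Prop}
    (h : 0 < e.val s) (hp : Ends X p s T R)
    (hq : ∀ s', s'.Bdd X → Frame p s s' → R s' → Ends X (.loop e p) s' U Q) :
    Ends X (.loop e p) s (T + U + 1) Q := fun hs => by
  obtain ⟨t, s', ht, hr, hR⟩ := hp hs
  obtain ⟨u, s'', hu, hr', hQ⟩ := hq s' (hr.bdd hs) hr.frame hR (hr.bdd hs)
  exact ⟨t + u + 1, s'', by lia, .loop_step h hr hr', hQ⟩

/-- The loop `for v in 0, …, hi - 1`. -/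
def forLoop (v hi : PVar) (p : Cmd) : Cmd :=
  .block [.asg v (.lit 0)] ;;
    .loop (.bin .sub (.var hi) (.var v)) (p ;; .block [.asg v (.bin .add (.var v) (.lit 1))])

@[simp] theorem forLoop_writesVar (v hi : PVar) (p : Cmd) (w : PVar) :
    (forLoop v hi p).WritesVar w ↔ w = v ∨ p.WritesVar w := by
  simp [forLoop]; tauto

@[simp] theorem forLoop_writesBank (v hi : PVar) (p : Cmd) (b : ℕ) :
    (forLoop v hi p).WritesBank b ↔ p.WritesBank b := by
  simp [forLoop]

theorem Ends.forLoop {X : ℤ} {v hi : PVar} {p : Cmd} {s : St} {n T : ℕ} (I : ℕ → St → Prop)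
    (hX : 0 ≤ X) (hvar : hi ≠ v) (hv : ¬ p.WritesVar v) (hhi : ¬ p.WritesVar hi)
    (hn : s.reg hi = n) (h0 : I 0 (s.set v 0))
    (hp : ∀ i < n, ∀ s', s'.Bdd X → Frame (forLoop v hi p) s s' → s'.reg v = i → I i s' →
      Ends X p s' T (fun s'' => I (i + 1) (s''.set v (i + 1)))) :
    Ends X (forLoop v hi p) s (n * (T + 2) + 2) (I n) := by
  -- Induction on the number `j` of remaining iterations. The frame is kept relative to the initial
  -- state, which is what preserves the upper limit `hi` throughout.
  have key : ∀ j ≤ n, ∀ s', s'.Bdd X → Frame (_root_.forLoop v hi p) s s' →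
      s'.reg v = (n - j : ℕ) → I (n - j) s' →
      Ends X (.loop (.bin .sub (.var hi) (.var v))
        (p ;; .block [.asg v (.bin .add (.var v) (.lit 1))])) s' (j * (T + 2) + 1) (I n) := by
    intro j
    induction j with
    | zero =>
      intro _ s' _ hf hvs hI
      rw [zero_mul, zero_add]
      refine Ends.loop_done ?_ hI
      have := hf.1 hi (by simp [hvar, hhi])
      simp [RamOp.eval, this, hvs, hn]
    | succ j ih =>
      intro hj s' hb hf hvs hI
      have hhi' : s'.reg hi = n := by rw [hf.1 hi (by simp [hvar, hhi]), hn]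
      refine (Ends.loop_step (T := T + 1) (U := j * (T + 2) + 1)
        (R := fun s'' => I (n - j) s'' ∧ s''.reg v = (n - j : ℕ)) ?_ ?_ ?_).mono
        (by ring_nf; lia) fun _ _ _ h => h
      · simp [RamOp.eval, hhi', hvs]; lia
      · refine (hp (n - (j + 1)) (by lia) s' hb hf hvs hI).seq fun t htb hft hIt => ?_
        have h1 : t.reg v + 1 = (n - j : ℕ) := by rw [hft.1 v hv, hvs]; lia
        have h2 : ((n - (j + 1) : ℕ) : ℤ) + 1 = (n - j : ℕ) := by lia
        refine Ends.block (fun hb => ?_) ?_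
        · simp only [OkIns, Ins.Ok, Ex.val, RamOp.eval, and_true, h1]
          -- The incremented counter is at most the value of `hi`, which is bounded because the
          -- state is.
          have := hb.1 hi
          rw [hft.1 hi hhi, hhi', Nat.abs_cast] at this
          rw [Nat.abs_cast]
          lia
        · simp only [runIns, Ins.run, Ex.val, RamOp.eval, h1]
          rw [h2, show n - (j + 1) + 1 = n - j by lia] at hIt
          exact ⟨hIt, by simp⟩
      · rintro s'' hb'' hf'' ⟨hI'', hv''⟩
        refine ih (by lia) s'' hb'' ⟨fun w hw => ?_, fun b hw => ?_⟩ hv'' hI''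
        · rw [hf''.1 w (by simpa [or_comm] using hw), hf.1 w hw]
        · rw [hf''.2 b (by simpa using hw), hf.2 b hw]
  refine (Ends.block_seq (fun _ => by simpa using hX) fun hb =>
    key n le_rfl _ hb ⟨fun w hw => ?_, fun _ _ => rfl⟩ (by simp) (by simpa using h0)).mono
    (by lia) fun _ _ _ h => h
  simp only [forLoop_writesVar, not_or] at hw
  simp [hw.1]

/-! ### A memory with an undo log

Bank `3` is the memory; banks `4` and `5` hold the addresses and the previous contents of the cells
that have been overwritten. -/

/-- Undoing the log entries `b, …, b + c - 1` turns the memory content into `V₀`. -/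
def Undoes (LA LV V₀ : ℤ → ℤ) (b : ℕ) : ℕ → (ℤ → ℤ) → Prop
  | 0, V => V = V₀
  | c + 1, V => Undoes LA LV V₀ b c (Function.update V (LA (b + c : ℕ)) (LV (b + c : ℕ)))

theorem Undoes.congr {LA LV LA' LV' V₀ : ℤ → ℤ} {b c : ℕ} {V : ℤ → ℤ} (h : Undoes LA LV V₀ b c V)
    (hA : ∀ a < ((b + c : ℕ) : ℤ), LA' a = LA a) (hV : ∀ a < ((b + c : ℕ) : ℤ), LV' a = LV a) :
    Undoes LA' LV' V₀ b c V := by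
  induction c generalizing V with
  | zero => exact h
  | succ c ih =>
    rw [Undoes, hA _ (by lia), hV _ (by lia)]
    exact ih h (fun a ha => hA a (by lia)) (fun a ha => hV a (by lia))

/-- The latest entries are undone first, so the second stretch leads back to `V₁` before the first
one starts. -/
theorem Undoes.append {LA LV V₀ V₁ : ℤ → ℤ} {b c c' : ℕ} {V : ℤ → ℤ}
    (h : Undoes LA LV V₁ (b + c) c' V) (h₁ : Undoes LA LV V₀ b c V₁) :
    Undoes LA LV V₀ b (c + c') V := by
  induction c' generalizing V with
  | zero => exact (show V = V₁ from h) ▸ h₁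
  | succ c' ih =>
    rw [← add_assoc, Undoes, ← add_assoc b c c']
    exact ih h

/-- The memory of `s` has been obtained from the memory of `s₀` by logged changes. -/
def Logged (s₀ s : St) : Prop :=
  ∃ b c : ℕ, s₀.reg .top = b ∧ s.reg .top = (b + c : ℕ) ∧
    (∀ a < (b : ℤ), s.mem 4 a = s₀.mem 4 a) ∧ (∀ a < (b : ℤ), s.mem 5 a = s₀.mem 5 a) ∧
    Undoes (s.mem 4) (s.mem 5) (s₀.mem 3) b c (s.mem 3)

theorem Logged.refl {s : St} (h : 0 ≤ s.reg .top) : Logged s s :=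
  ⟨(s.reg .top).toNat, 0, by lia, by lia, fun _ _ => rfl, fun _ _ => rfl, rfl⟩

theorem Logged.top_nonneg {s s' : St} (h : Logged s s') : 0 ≤ s.reg .top ∧ s.reg .top ≤ s'.reg .top := by
  obtain ⟨b, c, h1, h2, -⟩ := h
  lia

/-- The second stretch only appends above position `b + c`, so the entries of the first one are
still intact. -/
theorem Logged.trans {s₀ s₁ s₂ : St} (h : Logged s₀ s₁) (h' : Logged s₁ s₂) : Logged s₀ s₂ := by
  obtain ⟨b, c, h1, h2, h3, h4, h5⟩ := h
  obtain ⟨b', c', h1', h2', h3', h4', h5'⟩ := h'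
  obtain rfl : b' = b + c := by lia
  refine ⟨b, c + c', h1, by rw [h2', add_assoc], fun a ha => ?_, fun a ha => ?_,
    h5'.append (h5.congr h3' h4')⟩
  · rw [h3' a (by lia), h3 a ha]
  · rw [h4' a (by lia), h4 a ha]

theorem Logged.congr {s₀ s₀' s s' : St} (h : Logged s₀ s) (ht₀ : s₀'.reg .top = s₀.reg .top)
    (h3₀ : s₀'.mem 3 = s₀.mem 3) (h4₀ : s₀'.mem 4 = s₀.mem 4) (h5₀ : s₀'.mem 5 = s₀.mem 5)
    (ht : s'.reg .top = s.reg .top) (h3 : s'.mem 3 = s.mem 3) (h4 : s'.mem 4 = s.mem 4)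
    (h5 : s'.mem 5 = s.mem 5) : Logged s₀' s' := by
  unfold Logged at *
  rwa [ht₀, h3₀, h4₀, h5₀, ht, h3, h4, h5]

/-- Store `y` into cell `x` of the memory and log this. -/
def logStore : List Ins :=
  [.sto 4 (.var .top) (.var .x), .sto 5 (.var .top) (.get 3 (.var .x)), .sto 3 (.var .x) (.var .y),
    .asg .top (.bin .add (.var .top) (.lit 1))]

theorem logStore_ok {X : ℤ} {s : St} (hs : s.Bdd X) (ht : |s.reg .top + 1| ≤ X) :
    OkIns X logStore s := by
  simp [logStore, RamOp.eval, hs.1, hs.2, ht]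

theorem logStore_mem (s : St) : (runIns logStore s).mem 3 =
    Function.update (s.mem 3) (s.reg .x) (s.reg .y) := by
  simp [logStore]

theorem logStore_top (s : St) : (runIns logStore s).reg .top = s.reg .top + 1 := by
  simp [logStore, RamOp.eval]

theorem logStore_reg (s : St) {v : PVar} (hv : v ≠ .top) : (runIns logStore s).reg v = s.reg v := by
  simp [logStore, hv]

theorem logStore_ext {s : St} (h : 0 ≤ s.reg .top) : Logged s (runIns logStore s) := by
  obtain ⟨t, ht⟩ := Int.eq_ofNat_of_zero_le h
  refine ⟨t, 1, ht, by rw [logStore_top, ht]; simp, fun a ha => ?_, fun a ha => ?_, ?_⟩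
  · simp [logStore, ht, Function.update_of_ne ha.ne]
  · simp [logStore, ht, Function.update_of_ne ha.ne]
  · simp [logStore, ht, Undoes]

/-- Undo all logged changes down to the position `mark`. -/
def undo : Cmd :=
  .loop (.bin .sub (.var .top) (.var .mark))
    (.block [.asg .top (.bin .sub (.var .top) (.lit 1)),
      .sto 3 (.get 4 (.var .top)) (.get 5 (.var .top))])

/-- Restoring costs time proportional to the number of changes, not to the size of the memory. This
is what makes it affordable to reset a data structure after each query. -/
theorem undo_ends {X : ℤ} {s₀ s : St} (h : Logged s₀ s) (hm : s.reg .mark = s₀.reg .top) {T : ℕ}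
    (hT : 2 * (s.reg .top - s₀.reg .top).toNat + 1 ≤ T) :
    Ends X undo s T (fun s' => s'.mem 3 = s₀.mem 3 ∧ s'.reg .top = s₀.reg .top ∧ Logged s₀ s') := by
  obtain ⟨b, c, h1, h2, h3, h4, h5⟩ := h
  have hT' : 2 * c + 1 ≤ T := by lia
  clear hT
  suffices Ends X undo s (2 * c + 1)
      (fun s' => s'.mem 3 = s₀.mem 3 ∧ s'.reg .top = s₀.reg .top ∧ Logged s₀ s') from
    this.mono hT' fun _ _ _ h => h
  clear hT'
  induction c generalizing s with
  | zero =>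
    refine Ends.loop_done ?_ ⟨h5, by rw [h1, h2]; simp, b, 0, h1, h2, h3, h4, h5⟩
    simp [RamOp.eval, hm, h1, h2]
  | succ c ih =>
    have ht : s.reg .top - 1 = (b + c : ℕ) := by lia
    have hval : 0 < (Ex.bin .sub (.var .top) (.var .mark)).val s := by
      simp only [Ex.val, RamOp.eval]; lia
    refine (Ends.loop_step (T := 1) (R := fun s' => s' = runIns [.asg .top (.bin .sub (.var .top)
      (.lit 1)), .sto 3 (.get 4 (.var .top)) (.get 5 (.var .top))] s) hval
      (Ends.block (fun hb => ?_) rfl) fun s' _ _ hs' => ih (s := s') ?_ ?_ ?_ ?_ ?_).mono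
      (by lia) fun _ _ _ h => h
    · have := hb.1 .top
      rw [abs_le] at this
      simp only [OkIns, Ins.Ok, Ex.val, RamOp.eval, ht, and_true, Ins.run]
      refine ⟨?_, hb.2 _ _⟩
      rw [Nat.abs_cast]; lia
    all_goals subst hs'
    · simpa using hm
    · simpa [RamOp.eval] using ht
    · simpa using h3
    · simpa using h4
    · simpa [RamOp.eval, ht, Undoes] using h5

/-! ### Clocked simulation of machine programs -/

/-- A number that bounds the registers, the banks and the constants of a machine program. -/
def RamProg.mag : RamProg → ℕ
  | .skip => 0
  | .const r z => r + z.natAbs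
  | .op _ r s t => r + s + t
  | .load r b s => r + b + s
  | .store b s t => b + s + t
  | .seq p q => p.mag + q.mag
  | .ite r p q => r + p.mag + q.mag
  | .loop r p => r + p.mag

/-- Register `r` of the simulated machine is in cell `r * D`. -/
def regCell (D : ℕ) (r : ℕ) : Ex := .lit (r * D : ℕ)

/-- The content of a register of the simulated machine. -/
def regVal (D : ℕ) (r : ℕ) : Ex := .get 3 (regCell D r)

/-- Cell `a` of bank `b` of the simulated machine is in cell `a * D + sl b`, where register `s`
contains `a`. -/
def memCell (D : ℕ) (sl : ℕ → ℕ) (b s : ℕ) : Ex :=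
  .bin .add (.bin .mul (regVal D s) (.lit D)) (.lit (sl b))

/-- If there is time left on the clock, take one unit of it and run `p`. -/
def tick (p : Cmd) : Cmd :=
  .ite (.var .clk) (.block [.asg .clk (.bin .sub (.var .clk) (.lit 1))] ;; p) (.block [])

/-- Store the value of `f` into the cell `e` if it is a machine word; otherwise stop the clock. -/
def checkedStore (e f : Ex) : Cmd :=
  .block [.asg .x e, .asg .y f] ;;
    .ite (.bin .sub (.bin .add (.bin .mul (.var .W) (.var .W)) (.lit 1))
        (.bin .mul (.var .y) (.var .y)))
      (.block logStore) (.block [.asg .clk (.lit 0)])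

/-- The simulation of a machine program with a clock and a test of the word length. -/
def sim (D : ℕ) (sl : ℕ → ℕ) : RamProg → Cmd
  | .skip => tick (.block [])
  | .const r z => tick (checkedStore (regCell D r) (.lit z))
  | .op o r s t => tick (checkedStore (regCell D r) (.bin o (regVal D s) (regVal D t)))
  | .load r b s => tick (checkedStore (regCell D r) (.get 3 (memCell D sl b s)))
  | .store b s t => tick (checkedStore (memCell D sl b s) (regVal D t))
  | .seq p q => sim D sl p ;; sim D sl q
  | .ite r p q => tick (.ite (regVal D r) (sim D sl p) (sim D sl q))
  | .loop r p => .loop (.bin .mul (.var .clk) (regVal D r))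
      (.block [.asg .clk (.bin .sub (.var .clk) (.lit 1))] ;; sim D sl p)

theorem sim_not_writesVar {D : ℕ} {sl : ℕ → ℕ} {p : RamProg} {v : PVar} (h1 : v ≠ .clk)
    (h2 : v ≠ .x) (h3 : v ≠ .y) (h4 : v ≠ .top) : ¬ (sim D sl p).WritesVar v := by
  induction p <;> simp_all [sim, tick, checkedStore, logStore]

theorem sim_not_writesBank {D : ℕ} {sl : ℕ → ℕ} {p : RamProg} {b : ℕ} (h1 : b ≠ 3)
    (h2 : b ≠ 4) (h3 : b ≠ 5) : ¬ (sim D sl p).WritesBank b := by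
  induction p <;> simp_all [sim, tick, checkedStore, logStore]

/-- The number of steps of the simulation for each unit of time of the clock. -/
def simCost : RamProg → ℕ
  | .seq p q => simCost p + simCost q
  | .ite _ p q => simCost p + simCost q + 3
  | .loop _ p => simCost p + 3
  | _ => 6

/-- The memory `V` holds the registers and the first `B` banks of `st`. -/
def Holds (D B : ℕ) (sl : ℕ → ℕ) (V : ℤ → ℤ) (st : RamState) : Prop :=
  (∀ r : ℕ, V ((r * D : ℕ) : ℤ) = st.reg r) ∧ ∀ b < B, ∀ a : ℤ, V (a * D + sl b) = st.mem b a

/-- The first `B` banks are stored in different residue classes modulo `D`. -/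
def SlotsOk (D B : ℕ) (sl : ℕ → ℕ) : Prop :=
  (∀ b < B, 0 < sl b ∧ sl b < D) ∧ ∀ b < B, ∀ b' < B, sl b = sl b' → b = b'

/-! ### All registers and banks of the simulated machine in one address space. -/

theorem Int.mul_add_inj {D : ℕ} {a a' : ℤ} {i i' : ℕ} (hi : i < D) (hi' : i' < D)
    (h : a * D + i = a' * D + i') : a = a' ∧ i = i' := by
  have h1 : (a * D + i) % D = i := by
    rw [Int.mul_add_emod_self_right]; exact Int.emod_eq_of_lt (by lia) (by lia)
  have h2 : (a' * D + i') % D = i' := by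
    rw [Int.mul_add_emod_self_right]; exact Int.emod_eq_of_lt (by lia) (by lia)
  have h3 : i = i' := by rw [h, h2] at h1; lia
  refine ⟨?_, h3⟩
  subst h3
  have : (D : ℤ) ≠ 0 := by lia
  exact mul_right_cancel₀ this (by lia)

/-- Registers occupy the residue class `0` modulo `D` and banks occupy distinct nonzero classes, so
writing a register cannot disturb a bank. -/
theorem Holds.setReg {D B : ℕ} {sl : ℕ → ℕ} (hsl : SlotsOk D B sl) (hD : 0 < D) {V : ℤ → ℤ}
    {st : RamState} (h : Holds D B sl V st) (r : ℕ) (z : ℤ) :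
    Holds D B sl (Function.update V ((r * D : ℕ) : ℤ) z) (st.setReg r z) := by
  refine ⟨fun r' => ?_, fun b hb a => ?_⟩
  · rw [RamState.setReg_reg]
    split_ifs with h1
    · rw [h1, Function.update_self]
    · rw [Function.update_of_ne, h.1]
      intro h2
      exact h1 (Nat.eq_of_mul_eq_mul_right hD (by exact_mod_cast h2))
  · rw [Function.update_of_ne]
    · exact h.2 b hb a
    · intro h2
      have := Int.mul_add_inj (a := a) (a' := r) (i := sl b) (i' := 0) (hsl.1 b hb).2 hD
        (by rw [h2]; push_cast; ring)
      have := (hsl.1 b hb).1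
      lia

theorem Holds.setMem {D B : ℕ} {sl : ℕ → ℕ} (hsl : SlotsOk D B sl) {V : ℤ → ℤ}
    {st : RamState} (h : Holds D B sl V st) {b : ℕ} (hb : b < B) (a z : ℤ) :
    Holds D B sl (Function.update V (a * D + sl b) z) (st.setMem b a z) := by
  refine ⟨fun r => ?_, fun b' hb' a' => ?_⟩
  · rw [Function.update_of_ne]
    · exact h.1 r
    · intro h2
      have := Int.mul_add_inj (a := a) (a' := r) (i := sl b) (i' := 0) (hsl.1 b hb).2
        (by have := (hsl.1 b hb).2; lia) (by rw [← h2]; push_cast; ring)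
      have := (hsl.1 b hb).1
      lia
  · simp only [RamState.setMem, Function.update_apply]
    by_cases hbb : b' = b
    · subst hbb
      have hD : (D : ℤ) ≠ 0 := by have := (hsl.1 b' hb').2; lia
      simp only [add_left_inj, mul_left_inj' hD, if_true, Function.update_apply, h.2 b' hb']
    · rw [if_neg, if_neg hbb, h.2 b' hb']
      intro h2
      exact hbb (hsl.2 _ hb' _ hb (Int.mul_add_inj (hsl.1 b' hb').2 (hsl.1 b hb).2 h2).2)

/-- The conditions under which the simulation does not produce large numbers. -/
structure SimOk (X₀ Y w : ℤ) (s : St) : Prop where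
  mem : ∀ a, |s.mem 3 a| ≤ X₀
  clk : 0 ≤ s.reg .clk
  top : 0 ≤ s.reg .top
  add : s.reg .clk + s.reg .top ≤ Y
  word : s.reg .W = w

/-- What the simulation of `p` achieves between `s` and `s'`. -/
structure SimPost (D B : ℕ) (sl : ℕ → ℕ) (X₀ Y w : ℤ) (p : RamProg) (s s' : St) : Prop where
  ok : SimOk X₀ Y w s'
  ext : Logged s s'
  clk_le : s'.reg .clk ≤ s.reg .clk
  exec : ∀ st t st', Holds D B sl (s.mem 3) st → RamExec w p st t st' → (t : ℤ) ≤ s.reg .clk →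
    Holds D B sl (s'.mem 3) st' ∧ s.reg .clk - t ≤ s'.reg .clk

/-- The word test compares squares, as there is no absolute value. A number that is too long stops
the clock; the simulated machine would be stuck there, so faithfulness is claimed only for `|c| ≤
w`, while the bounds in `SimOk` hold in any case. -/
theorem checkedStore_ends {X X₀ Y w : ℤ} (hX₀ : 1 ≤ X₀) (hXX : X₀ ≤ X) (hY : Y ≤ X₀) (hw0 : 0 ≤ w) {e f : Ex}
    {a c : ℤ} {s : St} (hs : SimOk X₀ Y w s) (hlt : s.reg .clk + s.reg .top + 1 ≤ Y) (hwX : w ≤ X₀)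
    (he : e.val s = a) (hf : ∀ z, f.val (s.set .x z) = c) (ha : |a| ≤ X) (hc : |c| ≤ X) :
    Ends X (checkedStore e f) s 3 (fun s' => SimOk X₀ Y w s' ∧ Logged s s' ∧ s'.reg .clk ≤ s.reg .clk ∧
      (|c| ≤ w → s'.mem 3 = Function.update (s.mem 3) a c ∧ s'.reg .clk = s.reg .clk)) := by
  have hcw : w * w + 1 - c * c ≤ 0 ↔ w < |c| := by
    rw [← abs_mul_abs_self c]
    constructor
    · intro h; by_contra! h2; have := mul_self_le_mul_self (abs_nonneg c) h2; lia
    · intro h; nlinarith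
  refine (Ends.block_seq (U := 1 + 1) (fun _ => ?_) fun hb => ?_).mono le_rfl fun _ _ _ h => h
  · simp [he, hf, ha, hc]
  · set s₁ := runIns [.asg .x e, .asg .y f] s with hs₁
    have hx : s₁.reg .x = a := by simp [hs₁, he]
    have hy : s₁.reg .y = c := by simp [hs₁, hf]
    have hr : ∀ v, v ≠ .x → v ≠ .y → s₁.reg v = s.reg v := fun v h1 h2 => by simp [hs₁, h1, h2]
    have hm : s₁.mem = s.mem := rfl
    have hval : (Ex.bin .sub (.bin .add (.bin .mul (.var .W) (.var .W)) (.lit 1))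
        (.bin .mul (.var .y) (.var .y))).val s₁ = w * w + 1 - c * c := by
      simp [RamOp.eval, hy, hr, hs.word]
    clear_value s₁
    have h₁ : Logged s s₁ := (Logged.refl hs.top).congr rfl rfl rfl rfl (hr _ (by simp) (by simp))
      (by rw [hm]) (by rw [hm]) (by rw [hm])
    have htop : s₁.reg .top = s.reg .top := hr _ (by simp) (by simp)
    have hclk : s₁.reg .clk = s.reg .clk := hr _ (by simp) (by simp)
    have hW : s₁.reg .W = w := (hr _ (by simp) (by simp)).trans hs.word
    have h1 := hs.clk
    have h2 := hs.top
    refine Ends.ite (fun hpos => ?_) fun hneg => ?_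
    · rw [hval] at hpos
      have hcle : |c| ≤ w := by
        by_contra! h; rw [← hcw] at h; lia
      refine Ends.block (fun hb => logStore_ok hb ?_) ⟨⟨fun x => ?_, ?_, ?_, ?_, ?_⟩,
        h₁.trans (logStore_ext ?_), ?_, fun _ => ⟨?_, ?_⟩⟩
      · rw [htop, abs_of_nonneg (by lia)]; lia
      · rw [logStore_mem, Function.update_apply]
        split_ifs
        · rw [hy]; lia
        · rw [hm]; exact hs.mem x
      · rwa [logStore_reg _ (by simp), hclk]
      · rw [logStore_top, htop]; lia
      · rw [logStore_top, logStore_reg _ (by simp), htop, hclk]; lia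
      · rwa [logStore_reg _ (by simp)]
      · lia
      · rw [logStore_reg _ (by simp), hclk]
      · rw [logStore_mem, hx, hy, hm]
      · rw [logStore_reg _ (by simp), hclk]
    · rw [hval, not_lt, hcw] at hneg
      refine Ends.block (fun hb => by simp; lia) ⟨⟨fun x => ?_, ?_, ?_, ?_, ?_⟩,
        h₁.trans ((Logged.refl (by lia)).congr rfl rfl rfl rfl ?_ rfl rfl rfl), ?_, fun h => ?_⟩
      · simpa [hm] using hs.mem x
      · simp
      · simp [htop, h2]
      · simp [htop]; lia
      · simp [hW]
      · simp
      · simpa using h1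
      · lia

/-- Makes the case of an exhausted clock vacuous: no run fits into the remaining time. -/
theorem RamExec.one_le {W : ℤ} {p : RamProg} {σ τ : RamState} {t : ℕ} (h : RamExec W p σ t τ) :
    1 ≤ t := by
  induction h <;> lia

section

variable {D B : ℕ} {sl : ℕ → ℕ} {X X₀ Y w : ℤ}

/-- The unit taken from the clock pays for at most one new log entry; this keeps the sum of clock
and log length below `Y`. -/
theorem tick_ends (hXX : X₀ ≤ X) (hY : Y ≤ X₀) {p : RamProg} {c : Cmd} {T : ℕ} {s : St} (hs : SimOk X₀ Y w s)
    (hc : 0 < s.reg .clk → ∀ s₁ : St, s₁ = s.set .clk (s.reg .clk - 1) → SimOk X₀ Y w s₁ →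
      s₁.reg .clk + s₁.reg .top + 1 ≤ Y → s₁.Bdd X → ∃ t s', HRun X c s₁ t s' ∧ t ≤ T * (1 + (s₁.reg .clk - s'.reg .clk).toNat) ∧
        SimOk X₀ Y w s' ∧ Logged s₁ s' ∧ s'.reg .clk ≤ s₁.reg .clk ∧
        ∀ st t st', Holds D B sl (s.mem 3) st → RamExec w p st t st' → (t : ℤ) ≤ s.reg .clk →
          Holds D B sl (s'.mem 3) st' ∧ s.reg .clk - t ≤ s'.reg .clk) (hb : s.Bdd X) :
    ∃ t s', HRun X (tick c) s t s' ∧ t ≤ (T + 2) * (1 + (s.reg .clk - s'.reg .clk).toNat) ∧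
      SimPost D B sl X₀ Y w p s s' := by
  by_cases h : 0 < s.reg .clk
  · have h1 := hs.top
    have h2 := hs.add
    have hok : OkIns X [.asg .clk (.bin .sub (.var .clk) (.lit 1))] s := by
      simp only [OkIns, Ins.Ok, Ex.val, RamOp.eval, and_true]
      rw [abs_of_nonneg (by lia)]; lia
    have hR := hc h _ rfl ⟨by simpa using hs.mem, by simp; lia, by simpa using h1,
      by simp; lia, by simpa using hs.word⟩ (by simp; lia)
    obtain ⟨t, s', hr, ht, hs', hext, hle, hex⟩ := hR (runIns_bdd hb hok)
    simp only [St.set_reg, if_true] at ht hle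
    refine ⟨1 + t + 1, s', .ite_pos h (.seq (.block hok) hr), ?_, hs',
      hext.congr (by simp) rfl rfl rfl rfl rfl rfl rfl, by lia, hex⟩
    have : (s.reg .clk - s'.reg .clk).toNat = (s.reg .clk - 1 - s'.reg .clk).toNat + 1 := by lia
    rw [this]
    nlinarith
  · refine ⟨2, s, .ite_neg h (.block trivial), by nlinarith, hs, Logged.refl hs.top, le_rfl,
      fun st t st' _ hex ht => ?_⟩
    have := hex.one_le
    lia


/-- The common form of the four writing instructions: a single checked store of `c V` at address `a
V`, where `V` is the simulated memory. -/
theorem sim_elem (hX₀ : 1 ≤ X₀) (hXX : X₀ ≤ X) (hY : Y ≤ X₀) (hw0 : 0 ≤ w) (hwX : w ≤ X₀)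
    {p : RamProg} {e f : Ex} {a c : (ℤ → ℤ) → ℤ}
    (he : ∀ s, e.val s = a (s.mem 3)) (hf : ∀ s, f.val s = c (s.mem 3))
    (hac : ∀ V : ℤ → ℤ, (∀ x, |V x| ≤ X₀) → |a V| ≤ X ∧ |c V| ≤ X)
    (hex : ∀ V st t st', Holds D B sl V st → RamExec w p st t st' →
      t = 1 ∧ |c V| ≤ w ∧ Holds D B sl (Function.update V (a V) (c V)) st')
    {s : St} (hs : SimOk X₀ Y w s) (hb : s.Bdd X) :
    ∃ t s', HRun X (tick (checkedStore e f)) s t s' ∧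
      t ≤ 6 * (1 + (s.reg .clk - s'.reg .clk).toNat) ∧ SimPost D B sl X₀ Y w p s s' := by
  refine tick_ends (T := 4) hXX hY hs (fun hpos s₁ hs₁ hok hlt hb₁ => ?_) hb
  obtain ⟨t, s', ht, hr, h1, h2, h3, h4⟩ := checkedStore_ends hX₀ hXX hY hw0 hok hlt hwX (he s₁)
    (fun z => by rw [hf, St.set_mem]) (hac _ hok.mem).1 (hac _ hok.mem).2 hb₁
  refine ⟨t, s', hr, by lia, h1, h2, h3, fun st t st' hV hst htc => ?_⟩
  obtain ⟨rfl, hcw, hV'⟩ := hex _ _ _ _ hV hst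
  have hm : s₁.mem = s.mem := by rw [hs₁, St.set_mem]
  rw [hm] at h4
  obtain ⟨h5, h6⟩ := h4 hcw
  refine ⟨by rwa [h5], ?_⟩
  rw [h6, hs₁]
  simp

/-- Termination, the running time and the bounds hold for every content of the simulated memory,
even the meaningless ones that wrong guesses produce. Agreement with the real machine is asserted
only for runs that the clock allows. The proof is by induction on the program, with an inner
induction on the clock for loops. -/
theorem sim_spec (hsl : SlotsOk D B sl) (hD : 0 < D) (hX₀ : 1 ≤ X₀) (hY : Y ≤ X₀) (hw0 : 0 ≤ w) (hwX : w ≤ X₀)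
    (hX1 : X₀ * D + D ≤ X) (hX2 : 2 * (X₀ * X₀) ≤ X) {p : RamProg} (hpB : p.mag < B)
    (hpX : ((p.mag * D : ℕ) : ℤ) ≤ X) {s : St} (hs : SimOk X₀ Y w s) (hb : s.Bdd X) :
    ∃ t s', HRun X (sim D sl p) s t s' ∧
      t ≤ simCost p * (1 + (s.reg .clk - s'.reg .clk).toNat) ∧ SimPost D B sl X₀ Y w p s s' := by
  have hXX : X₀ ≤ X := by nlinarith
  have hmem : ∀ {r b : ℕ} {V : ℤ → ℤ}, b < B → (∀ x, |V x| ≤ X₀) →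
      |V ((r * D : ℕ) : ℤ) * D + sl b| ≤ X := by
    intro r b V hb' hV
    refine (abs_add_le _ _).trans ?_
    rw [abs_mul, Nat.abs_cast, Nat.abs_cast]
    have := mul_le_mul_of_nonneg_right (hV ((r * D : ℕ) : ℤ)) (by positivity : (0 : ℤ) ≤ D)
    have := (hsl.1 b hb').2
    lia
  have hreg : ∀ {r : ℕ}, r ≤ p.mag → |((r * D : ℕ) : ℤ)| ≤ X := by
    intro r hr
    rw [Nat.abs_cast]
    have : r * D ≤ p.mag * D := Nat.mul_le_mul_right _ hr
    lia
  induction p generalizing s with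
  | skip =>
    refine tick_ends (T := 4) hXX hY hs (fun hpos s₁ hs₁ hok hlt hb₁ =>
      ⟨1, s₁, .block trivial, by lia, hok, Logged.refl hok.top, le_rfl, fun st t st' hV hst htc => ?_⟩) hb
    cases hst
    rw [hs₁]
    exact ⟨hV, by simp⟩
  | const r z =>
    simp only [RamProg.mag] at hpB hpX hreg
    refine sim_elem (a := fun _ => ((r * D : ℕ) : ℤ)) (c := fun _ => z) hX₀ hXX hY hw0 hwX
      (fun _ => rfl) (fun _ => rfl) (fun V hV => ⟨hreg (by lia), ?_⟩) (fun V st t st' hV h => ?_) hs hb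
    · rw [Int.abs_eq_natAbs]
      have : (r + z.natAbs) * 1 ≤ (r + z.natAbs) * D := Nat.mul_le_mul_left _ hD
      lia
    · cases h with
      | const _ _ _ h => exact ⟨rfl, h, hV.setReg hsl hD r z⟩
  | op o r i j =>
    simp only [RamProg.mag] at hpB hpX hreg
    refine sim_elem (a := fun _ => ((r * D : ℕ) : ℤ))
      (c := fun V => o.eval (V ((i * D : ℕ) : ℤ)) (V ((j * D : ℕ) : ℤ))) hX₀ hXX hY hw0 hwX
      (fun _ => rfl) (fun _ => rfl) (fun V hV => ⟨hreg (by lia), ?_⟩) (fun V st t st' hV h => ?_) hs hb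
    · exact (o.abs_eval_le hX₀ hX₀ (hV _) (hV _)).trans hX2
    · cases h with
      | op _ _ _ _ _ h =>
        rw [hV.1, hV.1]
        exact ⟨rfl, h, hV.setReg hsl hD r _⟩
  | load r b i =>
    simp only [RamProg.mag] at hpB hpX hreg
    refine sim_elem (a := fun _ => ((r * D : ℕ) : ℤ))
      (c := fun V => V (V ((i * D : ℕ) : ℤ) * D + sl b)) hX₀ hXX hY hw0 hwX
      (fun _ => rfl) (fun _ => rfl) (fun V hV => ⟨hreg (by lia), (hV _).trans hXX⟩)
      (fun V st t st' hV h => ?_) hs hb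
    cases h with
    | load _ _ _ _ h =>
      rw [hV.1, hV.2 b (by lia)]
      exact ⟨rfl, h, hV.setReg hsl hD r _⟩
  | store b i j =>
    simp only [RamProg.mag] at hpB hpX hreg
    refine sim_elem (a := fun V => V ((i * D : ℕ) : ℤ) * D + sl b)
      (c := fun V => V ((j * D : ℕ) : ℤ)) hX₀ hXX hY hw0 hwX
      (fun _ => rfl) (fun _ => rfl) (fun V hV => ⟨hmem (by lia) hV, (hV _).trans hXX⟩)
      (fun V st t st' hV h => ?_) hs hb
    cases h with
    | store _ _ _ _ h =>
      rw [hV.1, hV.1]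
      exact ⟨rfl, h, hV.setMem hsl (by lia) _ _⟩
  | seq p q ihp ihq =>
    simp only [RamProg.mag] at hpB hpX hreg
    have hp1 : p.mag * D ≤ (p.mag + q.mag) * D := Nat.mul_le_mul_right _ (by lia)
    have hq1 : q.mag * D ≤ (p.mag + q.mag) * D := Nat.mul_le_mul_right _ (by lia)
    obtain ⟨t, s₁, hr, ht, h1, h2, h3, h4⟩ := ihp (by lia) (by lia) hs hb fun h => hreg (by lia)
    obtain ⟨t', s₂, hr', ht', h1', h2', h3', h4'⟩ := ihq (by lia) (by lia) h1 (hr.bdd hb)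
      fun h => hreg (by lia)
    refine ⟨t + t', s₂, .seq hr hr', ?_, h1', h2.trans h2', h3'.trans h3,
      fun st u st' hV hst hu => ?_⟩
    · have e : (s.reg .clk - s₂.reg .clk).toNat = (s.reg .clk - s₁.reg .clk).toNat +
        (s₁.reg .clk - s₂.reg .clk).toNat := by lia
      rw [simCost, e]
      nlinarith
    · cases hst with
      | seq hp hq =>
        obtain ⟨h5, h6⟩ := h4 _ _ _ hV hp (by lia)
        obtain ⟨h7, h8⟩ := h4' _ _ _ h5 hq (by lia)
        exact ⟨h7, by lia⟩
  | ite r p q ihp ihq =>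
    simp only [RamProg.mag] at hpB hpX hreg
    have hp1 : p.mag * D ≤ (r + p.mag + q.mag) * D := Nat.mul_le_mul_right _ (by lia)
    have hq1 : q.mag * D ≤ (r + p.mag + q.mag) * D := Nat.mul_le_mul_right _ (by lia)
    refine tick_ends (T := simCost p + simCost q + 1) hXX hY hs
      (fun hpos s₁ hs₁ hok hlt hb₁ => ?_) hb
    have hm : s₁.mem 3 = s.mem 3 := by rw [hs₁, St.set_mem]
    have hv : (regVal D r).val s₁ = s.mem 3 ((r * D : ℕ) : ℤ) := by rw [← hm]; rfl
    have hc : s₁.reg .clk = s.reg .clk - 1 := by simp [hs₁]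
    by_cases h : 0 < (regVal D r).val s₁
    · obtain ⟨t, s₂, hr, ht, h1, h2, h3, h4⟩ := ihp (by lia) (by lia) hok hb₁
        fun h => hreg (by lia)
      refine ⟨t + 1, s₂, .ite_pos h hr, by nlinarith, h1, h2, h3, fun st u st' hV hst hu => ?_⟩
      rw [hv, hV.1] at h
      cases hst with
      | ite_pos h hp =>
        obtain ⟨h5, h6⟩ := h4 _ _ _ (hm ▸ hV) hp (by lia)
        exact ⟨h5, by lia⟩
      | ite_neg h' hp => exact absurd h h'
    · obtain ⟨t, s₂, hr, ht, h1, h2, h3, h4⟩ := ihq (by lia) (by lia) hok hb₁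
        fun h => hreg (by lia)
      refine ⟨t + 1, s₂, .ite_neg h hr, by nlinarith, h1, h2, h3, fun st u st' hV hst hu => ?_⟩
      rw [hv, hV.1] at h
      cases hst with
      | ite_neg h hp =>
        obtain ⟨h5, h6⟩ := h4 _ _ _ (hm ▸ hV) hp (by lia)
        exact ⟨h5, by lia⟩
      | ite_pos h' hp => exact absurd h' h
  | loop r p ih =>
    simp only [RamProg.mag] at hpB hpX hreg
    have hp1 : p.mag * D ≤ (r + p.mag) * D := Nat.mul_le_mul_right _ (by lia)
    obtain ⟨n, hn⟩ := Int.eq_ofNat_of_zero_le hs.clk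
    induction n using Nat.strong_induction_on generalizing s with
    | _ n ihn =>
    have hv : (Ex.bin .mul (.var .clk) (regVal D r)).val s =
      s.reg .clk * s.mem 3 ((r * D : ℕ) : ℤ) := rfl
    by_cases h : 0 < (Ex.bin .mul (.var .clk) (regVal D r)).val s
    · have hclk0 := hs.clk
      -- The loop condition is the product of clock and register. The clock is nonnegative, so the
      -- product is positive only if both factors are; an expired clock therefore ends the loop.
      have hreg0 : 0 < s.mem 3 ((r * D : ℕ) : ℤ) ∧ 0 < s.reg .clk := by
        rw [hv] at h
        have h0 : 0 < s.reg .clk := by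
          rcases hclk0.lt_or_eq with h0 | h0
          · exact h0
          · simp [← h0] at h
        exact ⟨pos_of_mul_pos_right h hclk0, h0⟩
      have htop := hs.top
      have hadd := hs.add
      have hok : OkIns X [.asg .clk (.bin .sub (.var .clk) (.lit 1))] s := by
        simp only [OkIns, Ins.Ok, Ex.val, RamOp.eval, and_true]
        rw [abs_of_nonneg (by lia)]; lia
      set s₁ := runIns [.asg .clk (.bin .sub (.var .clk) (.lit 1))] s with hs₁
      have hm : s₁.mem = s.mem := rfl
      have hc : s₁.reg .clk = s.reg .clk - 1 := by simp [hs₁, RamOp.eval]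
      have ht1 : s₁.reg .top = s.reg .top := by simp [hs₁]
      have hW : s₁.reg .W = w := by simp [hs₁, hs.word]
      have hb₁ : s₁.Bdd X := runIns_bdd hb hok
      have hok₁ : SimOk X₀ Y w s₁ := ⟨by rw [hm]; exact hs.mem, by lia, by lia, by lia, hW⟩
      obtain ⟨t, s₂, hr, ht, h1, h2, h3, h4⟩ := ih (by lia) (by lia) hok₁ hb₁
        fun h => hreg (by lia)
      have hc2 := h1.clk
      obtain ⟨u, s₃, hr', hu, h1', h2', h3', h4'⟩ := ihn (s₂.reg .clk).toNat (by lia)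
        h1 (hr.bdd hb₁) (by lia)
      refine ⟨(1 + t) + u + 1, s₃, .loop_step h (.seq (.block hok) hr) hr', ?_, h1',
        (h2.congr (by simp [hs₁]) rfl rfl rfl rfl rfl rfl rfl).trans h2', by lia,
        fun st v st' hV hst hvc => ?_⟩
      · have e : (s.reg .clk - s₃.reg .clk).toNat = (s₁.reg .clk - s₂.reg .clk).toNat +
          (s₂.reg .clk - s₃.reg .clk).toNat + 1 := by lia
        rw [simCost] at *
        rw [e]
        nlinarith
      · cases hst with
        | loop_done h' => rw [← hV.1] at h'; exact absurd hreg0.1 h'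
        | loop_step h' hp hl =>
          obtain ⟨h5, h6⟩ := h4 _ _ _ hV hp (by lia)
          obtain ⟨h7, h8⟩ := h4' _ _ _ h5 hl (by lia)
          exact ⟨h7, by lia⟩
    · refine ⟨1, s, .loop_done h, by rw [simCost]; nlinarith, hs, Logged.refl hs.top, le_rfl,
        fun st v st' hV hst hvc => ?_⟩
      have h1 := hst.one_le
      have hclk0 := hs.clk
      cases hst with
      -- Leaving a loop costs the machine one step but takes nothing from the clock. This is why the
      -- clocks are compared by an inequality only.
      | loop_done _ => exact ⟨hV, by lia⟩
      | loop_step h' _ _ =>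
        rw [← hV.1] at h'
        have h0 : 0 < s.reg .clk := by lia
        exact absurd (mul_pos h0 h') h

/-- The simulation halts within a constant times the time on the clock. -/
theorem sim_ends (hsl : SlotsOk D B sl) (hD : 0 < D) (hX₀ : 1 ≤ X₀) (hY : Y ≤ X₀) (hw0 : 0 ≤ w) (hwX : w ≤ X₀)
    (hX1 : X₀ * D + D ≤ X) (hX2 : 2 * (X₀ * X₀) ≤ X) {p : RamProg} (hpB : p.mag < B)
    (hpX : ((p.mag * D : ℕ) : ℤ) ≤ X) {s : St} (hs : SimOk X₀ Y w s) {T : ℕ}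
    (hT : s.reg .clk ≤ T) :
    Ends X (sim D sl p) s (simCost p * (1 + T)) (SimPost D B sl X₀ Y w p s) := fun hb => by
  obtain ⟨t, s', h1, h2, h3⟩ := sim_spec hsl hD hX₀ hY hw0 hwX hX1 hX2 hpB hpX hs hb
  refine ⟨t, s', h2.trans (Nat.mul_le_mul_left _ ?_), h1, h3⟩
  have := h3.ok.clk
  lia

end

/-! ### The Fréchet distance of a comb and a query curve -/

/-- A point of the plane with integer coordinates. -/
def latticePoint (x y : ℤ) : RatPoint where
  num i := if i = 0 then x else y
  den _ := 1
  den_pos _ := one_pos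

theorem latticePoint_toPlane_zero (x y : ℤ) : (latticePoint x y).toPlane 0 = x := by
  simp [latticePoint, RatPoint.toPlane]

theorem latticePoint_toPlane_one (x y : ℤ) : (latticePoint x y).toPlane 1 = y := by
  simp [latticePoint, RatPoint.toPlane]

/-- At the right end the floor is `m - 1` and the clamped next vertex differs from `c m`; the
coefficient is `0` there, so the continuation of `c` beyond the curve does not matter. -/
theorem polygonalCurve_eq_lineMap {E : Type*} [AddCommGroup E] [Module ℝ E] {m : ℕ} (hm : 0 < m)
    (c : ℕ → E) (t : unitInterval) {s : ℝ} (hs : s = (t : ℝ) * ((m - 1 : ℕ) : ℝ)) :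
    polygonalCurve (fun j : Fin m => c j) t =
      AffineMap.lineMap (c ⌊s⌋₊) (c (⌊s⌋₊ + 1)) (s - ⌊s⌋₊) := by
  have h0 : 0 ≤ s := hs ▸ mul_nonneg t.2.1 (Nat.cast_nonneg _)
  have h1 : s ≤ (m - 1 : ℕ) := hs ▸ mul_le_of_le_one_left (Nat.cast_nonneg _) t.2.2
  have h2 : ⌊s⌋₊ ≤ m - 1 := Nat.floor_le_of_le h1
  have hv : ∀ i, i ≤ m - 1 → curveVertex (fun j : Fin m => c j) i = c i := fun i hi => by
    simp only [curveVertex, min_eq_left hi]; rw [dif_pos (by lia)]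
  simp only [polygonalCurve, ← hs]
  rw [hv _ h2]
  rcases h2.lt_or_eq with h3 | h3
  · rw [hv _ h3]
  · have : s = ⌊s⌋₊ := le_antisymm (h3 ▸ h1) (Nat.floor_le h0)
    rw [sub_eq_zero.2 this]
    simp

/-- Piecewise linear interpolation of a sequence. -/
noncomputable def interpolate (c : ℕ → ℝ) (s : ℝ) : ℝ :=
  c ⌊s⌋₊ + (s - ⌊s⌋₊) * (c (⌊s⌋₊ + 1) - c ⌊s⌋₊)

theorem interpolate_natCast (c : ℕ → ℝ) (v : ℕ) : interpolate c v = c v := by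
  simp [interpolate]

theorem interpolate_id {s : ℝ} : interpolate (fun j => (j : ℝ)) s = s := by
  simp [interpolate]

theorem interpolate_const_mul (a : ℝ) (c : ℕ → ℝ) (s : ℝ) :
    interpolate (fun j => a * c j) s = a * interpolate c s := by
  simp only [interpolate]; ring

theorem interpolate_mem {c : ℕ → ℝ} {s a b : ℝ} (hs : 0 ≤ s) (h1 : a ≤ c ⌊s⌋₊) (h2 : c ⌊s⌋₊ ≤ b)
    (h3 : a ≤ c (⌊s⌋₊ + 1)) (h4 : c (⌊s⌋₊ + 1) ≤ b) :
    a ≤ interpolate c s ∧ interpolate c s ≤ b := by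
  have h5 := Nat.floor_le hs
  have h6 := (Nat.lt_floor_add_one s).le
  have e : interpolate c s = (1 - (s - ⌊s⌋₊)) * c ⌊s⌋₊ + (s - ⌊s⌋₊) * c (⌊s⌋₊ + 1) := by
    simp only [interpolate]; ring
  rw [e]
  constructor <;> nlinarith

theorem interpolate_monotone {c : ℕ → ℝ} (hc : Monotone c) {s s' : ℝ} (hs : 0 ≤ s) (h : s ≤ s') :
    interpolate c s ≤ interpolate c s' := by
  have hf : ⌊s⌋₊ ≤ ⌊s'⌋₊ := Nat.floor_mono h
  have h1 := hc (Nat.le_succ ⌊s⌋₊)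
  rcases hf.eq_or_lt with hf | hf
  · simp only [interpolate, ← hf]
    simp only [Nat.succ_eq_add_one] at h1
    nlinarith
  · have h2 := (interpolate_mem hs (le_refl (c ⌊s⌋₊)) h1 h1 le_rfl).2
    have h3 := hc (Nat.le_succ ⌊s'⌋₊)
    have h4 := (interpolate_mem (hs.trans h) (le_refl (c ⌊s'⌋₊)) h3 h3 le_rfl).1
    exact h2.trans ((hc hf).trans h4)

/-- A discrete intermediate value theorem: if `c K < y`, the last segment is solved for `y`,
otherwise it is dropped. It yields surjectivity of the reparametrization of the comb. -/
theorem exists_interpolate_eq {c : ℕ → ℝ} {K : ℕ} {y : ℝ} (h0 : c 0 ≤ y)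
    (hK : y ≤ c K) : ∃ s : ℝ, 0 ≤ s ∧ s ≤ K ∧ interpolate c s = y := by
  induction K with
  | zero => exact ⟨0, le_rfl, by simp, by simpa [interpolate] using le_antisymm h0 hK⟩
  | succ K ih =>
    rcases le_or_gt y (c K) with h | h
    · obtain ⟨s, h1, h2, h3⟩ := ih h
      exact ⟨s, h1, by push_cast; linarith, h3⟩
    · rcases hK.eq_or_lt with rfl | hlt
      · exact ⟨(K + 1 : ℕ), by positivity, le_rfl, interpolate_natCast _ _⟩
      have hpos : 0 < c (K + 1) - c K := by linarith
      have hθ0 : 0 ≤ (y - c K) / (c (K + 1) - c K) := div_nonneg (by linarith) hpos.le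
      have hθ1 : (y - c K) / (c (K + 1) - c K) < 1 := (div_lt_one hpos).2 (by linarith)
      have hfl : ⌊(K : ℝ) + (y - c K) / (c (K + 1) - c K)⌋₊ = K := by
        rw [Nat.floor_eq_iff (by positivity)]
        constructor <;> linarith
      refine ⟨K + (y - c K) / (c (K + 1) - c K), by positivity, by push_cast; linarith, ?_⟩
      rw [interpolate, hfl, add_sub_cancel_left, div_mul_cancel₀ _ hpos.ne']
      ring

theorem latticeCurve_apply {m : ℕ} (hm : 0 < m) (x y : ℕ → ℤ) (t : unitInterval) {s : ℝ}
    (hs : s = (t : ℝ) * ((m - 1 : ℕ) : ℝ)) :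
    polygonalCurve (planeVertices fun j : Fin m => latticePoint (x j) (y j)) t 0 =
        interpolate (fun j => (x j : ℝ)) s ∧
      polygonalCurve (planeVertices fun j : Fin m => latticePoint (x j) (y j)) t 1 =
        interpolate (fun j => (y j : ℝ)) s := by
  have := polygonalCurve_eq_lineMap hm (fun j => (latticePoint (x j) (y j)).toPlane) t hs
  rw [show (planeVertices fun j : Fin m => latticePoint (x j) (y j)) =
    fun j : Fin m => (latticePoint (x j) (y j)).toPlane from rfl, this]
  simp [AffineMap.lineMap_apply, latticePoint_toPlane_zero, latticePoint_toPlane_one, interpolate,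
    add_comm]

theorem edist_plane_le_one {p q : EuclideanSpace ℝ (Fin 2)} (h0 : |p 0 - q 0| ≤ 1)
    (h1 : p 1 = q 1) : edist p q ≤ 1 := by
  rw [edist_dist, ENNReal.ofReal_le_one, EuclideanSpace.dist_eq, Real.sqrt_le_iff, one_pow]
  simp only [Fin.sum_univ_two, h1, Real.dist_eq, sub_self, abs_zero]
  refine ⟨zero_le_one, ?_⟩
  nlinarith [abs_nonneg (p 0 - q 0)]

/-- The query curve is at distance at most `1` from a comb whose teeth point to the right at all
positions that the query selects. -/
theorem curveDist_le_one {m k L : ℕ} (hm : 2 ≤ m) (hk : 2 ≤ k) {χ : ℕ → ℤ}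
    (hχ : ∀ j, χ j = 1 ∨ χ j = -1) {U : ℕ → ℕ} (hU : Monotone U) (hU0 : U 0 = 0)
    (hUk : U (k - 1) = m - 1) (hU1 : ∀ v, v % 3 ≠ 0 → U (v + 1) = U v)
    (hsel : ∀ v, v % 3 = 2 → χ (U v) = 1) :
    curveDist (fun j : Fin m => latticePoint (χ j) (L * (j : ℕ)))
      (fun v : Fin k => latticePoint (2 * ((v : ℕ) % 3 / 2 : ℕ)) (L * U v)) ≤ 1 := by
  have hm1 : (0 : ℝ) < (m - 1 : ℕ) := by exact_mod_cast (by lia : 0 < m - 1)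
  have hk1 : (0 : ℝ) < (k - 1 : ℕ) := by exact_mod_cast (by lia : 0 < k - 1)
  set c : ℕ → ℝ := fun v => (U v : ℝ) with hc
  have hcm : Monotone c := fun a b h => Nat.cast_le.2 (hU h)
  have hs0 : ∀ t : unitInterval, 0 ≤ (t : ℝ) * (k - 1 : ℕ) := fun t => mul_nonneg t.2.1 hk1.le
  have hs1 : ∀ t : unitInterval, (t : ℝ) * (k - 1 : ℕ) ≤ (k - 1 : ℕ) := fun t =>
    mul_le_of_le_one_left hk1.le t.2.2
  have hu0 : ∀ s, 0 ≤ s → 0 ≤ interpolate c s := fun s h =>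
    (interpolate_mem (c := c) (b := max (c ⌊s⌋₊) (c (⌊s⌋₊ + 1))) h (Nat.cast_nonneg _)
      (le_max_left _ _) (Nat.cast_nonneg _) (le_max_right _ _)).1
  have hu1 : ∀ t : unitInterval, interpolate c ((t : ℝ) * (k - 1 : ℕ)) ≤ (m - 1 : ℕ) := fun t => by
    refine (interpolate_monotone hcm (hs0 t) (hs1 t)).trans ?_
    simp only [interpolate_natCast, hc, hUk, le_refl]
  -- The query is traversed at its own speed, and the comb is always at the height of the query.
  let f : unitInterval → unitInterval := fun t =>
    ⟨interpolate c ((t : ℝ) * (k - 1 : ℕ)) / (m - 1 : ℕ), div_nonneg (hu0 _ (hs0 t)) hm1.le,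
      (div_le_one hm1).2 (hu1 t)⟩
  have hf : Monotone f := fun t t' h => by
    have h' : (t : ℝ) ≤ t' := h
    exact div_le_div_of_nonneg_right
      (interpolate_monotone hcm (hs0 t) (mul_le_mul_of_nonneg_right h' hk1.le)) hm1.le
  have hfs : Function.Surjective f := fun y => by
    obtain ⟨s, h1, h2, h3⟩ := exists_interpolate_eq (c := c) (K := k - 1)
      (y := (y : ℝ) * (m - 1 : ℕ)) (by simp [hc, hU0]; exact mul_nonneg y.2.1 (by positivity))
      (by simp only [hc, hUk]; exact mul_le_of_le_one_left hm1.le y.2.2)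
    refine ⟨⟨s / (k - 1 : ℕ), div_nonneg h1 hk1.le, (div_le_one hk1).2 h2⟩, Subtype.ext ?_⟩
    simp only [f]
    rw [div_mul_cancel₀ _ hk1.ne', h3, mul_div_cancel_right₀ _ hm1.ne']
  refine (iInf₂_le_of_le f id (iInf₂_le_of_le ⟨hf, hfs⟩ ⟨monotone_id, Function.surjective_id⟩
    (iSup_le fun t => ?_)))
  set s : ℝ := (t : ℝ) * (k - 1 : ℕ) with hs
  have hft : interpolate c s = (f t : ℝ) * (m - 1 : ℕ) := by
    simp only [f]
    rw [div_mul_cancel₀ _ hm1.ne']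
  obtain ⟨hPx, hPy⟩ := latticeCurve_apply (by lia : 0 < m) χ (fun j => L * (j : ℕ)) (f t) hft
  obtain ⟨hQx, hQy⟩ := latticeCurve_apply (by lia : 0 < k)
    (fun v => 2 * ((v : ℕ) % 3 / 2 : ℕ)) (fun v => L * U v) t hs
  have hχ' : ∀ j, -1 ≤ (χ j : ℝ) ∧ (χ j : ℝ) ≤ 1 := fun j => by
    rcases hχ j with h | h <;> simp [h]
  apply edist_plane_le_one
  · rw [hPx, id, hQx]
    obtain ⟨hp1, hp2⟩ := interpolate_mem (c := fun j => (χ j : ℝ)) (hu0 s (hs0 t)) (hχ' _).1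
      (hχ' _).2 (hχ' _).1 (hχ' _).2
    -- On segments starting at a multiple of `3` the query climbs along `x = 0`, within `1` of every
    -- point of the comb at the same height. On all other segments the height is constant, the comb
    -- waits at a tooth with `x = 1`, and the query has `x` between `0` and `2`.
    by_cases h3 : ⌊s⌋₊ % 3 = 0
    · have : interpolate (fun v : ℕ => ((2 * (v % 3 / 2 : ℕ) : ℤ) : ℝ)) s = 0 := by
        have h4 : (⌊s⌋₊ + 1) % 3 / 2 = 0 := by lia
        simp [interpolate, h3, h4]
      rw [this, sub_zero, abs_le]
      exact ⟨hp1, hp2⟩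
    · have hnat : interpolate c s = (U ⌊s⌋₊ : ℕ) := by
        simp [interpolate, hc, hU1 _ h3]
      have hone : χ (U ⌊s⌋₊) = 1 := by
        by_cases h4 : ⌊s⌋₊ % 3 = 2
        · exact hsel _ h4
        · rw [← hU1 _ h3]; exact hsel _ (by lia)
      rw [hnat, interpolate_natCast, hone]
      have hx : ∀ v : ℕ, (0 : ℝ) ≤ ((2 * (v % 3 / 2 : ℕ) : ℤ) : ℝ) ∧
          ((2 * (v % 3 / 2 : ℕ) : ℤ) : ℝ) ≤ 2 := fun v => by
        have : v % 3 / 2 ≤ 1 := by lia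
        constructor
        · positivity
        · exact_mod_cast (by lia : 2 * ((v % 3 / 2 : ℕ) : ℤ) ≤ 2)
      obtain ⟨hq1, hq2⟩ := interpolate_mem (c := fun v : ℕ => ((2 * (v % 3 / 2 : ℕ) : ℤ) : ℝ))
        (hs0 t) (hx _).1 (hx _).2 (hx _).1 (hx _).2
      rw [abs_le]
      push_cast at hq1 hq2 ⊢
      constructor <;> linarith
  · rw [hPy, id, hQy]
    simp only [Int.cast_mul, Int.cast_natCast, interpolate_const_mul]
    rw [interpolate_id]

/-- On the two segments at `p` the function rises from `-1` to at most `1`, hence with slope at most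
`2`. Farther away the right side is at least `1` and the bound is trivial. -/
theorem interpolate_le_of_eq_neg_one {χ : ℕ → ℝ} (hχ : ∀ j, χ j ≤ 1) {p : ℕ} (hp : χ p = -1)
    {u : ℝ} (hu : 0 ≤ u) : interpolate χ u ≤ -1 + 2 * |u - p| := by
  have h5 := Nat.floor_le hu
  have h6 := (Nat.lt_floor_add_one u).le
  have h7 := hχ ⌊u⌋₊
  have h8 := hχ (⌊u⌋₊ + 1)
  have h9 := le_abs_self (u - p)
  have h10 := neg_abs_le (u - p)
  rcases lt_trichotomy ⌊u⌋₊ p with h | h | h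
  · rcases (Nat.succ_le_of_lt h).eq_or_lt with h' | h'
    · have e : (p : ℝ) = ⌊u⌋₊ + 1 := by rw [← h']; push_cast; ring
      rw [interpolate, show ⌊u⌋₊ + 1 = p from h', hp]
      nlinarith
    · have e : (⌊u⌋₊ : ℝ) + 2 ≤ p := by exact_mod_cast h'
      have := (interpolate_mem (a := min (χ ⌊u⌋₊) (χ (⌊u⌋₊ + 1))) hu (min_le_left _ _) h7
        (min_le_right _ _) h8).2
      linarith
  · rw [interpolate, h, hp]
    subst h
    nlinarith
  · have e : (p : ℝ) + 1 ≤ ⌊u⌋₊ := by exact_mod_cast h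
    have := (interpolate_mem (a := min (χ ⌊u⌋₊) (χ (⌊u⌋₊ + 1))) hu (min_le_left _ _) h7
        (min_le_right _ _) h8).2
    linarith

/-- If the query selects a tooth that points to the left, then the curves are far apart. -/
theorem tooth_of_curveDist_lt {m k L : ℕ} (hm : 2 ≤ m) (hk : 2 ≤ k) (hL : 3 ≤ L) {χ : ℕ → ℤ}
    (hχ : ∀ j, χ j ≤ 1) {U : ℕ → ℕ} {δ : ℝ} (hδ : δ ^ 2 * (4 + (L : ℝ) ^ 2) ≤ 9 * (L : ℝ) ^ 2)
    (h : curveDist (fun j : Fin m => latticePoint (χ j) (L * (j : ℕ)))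
      (fun v : Fin k => latticePoint (2 * ((v : ℕ) % 3 / 2 : ℕ)) (L * U v)) < ENNReal.ofReal δ)
    {v : ℕ} (hvk : v < k) (hv : v % 3 = 2) : χ (U v) ≠ -1 := by
  intro hneg
  have hk1 : (0 : ℝ) < (k - 1 : ℕ) := by exact_mod_cast (by lia : 0 < k - 1)
  simp only [curveDist, frechetDist, iInf_lt_iff] at h
  obtain ⟨f, g, hf, hg, h⟩ := h
  have hvk' : (v : ℝ) ≤ (k - 1 : ℕ) := by exact_mod_cast (by lia : v ≤ k - 1)
  obtain ⟨t, ht⟩ := hg.2 ⟨(v : ℝ) / (k - 1 : ℕ), by positivity, (div_le_one hk1).2 hvk'⟩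
  have hlt := (le_iSup (fun t => edist (polygonalCurve (planeVertices fun j : Fin m =>
    latticePoint (χ j) (L * (j : ℕ))) (f t)) (polygonalCurve (planeVertices fun v : Fin k =>
    latticePoint (2 * ((v : ℕ) % 3 / 2 : ℕ)) (L * U v)) (g t))) t).trans_lt h
  have hgt : (v : ℝ) = (g t : ℝ) * (k - 1 : ℕ) := by
    rw [ht]
    simp only
    rw [div_mul_cancel₀ _ hk1.ne']
  set u : ℝ := (f t : ℝ) * (m - 1 : ℕ) with hu
  have hu0 : 0 ≤ u := mul_nonneg (f t).2.1 (Nat.cast_nonneg _)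
  obtain ⟨hPx, hPy⟩ := latticeCurve_apply (by lia : 0 < m) χ (fun j => L * (j : ℕ)) (f t) hu
  obtain ⟨hQx, hQy⟩ := latticeCurve_apply (by lia : 0 < k)
    (fun v => 2 * ((v : ℕ) % 3 / 2 : ℕ)) (fun v => L * U v) (g t) hgt
  have hδ0 : 0 < δ := by
    by_contra! h0
    rw [ENNReal.ofReal_of_nonpos h0] at hlt
    exact not_lt_zero hlt
  rw [edist_dist, ENNReal.ofReal_lt_ofReal_iff hδ0, EuclideanSpace.dist_eq,
    Real.sqrt_lt' hδ0] at hlt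
  simp only [Fin.sum_univ_two, Real.dist_eq, sq_abs, hPx, hPy, hQx, hQy, interpolate_natCast, hv,
    Int.cast_mul, Int.cast_natCast, interpolate_const_mul, interpolate_id] at hlt
  have hx := interpolate_le_of_eq_neg_one (χ := fun j => (χ j : ℝ))
    (fun j => by exact_mod_cast hχ j) (p := U v) (by simp [hneg]) hu0
  set x := interpolate (fun j => (χ j : ℝ)) u
  set e := |u - U v| with he
  have he0 : 0 ≤ e := abs_nonneg _
  have hsq : ((L : ℝ) * u - L * U v) ^ 2 = (L : ℝ) ^ 2 * e ^ 2 := by rw [he, sq_abs]; ring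
  rw [hsq] at hlt
  have hL' : (3 : ℝ) ≤ L := by exact_mod_cast hL
  norm_num at hlt
  have hL9 : (9 : ℝ) ≤ (L : ℝ) ^ 2 := by nlinarith
  -- The quadratic `(3 - 2 e)² + L² e²` has its minimum `9 L² / (4 + L²)` at `e = 6 / (4 + L²)`; the
  -- difference is the square below. For `e ≥ 3 / 2` the vertical distance alone is large enough.
  have hmul : (9 : ℝ) * (L : ℝ) ^ 2 ≤ ((x - 2) ^ 2 + (L : ℝ) ^ 2 * e ^ 2) * (4 + (L : ℝ) ^ 2) := by
    rcases le_or_gt (3 / 2) e with h2 | h2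
    · have : (9 : ℝ) ≤ (L : ℝ) ^ 2 * e ^ 2 := by nlinarith
      nlinarith [sq_nonneg (x - 2)]
    · have h3 : (3 - 2 * e) ^ 2 ≤ (x - 2) ^ 2 := by nlinarith
      have h4 : ((3 - 2 * e) ^ 2 + (L : ℝ) ^ 2 * e ^ 2) * (4 + (L : ℝ) ^ 2) =
          9 * (L : ℝ) ^ 2 + ((4 + (L : ℝ) ^ 2) * e - 6) ^ 2 := by ring
      nlinarith [sq_nonneg ((4 + (L : ℝ) ^ 2) * e - 6)]
  have : ((x - 2) ^ 2 + (L : ℝ) ^ 2 * e ^ 2) * (4 + (L : ℝ) ^ 2) < δ ^ 2 * (4 + (L : ℝ) ^ 2) :=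
    mul_lt_mul_of_pos_right hlt (by positivity)
  linarith

/-! ### Combs and query curves of vectors

The coordinates of a vector are divided into blocks of length `len`. The position of a tooth of a
comb encodes a block (counted from `1`) and the content of this block. -/

theorem Nat.binary_sum {γ : ℕ → ℕ} (hγ : ∀ t, γ t ≤ 1) (n : ℕ) :
    ∑ t ∈ Finset.range n, γ t * 2 ^ t < 2 ^ n ∧
      ∀ t < n, (∑ t ∈ Finset.range n, γ t * 2 ^ t) / 2 ^ t % 2 = γ t := by
  induction n with
  | zero => simp
  | succ n ih =>
    rw [Finset.sum_range_succ]
    have h1 := hγ n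
    obtain ⟨h2, h3⟩ := ih
    refine ⟨?_, fun t ht => ?_⟩
    · have := Nat.mul_le_mul_right (2 ^ n) h1
      rw [pow_succ]; lia
    · rcases (Nat.lt_succ_iff_lt_or_eq.1 ht) with h | rfl
      · obtain ⟨e, rfl⟩ := Nat.exists_eq_add_of_lt h
        rw [show γ (t + e + 1) * 2 ^ (t + e + 1) = 2 ^ t * (2 * (γ (t + e + 1) * 2 ^ e)) by ring,
          Nat.add_mul_div_left _ _ (by positivity), Nat.add_mul_mod_self_left]
        exact h3 t h
      · rw [Nat.add_mul_div_right _ _ (by positivity), Nat.div_eq_of_lt h2]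
        lia

/-- The number of coordinates `l` with `α l = 1` of the block of position `j` at which the content
that is encoded by `j` is `1`. -/
def toothSum (len d : ℕ) (α : ℕ → ℕ) (j : ℕ) : ℕ :=
  ∑ l ∈ Finset.range d, α l * (j / 2 ^ (l % len) % 2) * (if l / len + 1 = j / 2 ^ len then 1 else 0)

/-- The direction of the tooth at position `j` of the comb of `α`. -/
def tooth (len d : ℕ) (α : ℕ → ℕ) (j : ℕ) : ℤ := if toothSum len d α j = 0 then 1 else -1

/-- The number that is encoded by block `q` of `β`. -/
def blockSum (len d : ℕ) (β : ℕ → ℕ) (q : ℕ) : ℕ :=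
  ∑ l ∈ Finset.range d, β l * 2 ^ (l % len) * (if l / len + 1 = q then 1 else 0)

/-- The position that encodes block `q` and its content in `β`. -/
def blockPos (len d : ℕ) (β : ℕ → ℕ) (q : ℕ) : ℕ := q * 2 ^ len + blockSum len d β q

theorem blockSum_zero (len d : ℕ) (β : ℕ → ℕ) : blockSum len d β 0 = 0 := by
  simp [blockSum]

/-- Substitute `l = q * len + t`. Missing coordinates of the last block become zero digits, so a
block content is always a binary number with `len` digits. -/
theorem blockSum_succ {len : ℕ} (hlen : 0 < len) (d : ℕ) (β : ℕ → ℕ) (q : ℕ) :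
    blockSum len d β (q + 1) =
      ∑ t ∈ Finset.range len, (if q * len + t < d then β (q * len + t) else 0) * 2 ^ t := by
  have e1 : blockSum len d β (q + 1) = ∑ l ∈ (Finset.range d).filter (fun l => l / len = q),
      β l * 2 ^ (l % len) := by
    rw [blockSum, Finset.sum_filter]
    refine Finset.sum_congr rfl fun l _ => ?_
    simp only [add_left_inj]
    split_ifs <;> simp
  have e2 : ∑ t ∈ Finset.range len, (if q * len + t < d then β (q * len + t) else 0) * 2 ^ t =
      ∑ t ∈ (Finset.range len).filter (fun t => q * len + t < d), β (q * len + t) * 2 ^ t := by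
    rw [Finset.sum_filter]
    refine Finset.sum_congr rfl fun t _ => ?_
    split_ifs <;> simp
  rw [e1, e2]
  refine Finset.sum_nbij' (fun l => l % len) (fun t => q * len + t) ?_ ?_ ?_ ?_ ?_
  · intro l hl
    simp only [Finset.mem_filter, Finset.mem_range] at hl ⊢
    refine ⟨Nat.mod_lt _ hlen, ?_⟩
    rw [← hl.2, Nat.div_add_mod']
    exact hl.1
  · intro t ht
    simp only [Finset.mem_filter, Finset.mem_range] at ht ⊢
    refine ⟨ht.2, ?_⟩
    rw [mul_comm, Nat.mul_add_div hlen, Nat.div_eq_of_lt ht.1, add_zero]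
  · intro l hl
    simp only [Finset.mem_filter, Finset.mem_range] at hl
    simp only [← hl.2, Nat.div_add_mod']
  · intro t ht
    simp only [Finset.mem_filter, Finset.mem_range] at ht
    simp only [Nat.mul_add_mod', Nat.mod_eq_of_lt ht.1]
  · intro l hl
    simp only [Finset.mem_filter, Finset.mem_range] at hl
    simp only [← hl.2, Nat.div_add_mod']

section

variable {len d : ℕ} (hlen : 0 < len) {β : ℕ → ℕ} (hβ : ∀ l, β l ≤ 1)

include hlen hβ

theorem blockSum_lt (q : ℕ) : blockSum len d β q < 2 ^ len := by
  cases q with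
  | zero => rw [blockSum_zero]; positivity
  | succ q =>
    rw [blockSum_succ hlen]
    exact (Nat.binary_sum (fun t => by split_ifs <;> simp [hβ]) len).1

theorem blockSum_bit {l : ℕ} (hl : l < d) :
    blockSum len d β (l / len + 1) / 2 ^ (l % len) % 2 = β l := by
  rw [blockSum_succ hlen]
  rw [(Nat.binary_sum (γ := fun t => if l / len * len + t < d then β (l / len * len + t) else 0)
    (fun t => by split_ifs <;> simp [hβ]) len).2 _ (Nat.mod_lt _ hlen), Nat.div_add_mod',
    if_pos hl]

theorem blockPos_div (q : ℕ) : blockPos len d β q / 2 ^ len = q := by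
  rw [blockPos, mul_comm, Nat.mul_add_div (by positivity), Nat.div_eq_of_lt (blockSum_lt hlen hβ q),
    add_zero]

/-- The block number contributes a multiple of `2 ^ len`, which does not affect the lower binary
digits. -/
theorem blockPos_bit {l : ℕ} (hl : l < d) :
    blockPos len d β (l / len + 1) / 2 ^ (l % len) % 2 = β l := by
  obtain ⟨e, he⟩ := Nat.exists_eq_add_of_lt (Nat.mod_lt l hlen)
  rw [blockPos]
  have hpow : 2 ^ len = 2 ^ (l % len) * (2 * 2 ^ e) := by
    conv_lhs => rw [he]
    ring
  rw [hpow, show (l / len + 1) * (2 ^ (l % len) * (2 * 2 ^ e)) =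
    2 ^ (l % len) * (2 * ((l / len + 1) * 2 ^ e)) by ring, Nat.mul_add_div (by positivity),
    Nat.mul_add_mod]
  exact blockSum_bit hlen hβ hl

/-- At the position that encodes block `q` of `β`, the digits that enter the sum are the coordinates
of `β`. The sum is then the inner product of the two blocks with this number, so one tooth tests one
block. -/
theorem toothSum_blockPos_eq_zero_iff (α : ℕ → ℕ) (q : ℕ) :
    toothSum len d α (blockPos len d β q) = 0 ↔ ∀ l < d, l / len + 1 = q → α l * β l = 0 := by
  rw [toothSum, Finset.sum_eq_zero_iff]
  simp only [Finset.mem_range, blockPos_div hlen hβ]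
  refine forall₂_congr fun l hl => ?_
  by_cases h : l / len + 1 = q
  · subst h
    rw [blockPos_bit hlen hβ hl]
    simp
  · simp [h]

theorem blockPos_lt (q : ℕ) : blockPos len d β q < (q + 1) * 2 ^ len := by
  have := blockSum_lt (d := d) hlen hβ q
  rw [blockPos]
  lia

end

/-- The position that vertex `v` of the query curve of `β` points to. -/
def queryPos (len d K m : ℕ) (β : ℕ → ℕ) (v : ℕ) : ℕ :=
  if (v + 2) / 3 ≤ K then blockPos len d β ((v + 2) / 3) else m - 1

/-- The comb of the vector `α`. -/
def combCurve (L m len d : ℕ) (α : ℕ → ℕ) : Fin m → RatPoint :=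
  fun j => latticePoint (tooth len d α j) (L * (j : ℕ))

/-- The query curve of the vector `β`. -/
def queryCurve (L k m len d K : ℕ) (β : ℕ → ℕ) : Fin k → RatPoint :=
  fun v => latticePoint (2 * ((v : ℕ) % 3 / 2 : ℕ)) (L * queryPos len d K m β v)

theorem tooth_eq (len d : ℕ) (α : ℕ → ℕ) (j : ℕ) :
    tooth len d α j = 1 ∨ tooth len d α j = -1 := by
  unfold tooth; split_ifs <;> simp

/-- The conditions on the parameters under which combs and query curves encode orthogonality. -/
structure CombOk (k m len d K : ℕ) : Prop where
  len_pos : 0 < len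
  K_eq : K = (k - 2) / 3
  two_le : 2 ≤ k
  le_mul : d ≤ K * len
  lt : (K + 1) * 2 ^ len < m

section

variable {k m len d K : ℕ} (h : CombOk k m len d K)

include h

theorem CombOk.two_le_m : 2 ≤ m := by
  have := h.lt
  have : 1 ≤ (K + 1) * 2 ^ len := Nat.one_le_iff_ne_zero.2 (by positivity)
  lia

theorem CombOk.orthogonal_of_toothSum {α β : ℕ → ℕ} (hβ : ∀ l, β l ≤ 1)
    (h0 : ∀ q, 1 ≤ q → q ≤ K → toothSum len d α (blockPos len d β q) = 0) :
    ∀ l < d, α l * β l = 0 := fun l hl => by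
  have hlen := h.len_pos
  refine (toothSum_blockPos_eq_zero_iff hlen hβ α (l / len + 1)).1 (h0 _ (by lia) ?_) l hl rfl
  exact Nat.succ_le_of_lt (Nat.div_lt_of_lt_mul (by rw [mul_comm]; exact hl.trans_le h.le_mul))

theorem CombOk.queryPos_le {β : ℕ → ℕ} (hβ : ∀ l, β l ≤ 1) (v : ℕ) :
    queryPos len d K m β v ≤ m - 1 := by
  unfold queryPos
  split_ifs with h1
  · have h2 := blockPos_lt (d := d) h.len_pos hβ ((v + 2) / 3)
    have h3 : ((v + 2) / 3 + 1) * 2 ^ len ≤ (K + 1) * 2 ^ len := Nat.mul_le_mul_right _ (by lia)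
    have := h.lt
    lia
  · exact le_rfl

/-- The block number is the leading part of a position, so a later block lies higher whatever the
contents are. -/
theorem CombOk.queryPos_monotone {β : ℕ → ℕ} (hβ : ∀ l, β l ≤ 1) :
    Monotone (queryPos len d K m β) := fun v v' hv => by
  by_cases h1 : (v' + 2) / 3 ≤ K
  · have h2 : (v + 2) / 3 ≤ (v' + 2) / 3 := Nat.div_le_div_right (by lia)
    rw [queryPos, queryPos, if_pos (h2.trans h1), if_pos h1]
    rcases h2.lt_or_eq with h3 | h3
    · have h4 := blockPos_lt (d := d) h.len_pos hβ ((v + 2) / 3)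
      have h5 : ((v + 2) / 3 + 1) * 2 ^ len ≤ (v' + 2) / 3 * 2 ^ len := Nat.mul_le_mul_right _ h3
      have h6 : (v' + 2) / 3 * 2 ^ len ≤ blockPos len d β ((v' + 2) / 3) := Nat.le_add_right _ _
      lia
    · rw [h3]
  · refine (h.queryPos_le hβ v).trans ?_
    rw [queryPos, if_neg h1]

theorem CombOk.curveDist_le_one {L : ℕ} {α β : ℕ → ℕ} (hβ : ∀ l, β l ≤ 1)
    (h0 : ∀ l < d, α l * β l = 0) :
    curveDist (combCurve L m len d α) (queryCurve L k m len d K β) ≤ 1 := by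
  have hk := h.two_le
  have hK := h.K_eq
  refine _root_.curveDist_le_one h.two_le_m hk (tooth_eq len d α) (h.queryPos_monotone hβ) ?_ ?_ ?_ ?_
  · simp [queryPos, blockPos, blockSum_zero]
  -- For the last vertex the block number is `(k + 1) / 3 = K + 1`, so the query ends at the height
  -- of the last tooth.
  · rw [queryPos, if_neg (by lia)]
  · intro v hv
    rw [queryPos, queryPos, show (v + 1 + 2) / 3 = (v + 2) / 3 by lia]
  · intro v hv
    rw [tooth, if_pos]
    unfold queryPos
    split_ifs with h1
    · rw [toothSum_blockPos_eq_zero_iff h.len_pos hβ]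
      exact fun l hl _ => h0 l hl
    -- An excursion beyond block `K` selects tooth `m - 1`. Its block number is at least `K + 1`, no
    -- coordinate belongs to it, and the tooth points to the right.
    · rw [toothSum, Finset.sum_eq_zero_iff]
      intro l hl
      rw [Finset.mem_range] at hl
      rw [if_neg, mul_zero]
      have h2 : K + 1 ≤ (m - 1) / 2 ^ len := by
        rw [Nat.le_div_iff_mul_le (by positivity)]
        have := h.lt
        lia
      have h3 : l / len < K := Nat.div_lt_of_lt_mul (by rw [mul_comm]; exact hl.trans_le h.le_mul)
      lia

theorem CombOk.orthogonal_of_curveDist_lt {L : ℕ} (hL : 3 ≤ L) {δ : ℝ}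
    (hδ : δ ^ 2 * (4 + (L : ℝ) ^ 2) ≤ 9 * (L : ℝ) ^ 2) {α β : ℕ → ℕ} (hβ : ∀ l, β l ≤ 1)
    (hd : curveDist (combCurve L m len d α) (queryCurve L k m len d K β) < ENNReal.ofReal δ) :
    ∀ l < d, α l * β l = 0 := by
  have hk := h.two_le
  have hK := h.K_eq
  refine h.orthogonal_of_toothSum hβ fun q hq1 hqK => ?_
  -- The tip of the excursion for block `q` is vertex `3 * q - 1`.
  have h1 := tooth_of_curveDist_lt h.two_le_m hk hL
    (fun j => by rcases tooth_eq len d α j with h | h <;> rw [h]; norm_num) hδ hd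
    (v := 3 * q - 1) (by lia) (by lia)
  have h2 : (3 * q - 1 + 2) / 3 = q := by lia
  rw [queryPos, h2, if_pos hqK, tooth] at h1
  by_contra h3
  exact h1 (if_neg h3)

/-- The data structure stores distinct curves, so distinct vectors must have distinct combs. The
tooth at the position of the unit vector for `l` reveals `α l`. -/
theorem CombOk.eq_of_combCurve_eq {L : ℕ} {α α' : ℕ → ℕ} (hα : ∀ l, α l ≤ 1) (hα' : ∀ l, α' l ≤ 1)
    (he : planeVertices (combCurve L m len d α) = planeVertices (combCurve L m len d α')) :
    ∀ l < d, α l = α' l := fun l hl => by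
  have hlen := h.len_pos
  let β : ℕ → ℕ := fun l' => if l' = l then 1 else 0
  have hβ : ∀ l', β l' ≤ 1 := fun l' => by simp only [β]; split_ifs <;> simp
  have hq : l / len < K := Nat.div_lt_of_lt_mul (by rw [mul_comm]; exact hl.trans_le h.le_mul)
  have hj : blockPos len d β (l / len + 1) < m := by
    have h2 := blockPos_lt (d := d) hlen hβ (l / len + 1)
    have h3 : (l / len + 1 + 1) * 2 ^ len ≤ (K + 1) * 2 ^ len := Nat.mul_le_mul_right _ (by lia)
    have := h.lt
    lia
  have h1 := congrArg (fun p => p 0) (congrFun he ⟨_, hj⟩)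
  simp only [planeVertices, combCurve, latticePoint_toPlane_zero, Int.cast_inj] at h1
  have key : ∀ a : ℕ → ℕ, toothSum len d a (blockPos len d β (l / len + 1)) = 0 ↔ a l = 0 := by
    intro a
    rw [toothSum_blockPos_eq_zero_iff hlen hβ]
    constructor
    · intro h2
      simpa [β] using h2 l hl rfl
    · intro h2 l' _ _
      by_cases h3 : l' = l
      · simp [h3, h2]
      · simp [β, h3]
  simp only [tooth, key] at h1
  have h2 := hα l
  have h3 := hα' l
  split_ifs at h1 <;> lia

end

/-! ### Procedures -/

instance : Add Ex := ⟨.bin .add⟩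
instance : Sub Ex := ⟨.bin .sub⟩
instance : Mul Ex := ⟨.bin .mul⟩
instance : Div Ex := ⟨.bin .div⟩
instance : Mod Ex := ⟨.bin .mod⟩

section

variable (e f : Ex) (s : St)

@[simp] theorem Ex.val_add : (e + f).val s = e.val s + f.val s := rfl
@[simp] theorem Ex.val_sub : (e - f).val s = e.val s - f.val s := rfl
@[simp] theorem Ex.val_mul : (e * f).val s = e.val s * f.val s := rfl
@[simp] theorem Ex.val_div : (e / f).val s = e.val s / f.val s := rfl
@[simp] theorem Ex.val_mod : (e % f).val s = e.val s % f.val s := rfl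

/-- A power with constant exponent. -/
def Ex.pow (e : Ex) : ℕ → Ex
  | 0 => .lit 1
  | j + 1 => e.pow j * e

@[simp] theorem Ex.val_pow (j : ℕ) : (e.pow j).val s = e.val s ^ j := by
  induction j with
  | zero => simp [Ex.pow]
  | succ j ih => simp [Ex.pow, ih, pow_succ]

/-- The expression with value `1` if `e` and `f` have the same value, and with value `0`
otherwise. -/
def Ex.eq (e f : Ex) : Ex := .lit 1 / (.lit 1 + (e - f) * (e - f))

@[simp] theorem Ex.val_eq : (e.eq f).val s = if e.val s = f.val s then 1 else 0 := by
  simp only [Ex.eq, Ex.val_lit, Ex.val_var, Ex.val_get, Ex.val_add,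
      Ex.val_sub, Ex.val_mul, Ex.val_div, Ex.val_mod]
  split_ifs with h
  · simp [h]
  · have : 0 < (e.val s - f.val s) * (e.val s - f.val s) := by
      exact mul_self_pos.2 (sub_ne_zero.2 h)
    exact Int.ediv_eq_zero_of_lt (by lia) (by lia)

end

/-- The numbers `N` and `d` and the vectors of an orthogonal vectors instance are in place. -/
structure Data (N d : ℕ) (fA fB : ℕ → ℕ → ℕ) (s : St) : Prop where
  N_eq : s.reg .N = N
  d_eq : s.reg .d = d
  memA : ∀ i < N, ∀ l < d, s.mem 0 ((i * d + l : ℕ) : ℤ) = fA i l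
  memB : ∀ i < N, ∀ l < d, s.mem 1 ((i * d + l : ℕ) : ℤ) = fB i l

theorem Data.congr {N d : ℕ} {fA fB : ℕ → ℕ → ℕ} {s s' : St} (h : Data N d fA fB s)
    (h1 : s'.reg .N = s.reg .N) (h2 : s'.reg .d = s.reg .d) (h3 : s'.mem 0 = s.mem 0)
    (h4 : s'.mem 1 = s.mem 1) : Data N d fA fB s' :=
  ⟨h1.trans h.N_eq, h2.trans h.d_eq, by rw [h3]; exact h.memA, by rw [h4]; exact h.memB⟩

theorem Data.frame {N d : ℕ} {fA fB : ℕ → ℕ → ℕ} {s s' : St} (h : Data N d fA fB s) {c : Cmd}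
    (hf : Frame c s s') (h1 : ¬ c.WritesVar .N) (h2 : ¬ c.WritesVar .d) (h3 : ¬ c.WritesBank 0)
    (h4 : ¬ c.WritesBank 1) : Data N d fA fB s' :=
  h.congr (hf.1 _ h1) (hf.1 _ h2) (hf.2 _ h3) (hf.2 _ h4)

/-- The inner product of two vectors. -/
def dot (d : ℕ) (α β : ℕ → ℕ) : ℕ := ∑ l ∈ Finset.range d, α l * β l

/-- Set `ans` to `1` if vector `idx` of the first set is orthogonal to vector `b` of the second. -/
def verify : Cmd :=
  .block [.asg .acc (.lit 0)] ;;
  forLoop .l .d (.block [.asg .acc (.var .acc + .get 0 (.var .idx * .var .d + .var .l) *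
    .get 1 (.var .b * .var .d + .var .l))]) ;;
  .ite (.lit 1 - .var .acc) (.block [.asg .ans (.lit 1)]) (.block [])

/-- The only place where `ans` becomes `1`; every positive answer is thereby justified by an actual
inner product. -/
theorem verify_ends {X : ℤ} (hX : 1 ≤ X) {N d : ℕ} {fA fB : ℕ → ℕ → ℕ} (hA : ∀ i l, fA i l ≤ 1)
    (hB : ∀ i l, fB i l ≤ 1) {s : St} (hs : Data N d fA fB s) {i j : ℕ} (hi : i < N) (hj : j < N)
    (hsi : s.reg .idx = i) (hsj : s.reg .b = j) :
    Ends X verify s (3 * d + 5)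
      (fun s' => s'.reg .ans = if dot d (fA i) (fB j) = 0 then 1 else s.reg .ans) := by
  refine (Ends.block_seq (U := (d * (1 + 2) + 2) + (1 + 1)) (fun _ => by simp; lia) fun _ =>
    Ends.seq (R := fun s' => s'.reg .acc = dot d (fA i) (fB j)) ((Ends.forLoop
      (I := fun c s' => s'.reg .acc = dot c (fA i) (fB j)) (n := d) (by lia) (by simp) (by simp)
      (by simp) (by simpa using hs.d_eq) (by simp [dot]) fun l hl s' hb hf hl' hI => ?_).mono le_rfl
      fun _ _ _ h => h) fun s' _ hf hR => ?_).mono (by lia) fun _ _ _ h => h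
  · have hd : s'.reg .d = d := by rw [hf.1 _ (by simp)]; simpa using hs.d_eq
    have hi' : s'.reg .idx = i := by rw [hf.1 _ (by simp)]; simpa using hsi
    have hj' : s'.reg .b = j := by rw [hf.1 _ (by simp)]; simpa using hsj
    have h0 : s'.mem 0 = s.mem 0 := by rw [hf.2 _ (by simp)]; simp
    have h1 : s'.mem 1 = s.mem 1 := by rw [hf.2 _ (by simp)]; simp
    have hA1 := hs.memA i hi l hl
    have hB1 := hs.memB j hj l hl
    push_cast at hA1 hB1
    have hdot : dot (l + 1) (fA i) (fB j) = dot l (fA i) (fB j) + fA i l * fB j l := by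
      rw [dot, Finset.sum_range_succ]; rfl
    have hle : dot (l + 1) (fA i) (fB j) ≤ l + 1 := by
      unfold dot
      refine (Finset.sum_le_card_nsmul _ _ 1 fun t _ => ?_).trans (by simp)
      nlinarith [hA i t, hB j t]
    have hv : (Ex.var .acc + .get 0 (.var .idx * .var .d + .var .l) *
        .get 1 (.var .b * .var .d + .var .l)).val s' = (dot (l + 1) (fA i) (fB j) : ℕ) := by
      simp only [Ex.val_lit, Ex.val_var, Ex.val_get, Ex.val_add,
      Ex.val_sub, Ex.val_mul, Ex.val_div, Ex.val_mod, hd, hi', hj', hl', h0, h1, hA1, hB1]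
      rw [show s'.reg .acc = _ from hI, hdot]
      push_cast; ring
    refine Ends.block (fun hb => ?_) ?_
    · have hdX := hb.1 .d
      rw [hd, Nat.abs_cast] at hdX
      simp only [OkIns, Ins.Ok, hv, and_true, Nat.abs_cast]
      lia
    · simp only [runIns, Ins.run, hv]
      simp
  · have hans : s'.reg .ans = s.reg .ans := by rw [hf.1 _ (by simp)]; simp
    have hv : (Ex.lit 1 - .var .acc).val s' = 1 - (dot d (fA i) (fB j) : ℕ) := by
      simp [hR]
    refine Ends.ite (fun h => Ends.block (fun _ => by simp; lia) ?_) fun h => Ends.block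
      (fun _ => trivial) ?_
    · rw [hv] at h
      rw [if_pos (by lia)]
      simp
    · rw [hv] at h
      rw [if_neg (by lia)]
      simpa using hans

/-- Fill bank `2` with the powers of two. -/
def powTable : Cmd :=
  .block [.asg .dl (.var .d + .lit 2), .asg .pw (.lit 1)] ;;
  forLoop .l .dl (.block [.sto 2 (.var .l) (.var .pw), .asg .pw (.lit 2 * .var .pw)])

/-- The machine has no shifts, so binary digits are extracted by division. The table reaches
exponent `d + 1`, the largest possible value of `len`. -/
theorem powTable_ends {X : ℤ} {d : ℕ} (hX : (2 : ℤ) ^ (d + 2) ≤ X) {s : St} (hs : s.reg .d = d) :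
    Ends X powTable s (3 * d + 9) (fun s' => ∀ t < d + 2, s'.mem 2 (t : ℤ) = 2 ^ t) := by
  have hd2 : ((d + 2 : ℕ) : ℤ) ≤ X := by
    have : d + 2 < 2 ^ (d + 2) := Nat.lt_two_pow_self
    have : ((d + 2 : ℕ) : ℤ) < 2 ^ (d + 2) := by exact_mod_cast this
    lia
  refine (Ends.block_seq (U := (d + 2) * (1 + 2) + 2) (fun _ => ?_) fun _ => (Ends.forLoop
      (I := fun c s' => s'.reg .pw = 2 ^ c ∧ ∀ t < c, s'.mem 2 (t : ℤ) = 2 ^ t) (n := d + 2)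
      (by lia) (by simp) (by simp) (by simp) (by simp [hs]) (by simp)
      fun l hl s' hb hf hl' hI => ?_).mono le_rfl
      fun _ _ _ h => h.2).mono (by lia) fun _ _ _ h => h
  · simp only [OkIns, Ins.Ok, Ex.val_lit, Ex.val_var, Ex.val_get, Ex.val_add,
      Ex.val_sub, Ex.val_mul, Ex.val_div, Ex.val_mod, hs, and_true]
    rw [abs_of_nonneg (by lia), abs_of_nonneg (by lia)]
    push_cast at hd2
    lia
  · obtain ⟨hp, ht⟩ := hI
    have hpow : (2 : ℤ) ^ (l + 1) ≤ X := le_trans (pow_le_pow_right₀ (by norm_num) (by lia)) hX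
    refine Ends.block (fun hb => ?_) ⟨?_, fun t htl => ?_⟩
    · simp only [OkIns, Ins.Ok, Ins.run, Ex.val_lit, Ex.val_var, Ex.val_get, Ex.val_add,
      Ex.val_sub, Ex.val_mul, Ex.val_div, Ex.val_mod, and_true]
      refine ⟨hb.1 _, ?_⟩
      rw [St.put_reg, hp, ← pow_succ', abs_of_nonneg (by positivity)]
      exact hpow
    · simp [hp, pow_succ']
    · simp only [runIns, Ins.run, Ex.val_lit, Ex.val_var, Ex.val_get, Ex.val_add,
      Ex.val_sub, Ex.val_mul, Ex.val_div, Ex.val_mod, St.set_mem, St.put_mem, if_true, hl', hp]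
      rw [Function.update_apply]
      rcases Nat.lt_succ_iff_lt_or_eq.1 htl with h | rfl
      · rw [if_neg (by lia), ht t h]
      · simp

/-! ### Writing the simulated memory -/

/-- A table that is filled up to position `c`. -/
def partTable (f : ℕ → ℤ) (c : ℕ) : ℤ → ℤ := fun a => if 0 ≤ a ∧ a < c then f a.toNat else 0

theorem update_partTable (f : ℕ → ℤ) (c : ℕ) :
    Function.update (partTable f c) (c : ℤ) (f c) = partTable f (c + 1) := by
  ext a
  rw [Function.update_apply]
  simp only [partTable]
  split_ifs with h1 h2 h3 h4
  · simp [h1]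
  · lia
  · rfl
  · lia
  · lia
  · rfl

theorem partTable_zero (f : ℕ → ℤ) : partTable f 0 = fun _ => 0 := by
  ext a; simp [partTable]

theorem partTable_congr {f g : ℕ → ℤ} {c : ℕ} (h : ∀ a < c, f a = g a) :
    partTable f c = partTable g c := by
  ext a
  simp only [partTable]
  split_ifs with h1
  · exact h _ (by lia)
  · rfl

/-- The configuration `st`, where the banks `b₀, …, b₀ + 3` hold the coordinates of the first `c`
vertices of a sequence of points with integer coordinates. -/
def withPoints (st : RamState) (b₀ : ℕ) (f g : ℕ → ℤ) (c : ℕ) : RamState where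
  reg := st.reg
  mem b := if b = b₀ then partTable f c else if b = b₀ + 1 then partTable (fun _ => 1) c
    else if b = b₀ + 2 then partTable g c else if b = b₀ + 3 then partTable (fun _ => 1) c
    else st.mem b

theorem withPoints_succ (st : RamState) (b₀ : ℕ) (f g : ℕ → ℤ) (c : ℕ) :
    ((((withPoints st b₀ f g c).setMem b₀ c (f c)).setMem (b₀ + 1) c 1).setMem (b₀ + 2) c
      (g c)).setMem (b₀ + 3) c 1 = withPoints st b₀ f g (c + 1) := by
  simp only [RamState.setMem, withPoints, RamState.mk.injEq, true_and]
  funext b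
  simp only [Function.update_apply]
  by_cases h0 : b = b₀
  · subst h0; simp [update_partTable]
  by_cases h1 : b = b₀ + 1
  · subst h1; simp [update_partTable (fun _ => 1)]
  by_cases h2 : b = b₀ + 2
  · subst h2; simp [update_partTable]
  by_cases h3 : b = b₀ + 3
  · subst h3; simp [update_partTable (fun _ => 1)]
  simp [h0, h1, h2, h3]

/-- Store the value of `f` into the cell `e` and log this. -/
def loggedStore (e f : Ex) : List Ins := .asg .x e :: .asg .y f :: logStore

/-- The values in the simulated memory are at most `X₀`, and `s` is obtained from `s₀` by `c` logged
changes. -/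
structure LogOk (X₀ : ℤ) (s₀ s : St) (c : ℕ) : Prop where
  mem : ∀ a, |s.mem 3 a| ≤ X₀
  logged : Logged s₀ s
  top : s.reg .top = s₀.reg .top + c

theorem LogOk.congr {X₀ : ℤ} {s₀ s s' : St} {c : ℕ} (h : LogOk X₀ s₀ s c)
    (h1 : s'.reg .top = s.reg .top) (h3 : s'.mem 3 = s.mem 3) (h4 : s'.mem 4 = s.mem 4)
    (h5 : s'.mem 5 = s.mem 5) : LogOk X₀ s₀ s' c :=
  ⟨by rw [h3]; exact h.mem, h.logged.congr rfl rfl rfl rfl h1 h3 h4 h5, by rw [h1, h.top]⟩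

theorem loggedStore_ends {X X₀ : ℤ} (hXX : X₀ ≤ X) {e f : Ex} {a z : ℤ} {s₀ s : St} {c : ℕ}
    (hs : LogOk X₀ s₀ s c) (ht : s₀.reg .top + c + 1 ≤ X) (he : e.val s = a)
    (hf : ∀ u, f.val (s.set .x u) = z) (ha : |a| ≤ X) (hz : |z| ≤ X₀) :
    Ends X (.block (loggedStore e f)) s 1 (fun s' => LogOk X₀ s₀ s' (c + 1) ∧
      s'.mem 3 = Function.update (s.mem 3) a z) := by
  have h0 := hs.logged.top_nonneg
  have htop := hs.top
  set s₁ := runIns [.asg .x e, .asg .y f] s with hs₁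
  have hrun : runIns (loggedStore e f) s = runIns logStore s₁ := rfl
  have hx : s₁.reg .x = a := by simp [hs₁, he]
  have hy : s₁.reg .y = z := by simp [hs₁, hf]
  have ht₁ : s₁.reg .top = s.reg .top := by simp [hs₁]
  have hm : s₁.mem = s.mem := rfl
  refine Ends.block (fun hb => ⟨?_, ?_, ?_⟩) ⟨⟨fun x => ?_, ?_, ?_⟩, ?_⟩
  · simpa [he] using ha
  · simpa [hf] using hz.trans hXX
  · refine logStore_ok (s := s₁) (runIns_bdd hb ⟨by simpa [he] using ha, ?_⟩) ?_
    · simpa [hf] using hz.trans hXX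
    · rw [ht₁, abs_of_nonneg (by lia)]; lia
  · rw [hrun, logStore_mem, hx, hy, hm, Function.update_apply]
    split_ifs
    · exact hz
    · exact hs.mem x
  · rw [hrun]
    exact (hs.logged.congr (s' := s₁) rfl rfl rfl rfl ht₁ rfl rfl rfl).trans
      (logStore_ext (by lia))
  · rw [hrun, logStore_top, ht₁, htop]; push_cast; ring
  · rw [hrun, logStore_mem, hx, hy, hm]

/-- Store `f` into cell `a` of bank `b` of the simulated machine. -/
def putMem (D : ℕ) (sl : ℕ → ℕ) (b : ℕ) (f : Ex) : Cmd :=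
  .block (loggedStore (.var .a * .lit D + .lit (sl b)) f)

/-- Write vertex number `a` of a curve; the coordinates are in `z` and `pw`. -/
def putPoint (D : ℕ) (sl : ℕ → ℕ) (b₀ : ℕ) : Cmd :=
  putMem D sl b₀ (.var .z) ;; putMem D sl (b₀ + 1) (.lit 1) ;;
    putMem D sl (b₀ + 2) (.var .pw) ;; putMem D sl (b₀ + 3) (.lit 1)

@[simp] theorem putPoint_writesVar (D : ℕ) (sl : ℕ → ℕ) (b₀ : ℕ) (v : PVar) :
    (putPoint D sl b₀).WritesVar v ↔ v = .x ∨ v = .y ∨ v = .top := by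
  simp [putPoint, putMem, loggedStore, logStore]

@[simp] theorem putPoint_writesBank (D : ℕ) (sl : ℕ → ℕ) (b₀ b : ℕ) :
    (putPoint D sl b₀).WritesBank b ↔ b = 3 ∨ b = 4 ∨ b = 5 := by
  simp [putPoint, putMem, loggedStore, logStore]
  tauto

section

variable {D B : ℕ} {sl : ℕ → ℕ} {X X₀ : ℤ}

/-- The proposition `P` separates two claims: bounds and log are correct always, and the simulated
configuration is the intended one if it was so before. The unconditional part is needed when the
guessed parameters are wrong. -/
theorem putMem_ends (hsl : SlotsOk D B sl) (hXX : X₀ ≤ X) {f : Ex} {z : ℤ}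
    {s₀ s : St} {c : ℕ} (hs : LogOk X₀ s₀ s c) (ht : s₀.reg .top + c + 1 ≤ X) {b : ℕ} (hb : b < B)
    {a : ℕ} (ha : s.reg .a = a) (haX : ((a + 1) * D : ℕ) ≤ X) (hf : ∀ u, f.val (s.set .x u) = z)
    (hz : |z| ≤ X₀) {st : RamState} {P : Prop}
    (hst : P → Holds D B sl (s.mem 3) st) :
    Ends X (putMem D sl b f) s 1 (fun s' => LogOk X₀ s₀ s' (c + 1) ∧
      (P → Holds D B sl (s'.mem 3) (st.setMem b a z))) := by
  refine (loggedStore_ends hXX hs ht (a := (a : ℤ) * D + sl b) (by simp [ha]) hf ?_ hz).mono le_rfl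
    fun s' _ _ h => ⟨h.1, ?_⟩
  · have := (hsl.1 b hb).2
    rw [abs_of_nonneg (by positivity)]
    push_cast at haX
    have : ((sl b : ℕ) : ℤ) < D := by exact_mod_cast this
    lia
  · rw [h.2]
    exact fun hP => (hst hP).setMem hsl hb _ _

theorem putPoint_ends (hsl : SlotsOk D B sl) (hXX : X₀ ≤ X) (hX₀ : 1 ≤ X₀)
    {s₀ s : St} {c : ℕ} (hs : LogOk X₀ s₀ s c) (ht : s₀.reg .top + c + 4 ≤ X) {b₀ : ℕ}
    (hb : b₀ + 3 < B) {a : ℕ} (ha : s.reg .a = a) (haX : ((a + 1) * D : ℕ) ≤ X) {f g : ℕ → ℤ}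
    (hf : s.reg .z = f a) (hg : s.reg .pw = g a) (hfX : |f a| ≤ X₀) (hgX : |g a| ≤ X₀)
    {st : RamState} {P : Prop} (hst : P → Holds D B sl (s.mem 3) (withPoints st b₀ f g a)) :
    Ends X (putPoint D sl b₀) s 4 (fun s' => LogOk X₀ s₀ s' (c + 4) ∧
      (P → Holds D B sl (s'.mem 3) (withPoints st b₀ f g (a + 1)))) := by
  have h1X : |(1 : ℤ)| ≤ X₀ := by simpa using hX₀
  refine (Ends.seq (putMem_ends hsl hXX hs (by lia) (by lia) ha haX (by simpa using hf) hfX hst)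
    (U := 1 + (1 + 1)) fun s₁ _ hf₁ h₁ => ?_).mono le_rfl fun _ _ _ h => h
  have ha₁ : s₁.reg .a = a := by rw [hf₁.1 _ (by simp [putMem, loggedStore, logStore]), ha]
  have hg₁ : s₁.reg .pw = g a := by rw [hf₁.1 _ (by simp [putMem, loggedStore, logStore]), hg]
  refine Ends.seq (putMem_ends hsl hXX h₁.1 (by lia) (b := b₀ + 1) (by lia) ha₁ haX (z := 1)
    (by simp) h1X h₁.2) fun s₂ _ hf₂ h₂ => ?_
  have ha₂ : s₂.reg .a = a := by rw [hf₂.1 _ (by simp [putMem, loggedStore, logStore]), ha₁]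
  have hg₂ : s₂.reg .pw = g a := by rw [hf₂.1 _ (by simp [putMem, loggedStore, logStore]), hg₁]
  refine Ends.seq (putMem_ends hsl hXX h₂.1 (by lia) (b := b₀ + 2) (by lia) ha₂ haX
    (by simpa using hg₂) hgX h₂.2) fun s₃ _ hf₃ h₃ => ?_
  have ha₃ : s₃.reg .a = a := by rw [hf₃.1 _ (by simp [putMem, loggedStore, logStore]), ha₂]
  refine (putMem_ends hsl hXX h₃.1 (by lia) (b := b₀ + 3) (by lia) ha₃ haX (z := 1)
    (by simp) h1X h₃.2).mono le_rfl fun s₄ _ _ h₄ => ⟨h₄.1, ?_⟩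
  rw [← withPoints_succ]
  exact h₄.2

end

/-! ### Writing the input and query curves -/

/-- The variables that describe a data structure with `n` combs with `m` teeth and queries with `k`
vertices, and the tables, are in place. -/
structure Env (N d : ℕ) (fA fB : ℕ → ℕ → ℕ) (n m k K len : ℕ) (w : ℤ) (s : St) : Prop
    extends Data N d fA fB s where
  n_eq : s.reg .n = n
  m_eq : s.reg .m = m
  k_eq : s.reg .k = k
  K_eq : s.reg .K = K
  len_eq : s.reg .len = len
  S_eq : s.reg .S = 2 ^ len
  W_eq : s.reg .W = w
  pow_eq : ∀ t < d + 2, s.mem 2 (t : ℤ) = 2 ^ t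

section

variable {N d : ℕ} {fA fB : ℕ → ℕ → ℕ} {n m k K len : ℕ} {w : ℤ}

theorem Env.congr {s s' : St} (h : Env N d fA fB n m k K len w s)
    (hv : ∀ v ∈ [PVar.N, .d, .n, .m, .k, .K, .len, .S, .W], s'.reg v = s.reg v)
    (hb : ∀ b ∈ [0, 1, 2], s'.mem b = s.mem b) : Env N d fA fB n m k K len w s' := by
  simp only [List.mem_cons, List.not_mem_nil, or_false, forall_eq_or_imp, forall_eq] at hv hb
  obtain ⟨h1, h2, h3, h4, h5, h6, h7, h8, h9⟩ := hv
  obtain ⟨b1, b2, b3⟩ := hb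
  exact ⟨h.toData.congr h1 h2 b1 b2, h3.trans h.n_eq, h4.trans h.m_eq, h5.trans h.k_eq,
    h6.trans h.K_eq, h7.trans h.len_eq, h8.trans h.S_eq, h9.trans h.W_eq, by rw [b3]; exact h.pow_eq⟩

theorem Env.frame {s s' : St} (h : Env N d fA fB n m k K len w s) {c : Cmd} (hf : Frame c s s')
    (hv : ∀ v ∈ [PVar.N, .d, .n, .m, .k, .K, .len, .S, .W], ¬ c.WritesVar v)
    (hb : ∀ b ∈ [0, 1, 2], ¬ c.WritesBank b) : Env N d fA fB n m k K len w s' :=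
  h.congr (fun v hvl => hf.1 v (hv v hvl)) (fun b hbl => hf.2 b (hb b hbl))

end

/-- Add coordinate `l` of vector `idx` to the sum of tooth `j`. -/
def toothStep : Cmd :=
  .block [.asg .acc (.var .acc + .get 0 (.var .idx * .var .d + .var .l) *
    (.var .j / .get 2 (.var .l % .var .len) % .lit 2) *
    (.var .l / .var .len + .lit 1 : Ex).eq (.var .j / .var .S))]

/-- Write tooth number `a` of the concatenation of the combs of group `h`. -/
def writeTooth (L D : ℕ) (sl : ℕ → ℕ) : Cmd :=
  .block [.asg .j (.var .a % .var .m),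
    .asg .idx ((.var .h * .var .n + .var .a / .var .m) % .var .N), .asg .acc (.lit 0)] ;;
  forLoop .l .d toothStep ;;
  .block [.asg .z (.lit 2 * (.lit 1 / (.lit 1 + .var .acc)) - .lit 1),
    .asg .pw (.lit L * .var .j)] ;;
  putPoint D sl 0

/-- Write the combs of group `h`. -/
def writeCurves (L D : ℕ) (sl : ℕ → ℕ) : Cmd :=
  .block [.asg .nm (.var .n * .var .m)] ;; forLoop .a .nm (writeTooth L D sl)

/-- Add coordinate `l` of vector `b` to the position for block `q`. -/
def blockStep : Cmd :=
  .block [.asg .acc (.var .acc + .get 1 (.var .b * .var .d + .var .l) *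
    .get 2 (.var .l % .var .len) * (.var .l / .var .len + .lit 1 : Ex).eq (.var .q))]

/-- Write vertex number `a` of the query curve of vector `b`. -/
def writeVertex (L D : ℕ) (sl : ℕ → ℕ) : Cmd :=
  .block [.asg .q ((.var .a + .lit 2) / .lit 3), .asg .acc (.lit 0)] ;;
  forLoop .l .d blockStep ;;
  .block [.asg .z (.lit 2 * (.var .a % .lit 3 / .lit 2)),
    .asg .pw (.lit L * ((.lit 1 - .var .q / (.var .K + .lit 1)) *
      (.var .q * .var .S + .var .acc) + .var .q / (.var .K + .lit 1) * (.var .m - .lit 1)))] ;;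
  putPoint D sl 4

/-- Write the query curve of vector `b`. -/
def writeQuery (L D : ℕ) (sl : ℕ → ℕ) : Cmd := forLoop .a .k (writeVertex L D sl)

/-! ### Correctness of the code that writes combs and query curves. -/

theorem toothSum_succ (len d : ℕ) (α : ℕ → ℕ) (j : ℕ) : toothSum len (d + 1) α j =
    toothSum len d α j +
      α d * (j / 2 ^ (d % len) % 2) * (if d / len + 1 = j / 2 ^ len then 1 else 0) :=
  Finset.sum_range_succ _ _

theorem blockSum_succ_dim (len d : ℕ) (β : ℕ → ℕ) (q : ℕ) : blockSum len (d + 1) β q =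
    blockSum len d β q + β d * 2 ^ (d % len) * (if d / len + 1 = q then 1 else 0) :=
  Finset.sum_range_succ _ _

theorem toothSum_le {α : ℕ → ℕ} (hα : ∀ l, α l ≤ 1) (len d j : ℕ) : toothSum len d α j ≤ d := by
  refine (Finset.sum_le_card_nsmul _ _ 1 fun l _ => ?_).trans (by simp)
  have h1 : j / 2 ^ (l % len) % 2 ≤ 1 := by lia
  have h2 : (if l / len + 1 = j / 2 ^ len then 1 else 0) ≤ 1 := by split_ifs <;> simp
  calc _ ≤ 1 * 1 * 1 := Nat.mul_le_mul (Nat.mul_le_mul (hα l) h1) h2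
    _ = 1 := by norm_num

theorem two_mul_one_div_sub_one (t : ℕ) :
    2 * (1 / (1 + (t : ℤ))) - 1 = if t = 0 then 1 else -1 := by
  split_ifs with h
  · simp [h]
  · rw [Int.ediv_eq_zero_of_lt (by lia) (by lia)]; norm_num

section

variable {D B : ℕ} {sl : ℕ → ℕ} {X X₀ : ℤ} {N d : ℕ} {fA fB : ℕ → ℕ → ℕ} {n m k K len L : ℕ}
  {w : ℤ}

theorem toothStep_ends (hA : ∀ i l, fA i l ≤ 1) (hlen : 0 < len) (hld : len ≤ d + 1) {s : St}
    (hs : Env N d fA fB n m k K len w s) {i j l : ℕ} (hi : i < N) (hl : l < d)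
    (hsi : s.reg .idx = i) (hsj : s.reg .j = j) (hsl : s.reg .l = l)
    (hacc : s.reg .acc = toothSum len l (fA i) j) :
    Ends X toothStep s 1 (fun s' => s'.reg .acc = toothSum len (l + 1) (fA i) j) := by
  have hA1 := hs.memA i hi l hl
  have hp := hs.pow_eq (l % len) (by have := Nat.mod_lt l hlen; lia)
  push_cast at hA1 hp
  have hc : ((l : ℤ) / len + 1 = j / 2 ^ len) ↔ (l / len + 1 = j / 2 ^ len) := by
    exact_mod_cast Iff.rfl
  have hv : (Ex.var .acc + .get 0 (.var .idx * .var .d + .var .l) *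
      (.var .j / .get 2 (.var .l % .var .len) % .lit 2) *
      (.var .l / .var .len + .lit 1 : Ex).eq (.var .j / .var .S)).val s =
      (toothSum len (l + 1) (fA i) j : ℕ) := by
    simp only [Ex.val_lit, Ex.val_var, Ex.val_get, Ex.val_add,
      Ex.val_sub, Ex.val_mul, Ex.val_div, Ex.val_mod, Ex.val_eq, hs.d_eq, hsi, hsj, hsl, hA1, hs.len_eq, hp, hs.S_eq,
      hacc, toothSum_succ, hc]
    push_cast
    rfl
  refine Ends.block (fun hb => ?_) ?_
  · have hdX := hb.1 .d
    rw [hs.d_eq, Nat.abs_cast] at hdX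
    have := toothSum_le (hA i) len (l + 1) j
    simp only [OkIns, Ins.Ok, hv, and_true, Nat.abs_cast]
    lia
  · simp only [runIns, Ins.run, hv]
    simp

/-- The first coordinate of tooth number `a` of the concatenation of the combs of a group. -/
def groupTooth (len d N n m h : ℕ) (fA : ℕ → ℕ → ℕ) (a : ℕ) : ℤ :=
  tooth len d (fA ((h * n + a / m) % N)) (a % m)

/-- The second coordinate of tooth number `a` of the concatenation of the combs of a group. -/
def groupHeight (L m a : ℕ) : ℤ := (L * (a % m) : ℕ)

/-- Vector indices are taken modulo `N`: the last group wraps around, so each group consists of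
exactly `n` vectors. -/
theorem writeTooth_ends (hA : ∀ i l, fA i l ≤ 1) (hlen : 0 < len) (hld : len ≤ d + 1) (hN : 0 < N)
    (hsl : SlotsOk D B sl) (hB : 3 < B) (hX₀ : 1 ≤ X₀) (hXX : X₀ ≤ X) (hLm : ((L * m : ℕ) : ℤ) ≤ X₀)
    {s₀ s : St} (hs : Env N d fA fB n m k K len w s) {h a c : ℕ} (hsh : s.reg .h = h)
    (hsa : s.reg .a = a) (hm : 0 < m) (hlog : LogOk X₀ s₀ s c) (ht : s₀.reg .top + c + 4 ≤ X)
    (haX : ((a + 1) * D : ℕ) ≤ X) {st : RamState} {P : Prop}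
    (hst : P → Holds D B sl (s.mem 3)
      (withPoints st 0 (groupTooth len d N n m h fA) (groupHeight L m) a)) :
    Ends X (writeTooth L D sl) s (3 * d + 8) (fun s' => LogOk X₀ s₀ s' (c + 4) ∧
      (P → Holds D B sl (s'.mem 3)
        (withPoints st 0 (groupTooth len d N n m h fA) (groupHeight L m) (a + 1)))) := by
  set i := (h * n + a / m) % N with hi
  have hiN : i < N := Nat.mod_lt _ hN
  have hjm : a % m < m := Nat.mod_lt _ hm
  have vj : (Ex.var .a % .var .m).val s = (a % m : ℕ) := by
    simp [hsa, hs.m_eq]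
  have vi : ∀ z, ((Ex.var .h * .var .n + .var .a / .var .m) % .var .N).val (s.set .j z) =
      (i : ℕ) := fun z => by
    simp [hsa, hs.m_eq, hsh, hs.n_eq, hs.N_eq, hi]
  refine (Ends.block_seq (U := (d * (1 + 2) + 2) + (1 + 4)) (fun hb => ?_) fun _ => ?_).mono
    (by lia) fun _ _ _ h => h
  · have hmX := hb.1 .m
    have hNX := hb.1 .N
    rw [hs.m_eq, Nat.abs_cast] at hmX
    rw [hs.N_eq, Nat.abs_cast] at hNX
    simp only [OkIns, Ins.Ok, Ins.run, vj, vi, Nat.abs_cast, and_true, Ex.val_lit, Ex.val_var, Ex.val_get, Ex.val_add,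
      Ex.val_sub, Ex.val_mul, Ex.val_div, Ex.val_mod, abs_zero]
    lia
  set s₁ := runIns [.asg .j (.var .a % .var .m),
    .asg .idx ((.var .h * .var .n + .var .a / .var .m) % .var .N), .asg .acc (.lit 0)] s with hs₁
  have e₁ : Env N d fA fB n m k K len w s₁ := hs.congr (by simp [hs₁]) (by simp [hs₁])
  have j₁ : s₁.reg .j = (a % m : ℕ) := by
    simp only [hs₁, runIns, Ins.run, vj, vi]; simp
  have i₁ : s₁.reg .idx = (i : ℕ) := by
    simp only [hs₁, runIns, Ins.run, vj, vi]; simp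
  have c₁ : s₁.reg .acc = 0 := by simp [hs₁]
  have a₁ : s₁.reg .a = a := by simp [hs₁, hsa]
  have l₁ : LogOk X₀ s₀ s₁ c := hlog.congr (by simp [hs₁]) rfl rfl rfl
  have m₁ : s₁.mem 3 = s.mem 3 := rfl
  clear_value s₁
  refine Ends.seq (R := fun s' => s'.reg .acc = (toothSum len d (fA i) (a % m) : ℕ))
    ((Ends.forLoop (I := fun l s' => s'.reg .acc = (toothSum len l (fA i) (a % m) : ℕ)) (n := d)
      (by lia) (by simp) (by simp [toothStep]) (by simp [toothStep]) e₁.d_eq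
      (by simp [c₁, toothSum]) fun l hl s' hb hf hl' hI => ?_).mono le_rfl fun _ _ _ h => h)
    fun s₂ _ hf₂ hacc => ?_
  · have e' := e₁.frame hf (by simp [toothStep]) (by simp [toothStep])
    refine (toothStep_ends hA hlen hld e' hiN hl (by rw [hf.1 _ (by simp [toothStep]), i₁])
      (by rw [hf.1 _ (by simp [toothStep]), j₁]) hl' hI).mono le_rfl fun s'' _ _ h'' => ?_
    simpa using h''
  · have e₂ := e₁.frame hf₂ (by simp [toothStep]) (by simp [toothStep])
    have j₂ : s₂.reg .j = (a % m : ℕ) := by rw [hf₂.1 _ (by simp [toothStep]), j₁]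
    have a₂ : s₂.reg .a = a := by rw [hf₂.1 _ (by simp [toothStep]), a₁]
    have l₂ : LogOk X₀ s₀ s₂ c := l₁.congr (hf₂.1 _ (by simp [toothStep]))
      (hf₂.2 _ (by simp [toothStep])) (hf₂.2 _ (by simp [toothStep])) (hf₂.2 _ (by simp [toothStep]))
    have m₂ : s₂.mem 3 = s.mem 3 := by rw [hf₂.2 _ (by simp [toothStep]), m₁]
    have vz : (Ex.lit 2 * (.lit 1 / (.lit 1 + .var .acc)) - .lit 1 : Ex).val s₂ =
        groupTooth len d N n m h fA a := by
      simp only [Ex.val_lit, Ex.val_var, Ex.val_get, Ex.val_add,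
      Ex.val_sub, Ex.val_mul, Ex.val_div, Ex.val_mod, hacc, two_mul_one_div_sub_one]
      rfl
    have vp : ∀ z, (Ex.lit L * .var .j).val (s₂.set .z z) = groupHeight L m a := fun z => by
      simp [j₂, groupHeight]
    have hz1 : |groupTooth len d N n m h fA a| ≤ 1 := by
      rcases tooth_eq len d (fA ((h * n + a / m) % N)) (a % m) with h' | h' <;>
        simp [groupTooth, h']
    have hp1 : |groupHeight L m a| ≤ X₀ := by
      rw [groupHeight, Nat.abs_cast]
      have : L * (a % m) ≤ L * m := Nat.mul_le_mul_left _ hjm.le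
      lia
    refine Ends.block_seq (fun hb => ?_) fun _ => ?_
    · simp only [OkIns, Ins.Ok, Ins.run, vz, vp, and_true]
      lia
    · refine putPoint_ends hsl hXX hX₀ ?_ ht hB (a := a) ?_ haX ?_ ?_ (hz1.trans hX₀) hp1
        (st := st) ?_
      · exact l₂.congr (by simp) rfl rfl rfl
      · simp [a₂]
      · simp only [runIns, Ins.run, vz, vp]; simp
      · simp only [runIns, Ins.run, vz, vp]; simp
      · simp only [runIns, Ins.run, St.set_mem, m₂]
        exact hst

theorem writeCurves_ends (hA : ∀ i l, fA i l ≤ 1) (hlen : 0 < len) (hld : len ≤ d + 1) (hN : 0 < N)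
    (hsl : SlotsOk D B sl) (hB : 3 < B) (hX₀ : 1 ≤ X₀) (hXX : X₀ ≤ X) (hLm : ((L * m : ℕ) : ℤ) ≤ X₀)
    {s₀ s : St} (hs : Env N d fA fB n m k K len w s) {h c : ℕ} (hsh : s.reg .h = h)
    (hlog : LogOk X₀ s₀ s c) (ht : s₀.reg .top + c + 4 * (n * m) ≤ X) (hD : 0 < D)
    (hX : (n * m * D : ℕ) ≤ X) {st : RamState} {P : Prop} (hst : P → Holds D B sl (s.mem 3)
      (withPoints st 0 (groupTooth len d N n m h fA) (groupHeight L m) 0)) :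
    Ends X (writeCurves L D sl) s (n * m * (3 * d + 10) + 3) (fun s' =>
      LogOk X₀ s₀ s' (c + 4 * (n * m)) ∧ (P → Holds D B sl (s'.mem 3)
        (withPoints st 0 (groupTooth len d N n m h fA) (groupHeight L m) (n * m)))) := by
  have vn : (Ex.var .n * .var .m).val s = (n * m : ℕ) := by simp [hs.n_eq, hs.m_eq]
  have hnm : ((n * m : ℕ) : ℤ) ≤ X := by
    have : n * m ≤ n * m * D := Nat.le_mul_of_pos_right _ hD
    lia
  refine (Ends.block_seq (U := n * m * (3 * d + 8 + 2) + 2) (fun hb => ?_) fun _ => ?_).mono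
    (by lia) fun _ _ _ h => h
  · simp only [OkIns, Ins.Ok, vn, and_true, Nat.abs_cast]
    exact hnm
  refine (Ends.forLoop (I := fun a s' => LogOk X₀ s₀ s' (c + 4 * a) ∧ (P → Holds D B sl (s'.mem 3)
    (withPoints st 0 (groupTooth len d N n m h fA) (groupHeight L m) a))) (n := n * m)
    ?_ ?_ ?_ ?_ ?_ ?_ fun a ha s' hb hf ha' hI => ?_).mono le_rfl fun _ _ _ h => h
  · lia
  · simp
  · simp [writeTooth, toothStep]
  · simp [writeTooth, toothStep]
  · simp [hs.n_eq, hs.m_eq]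
  · exact ⟨hlog.congr (by simp) rfl rfl rfl, hst⟩
  have hm : 0 < m := by
    by_contra! h0
    obtain rfl : m = 0 := by lia
    simp at ha
  have e' : Env N d fA fB n m k K len w s' :=
    (hs.congr (by simp) (by simp)).frame hf (by simp [writeTooth, toothStep])
      (by simp [writeTooth, toothStep])
  have haD : (a + 1) * D ≤ n * m * D := Nat.mul_le_mul_right _ ha
  refine (writeTooth_ends hA hlen hld hN hsl hB hX₀ hXX hLm e' (h := h)
    (by rw [hf.1 _ (by simp [writeTooth, toothStep])]; simpa using hsh) ha' hm hI.1 ?_ ?_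
    hI.2).mono le_rfl fun s'' _ _ h'' => ⟨h''.1.congr (by simp) rfl rfl rfl, h''.2⟩
  · push_cast
    have : ((4 * (a + 1) : ℕ) : ℤ) ≤ (4 * (n * m) : ℕ) := by exact_mod_cast Nat.mul_le_mul_left 4 ha
    push_cast at this
    lia
  · lia

theorem blockStep_ends (hlen : 0 < len) (hld : len ≤ d + 1)
    (hB : ∀ i l, fB i l ≤ 1) (hX : (2 : ℤ) ^ (d + 2) ≤ X) {s : St}
    (hs : Env N d fA fB n m k K len w s) {j q l : ℕ} (hj : j < N) (hl : l < d)
    (hsj : s.reg .b = j) (hsq : s.reg .q = q) (hsl : s.reg .l = l)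
    (hacc : s.reg .acc = blockSum len l (fB j) q) :
    Ends X blockStep s 1 (fun s' => s'.reg .acc = blockSum len (l + 1) (fB j) q) := by
  have hB1 := hs.memB j hj l hl
  have hp := hs.pow_eq (l % len) (by have := Nat.mod_lt l hlen; lia)
  push_cast at hB1 hp
  have hc : ((l : ℤ) / len + 1 = q) ↔ (l / len + 1 = q) := by
    exact_mod_cast Iff.rfl
  have hv : (Ex.var .acc + .get 1 (.var .b * .var .d + .var .l) *
      .get 2 (.var .l % .var .len) * (.var .l / .var .len + .lit 1 : Ex).eq (.var .q)).val s =
      (blockSum len (l + 1) (fB j) q : ℕ) := by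
    simp only [Ex.val_lit, Ex.val_var, Ex.val_get, Ex.val_add,
      Ex.val_sub, Ex.val_mul, Ex.val_div, Ex.val_mod, Ex.val_eq, hs.d_eq, hsj, hsq, hsl, hB1, hs.len_eq, hp,
      hacc, blockSum_succ_dim, hc]
    push_cast
    rfl
  refine Ends.block (fun hb => ?_) ?_
  · have h1 := blockSum_lt (d := l + 1) hlen (hB j) q
    have h2 : 2 ^ len ≤ 2 ^ (d + 2) := Nat.pow_le_pow_right (by norm_num) (by lia)
    have h3 : ((blockSum len (l + 1) (fB j) q : ℕ) : ℤ) ≤ (2 ^ (d + 2) : ℕ) := by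
      exact_mod_cast (h1.le.trans h2)
    simp only [OkIns, Ins.Ok, hv, and_true, Nat.abs_cast]
    push_cast at h3
    lia
  · simp only [runIns, Ins.run, hv]
    simp

/-- The first coordinate of a vertex of a query curve. -/
def vertexX (v : ℕ) : ℤ := (2 * (v % 3 / 2) : ℕ)

/-- The second coordinate of a vertex of a query curve. -/
def vertexY (L len d K m : ℕ) (β : ℕ → ℕ) (v : ℕ) : ℤ := (L * queryPos len d K m β v : ℕ)

theorem writeVertex_ends (hB1 : ∀ i l, fB i l ≤ 1) (hlen : 0 < len) (hld : len ≤ d + 1)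
    (hX : (2 : ℤ) ^ (d + 2) ≤ X) (hsl : SlotsOk D B sl) (hB : 7 < B) (hX₀ : 2 ≤ X₀) (hXX : X₀ ≤ X)
    (hLm : ((L * ((K + 1) * 2 ^ len + m) : ℕ) : ℤ) ≤ X₀) (hK : K = (k - 2) / 3)
    (hm : 1 ≤ m) {s₀ s : St} (hs : Env N d fA fB n m k K len w s) {b a c : ℕ} (hbN : b < N)
    (hsb : s.reg .b = b) (hsa : s.reg .a = a) (hak : a < k) (hlog : LogOk X₀ s₀ s c)
    (ht : s₀.reg .top + c + 4 ≤ X) (haX : ((a + 1) * D : ℕ) ≤ X) {st : RamState} {P : Prop}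
    (hst : P → Holds D B sl (s.mem 3) (withPoints st 4 vertexX (vertexY L len d K m (fB b)) a)) :
    Ends X (writeVertex L D sl) s (3 * d + 8) (fun s' => LogOk X₀ s₀ s' (c + 4) ∧
      (P → Holds D B sl (s'.mem 3)
        (withPoints st 4 vertexX (vertexY L len d K m (fB b)) (a + 1)))) := by
  set q := (a + 2) / 3 with hq
  have vq : ((.var .a + .lit 2) / .lit 3 : Ex).val s = (q : ℕ) := by
    simp [hsa, hq]
  refine (Ends.block_seq (U := (d * (1 + 2) + 2) + (1 + 4)) (fun hb => ?_) fun _ => ?_).mono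
    (by lia) fun _ _ _ h => h
  · have haX' := hb.1 .a
    rw [hsa, Nat.abs_cast] at haX'
    simp only [OkIns, Ins.Ok, Ins.run, vq, Nat.abs_cast, and_true, Ex.val_lit, Ex.val_var, Ex.val_get, Ex.val_add,
      Ex.val_sub, Ex.val_mul, Ex.val_div, Ex.val_mod, abs_zero]
    lia
  set s₁ := runIns [.asg .q ((.var .a + .lit 2) / .lit 3), .asg .acc (.lit 0)] s with hs₁
  have e₁ : Env N d fA fB n m k K len w s₁ := hs.congr (by simp [hs₁]) (by simp [hs₁])
  have q₁ : s₁.reg .q = (q : ℕ) := by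
    simp only [hs₁, runIns, Ins.run, vq]; simp
  have b₁ : s₁.reg .b = b := by simp [hs₁, hsb]
  have c₁ : s₁.reg .acc = 0 := by simp [hs₁]
  have a₁ : s₁.reg .a = a := by simp [hs₁, hsa]
  have l₁ : LogOk X₀ s₀ s₁ c := hlog.congr (by simp [hs₁]) rfl rfl rfl
  have m₁ : s₁.mem 3 = s.mem 3 := rfl
  clear_value s₁
  refine Ends.seq (R := fun s' => s'.reg .acc = (blockSum len d (fB b) q : ℕ))
    ((Ends.forLoop (I := fun l s' => s'.reg .acc = (blockSum len l (fB b) q : ℕ)) (n := d)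
      (by lia) (by simp) (by simp [blockStep]) (by simp [blockStep]) e₁.d_eq
      (by simp [c₁, blockSum]) fun l hl s' hb hf hl' hI => ?_).mono le_rfl fun _ _ _ h => h)
    fun s₂ _ hf₂ hacc => ?_
  · have e' := e₁.frame hf (by simp [blockStep]) (by simp [blockStep])
    refine (blockStep_ends hlen hld hB1 hX e' hbN hl (by rw [hf.1 _ (by simp [blockStep]), b₁])
      (by rw [hf.1 _ (by simp [blockStep]), q₁]) hl' hI).mono le_rfl fun s'' _ _ h'' => ?_
    simpa using h''
  · have e₂ := e₁.frame hf₂ (by simp [blockStep]) (by simp [blockStep])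
    have q₂ : s₂.reg .q = (q : ℕ) := by rw [hf₂.1 _ (by simp [blockStep]), q₁]
    have a₂ : s₂.reg .a = a := by rw [hf₂.1 _ (by simp [blockStep]), a₁]
    have l₂ : LogOk X₀ s₀ s₂ c := l₁.congr (hf₂.1 _ (by simp [blockStep]))
      (hf₂.2 _ (by simp [blockStep])) (hf₂.2 _ (by simp [blockStep])) (hf₂.2 _ (by simp [blockStep]))
    have m₂ : s₂.mem 3 = s.mem 3 := by rw [hf₂.2 _ (by simp [blockStep]), m₁]
    have vz : (.lit 2 * (.var .a % .lit 3 / .lit 2) : Ex).val s₂ = vertexX a := by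
      simp [a₂, vertexX]
    have vp : ∀ z, (.lit L * ((.lit 1 - .var .q / (.var .K + .lit 1)) *
      (.var .q * .var .S + .var .acc) + .var .q / (.var .K + .lit 1) * (.var .m - .lit 1)) :
        Ex).val (s₂.set .z z) = vertexY L len d K m (fB b) a := fun z => by
      -- For vertices of the query `q` is at most `K + 1`, so this quotient is `0` or `1` and
      -- selects between the block position and `m - 1` without a branch.
      have hdiv : ((q : ℤ) / (K + 1)) = if q ≤ K then 0 else 1 := by
        split_ifs with h1
        · exact Int.ediv_eq_zero_of_lt (by lia) (by lia)
        · have : q = K + 1 := by lia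
          rw [this]; push_cast
          exact Int.ediv_self (by lia)
      simp only [Ex.val_lit, Ex.val_var, Ex.val_get, Ex.val_add,
      Ex.val_sub, Ex.val_mul, Ex.val_div, Ex.val_mod, St.set_reg, q₂, e₂.K_eq, e₂.S_eq, e₂.m_eq, hacc, vertexY,
        queryPos, ← hq, reduceCtorEq, if_false, hdiv]
      split_ifs with h1
      · simp [blockPos]
      · push_cast [hm]; ring
    have hz1 : |vertexX a| ≤ 2 := by
      rw [vertexX, Nat.abs_cast]; lia
    have hp1 : |vertexY L len d K m (fB b) a| ≤ X₀ := by
      rw [vertexY, Nat.abs_cast]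
      refine le_trans ?_ hLm
      rw [Int.ofNat_le]
      refine Nat.mul_le_mul_left _ ?_
      unfold queryPos
      split_ifs with h1
      · have h2 := blockPos_lt (d := d) hlen (hB1 b) ((a + 2) / 3)
        have h3 : ((a + 2) / 3 + 1) * 2 ^ len ≤ (K + 1) * 2 ^ len := Nat.mul_le_mul_right _ (by lia)
        lia
      · lia
    refine Ends.block_seq (fun hb => ?_) fun _ => ?_
    · simp only [OkIns, Ins.Ok, Ins.run, vz, vp, and_true]
      lia
    · refine putPoint_ends hsl hXX (by lia) ?_ ht hB (a := a) ?_ haX ?_ ?_ (hz1.trans hX₀) hp1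
        (st := st) ?_
      · exact l₂.congr (by simp) rfl rfl rfl
      · simp [a₂]
      · simp only [runIns, Ins.run, vz, vp]; simp
      · simp only [runIns, Ins.run, vz, vp]; simp
      · simp only [runIns, Ins.run, St.set_mem, m₂]
        exact hst

theorem writeQuery_ends (hB1 : ∀ i l, fB i l ≤ 1) (hlen : 0 < len) (hld : len ≤ d + 1)
    (hX : (2 : ℤ) ^ (d + 2) ≤ X) (hsl : SlotsOk D B sl) (hB : 7 < B) (hX₀ : 2 ≤ X₀) (hXX : X₀ ≤ X)
    (hLm : ((L * ((K + 1) * 2 ^ len + m) : ℕ) : ℤ) ≤ X₀) (hK : K = (k - 2) / 3)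
    (hm : 1 ≤ m) {s₀ s : St} (hs : Env N d fA fB n m k K len w s) {b c : ℕ} (hbN : b < N)
    (hsb : s.reg .b = b) (hlog : LogOk X₀ s₀ s c)
    (ht : s₀.reg .top + c + 4 * k ≤ X) (hkX : (k * D : ℕ) ≤ X) {st : RamState} {P : Prop}
    (hst : P → Holds D B sl (s.mem 3) (withPoints st 4 vertexX (vertexY L len d K m (fB b)) 0)) :
    Ends X (writeQuery L D sl) s (k * (3 * d + 10) + 2) (fun s' => LogOk X₀ s₀ s' (c + 4 * k) ∧
      (P → Holds D B sl (s'.mem 3)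
        (withPoints st 4 vertexX (vertexY L len d K m (fB b)) k))) := by
  refine (Ends.forLoop (I := fun a s' => LogOk X₀ s₀ s' (c + 4 * a) ∧ (P → Holds D B sl (s'.mem 3)
    (withPoints st 4 vertexX (vertexY L len d K m (fB b)) a))) (n := k)
    (by lia) (by simp) (by simp [writeVertex, blockStep]) (by simp [writeVertex, blockStep])
    hs.k_eq ⟨hlog.congr (by simp) rfl rfl rfl, hst⟩
    fun a ha s' hb hf ha' hI => ?_).mono le_rfl fun _ _ _ h => h
  have e' : Env N d fA fB n m k K len w s' :=
    hs.frame hf (by simp [writeVertex, blockStep]) (by simp [writeVertex, blockStep])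
  have haD : (a + 1) * D ≤ k * D := Nat.mul_le_mul_right _ ha
  refine (writeVertex_ends hB1 hlen hld hX hsl hB hX₀ hXX hLm hK hm e' hbN
    (by rw [hf.1 _ (by simp [writeVertex, blockStep]), hsb]) ha' ha hI.1 ?_ ?_
    hI.2).mono le_rfl fun s'' _ _ h'' => ⟨h''.1.congr (by simp) rfl rfl rfl, h''.2⟩
  · push_cast
    lia
  · lia

end

/-! ### Banks of the simulated machine -/

/-- A program mentions only banks up to its `mag`. Hence banks from `B` on are still empty after the
preprocessing, and their cells can be used for the query. -/
theorem RamExec.mem_eq {W : ℤ} {p : RamProg} {σ τ : RamState} {t : ℕ} (h : RamExec W p σ t τ)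
    {b : ℕ} (hb : p.mag < b) : τ.mem b = σ.mem b := by
  induction h with
  | skip | const | op | load | loop_done => rfl
  | store σ b' s t h =>
    simp only [RamProg.mag] at hb
    simp only [RamState.setMem]
    rw [Function.update_of_ne (by lia)]
  | seq _ _ ih ih' =>
    simp only [RamProg.mag] at hb
    rw [ih' (by lia), ih (by lia)]
  | ite_pos _ _ ih => exact ih (by simp only [RamProg.mag] at hb; lia)
  | ite_neg _ _ ih => exact ih (by simp only [RamProg.mag] at hb; lia)
  | loop_step _ _ _ ih ih' => rw [ih' hb, ih (by simp only [RamProg.mag] at hb; lia)]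

/-- The positions of the banks during the preprocessing. -/
def preSlot (b : ℕ) : ℕ := b + 1

/-- The positions of the banks during a query: the banks for the query curve are moved to a place
that the preprocessing does not use. -/
def qrySlot (B b : ℕ) : ℕ := if 4 ≤ b ∧ b < 8 then B + b - 3 else b + 1

theorem slotsOk_preSlot (B : ℕ) : SlotsOk (B + 5) (B + 4) preSlot := by
  refine ⟨fun b hb => ?_, fun b _ b' _ h => ?_⟩ <;> simp only [preSlot] at * <;> lia

theorem slotsOk_qrySlot (B : ℕ) : SlotsOk (B + 5) B (qrySlot B) := by
  refine ⟨fun b hb => ?_, fun b hb b' hb' h => ?_⟩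
  · unfold qrySlot
    split_ifs <;> lia
  · unfold qrySlot at h
    split_ifs at h <;> lia

/-- Placing a query replaces the whole content of banks `4` to `7`, on which the preprocessing may
have left data. Instead of erasing this, these banks are redirected to the empty cells of banks `B`
to `B + 3`. -/
theorem Holds.qrySlot {B : ℕ} {V : ℤ → ℤ} {σ : RamState} (h : Holds (B + 5) (B + 4) preSlot V σ)
    (h0 : ∀ b, B ≤ b → σ.mem b = fun _ => 0) (f g : ℕ → ℤ) :
    Holds (B + 5) B (qrySlot B) V (withPoints σ 4 f g 0) := by
  refine ⟨h.1, fun b hb a => ?_⟩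
  simp only [withPoints, partTable_zero, _root_.qrySlot]
  split_ifs with h1 h2 h3 h4 h5 h6 h7 h8 h9
  any_goals lia
  any_goals
    have h10 := h.2 (B + b - 4) (by lia) a
    rw [h0 _ (by lia), preSlot, show B + b - 4 + 1 = B + b - 3 by lia] at h10
    exact h10
  · exact h.2 b (by lia) a

/-! ### The program for one query -/

/-- Bounds for the numbers that occur while a data structure with preprocessing time `T₁` and query
time `T₂` is built and used. -/
structure Limits (X X₀ w : ℤ) (B L N d n m k K len T₁ T₂ : ℕ) : Prop where
  two_le : 2 ≤ X₀
  word_nonneg : 0 ≤ w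
  word_le : w ≤ X₀
  mul_le : X₀ * (B + 5 : ℕ) + (B + 5 : ℕ) ≤ X
  sq_le : 2 * (X₀ * X₀) ≤ X
  pow_le : (2 : ℤ) ^ (d + 2) ≤ X
  slots_le : (((B + 5) * (B + 5) : ℕ) : ℤ) ≤ X
  heights_le : ((L * ((K + 1) * 2 ^ len + m) : ℕ) : ℤ) ≤ X₀
  budget : ((4 * (n * m) + 5 + T₁ + 4 * k + T₂ : ℕ) : ℤ) ≤ X₀
  len_pos : 0 < len
  len_le : len ≤ d + 1
  K_eq : K = (k - 2) / 3
  one_le_m : 1 ≤ m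
  pos : 0 < N

theorem Limits.le {X X₀ w : ℤ} {B L N d n m k K len T₁ T₂ : ℕ}
    (h : Limits X X₀ w B L N d n m k K len T₁ T₂) : X₀ ≤ X := by
  have h1 := h.mul_le
  have h2 := h.two_le
  push_cast at h1
  nlinarith

/-- An orthogonal pair exists. -/
def OrthPair (N d : ℕ) (fA fB : ℕ → ℕ → ℕ) : Prop :=
  ∃ i < N, ∃ j < N, dot d (fA i) (fB j) = 0

/-- The variable `ans` has not been changed, or it has been set to `1` for a good reason. -/
def AnsStep (N d : ℕ) (fA fB : ℕ → ℕ → ℕ) (s s' : St) : Prop :=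
  s'.reg .ans = s.reg .ans ∨ s'.reg .ans = 1 ∧ OrthPair N d fA fB

theorem AnsStep.trans {N d : ℕ} {fA fB : ℕ → ℕ → ℕ} {s s' s'' : St} (h : AnsStep N d fA fB s s')
    (h' : AnsStep N d fA fB s' s'') : AnsStep N d fA fB s s'' := by
  unfold AnsStep at *
  rcases h' with h' | h'
  · rwa [h']
  · exact Or.inr h'

theorem AnsStep.one {N d : ℕ} {fA fB : ℕ → ℕ → ℕ} {s s' : St} (h : AnsStep N d fA fB s s')
    (h1 : s.reg .ans = 1) : s'.reg .ans = 1 := by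
  rcases h with h | h
  · rw [h, h1]
  · exact h.1

/-- A vector of group `h` is orthogonal to vector `j`. -/
def GroupOrth (N d n h : ℕ) (fA fB : ℕ → ℕ → ℕ) (j : ℕ) : Prop :=
  ∃ i < n, dot d (fA ((h * n + i) % N)) (fB j) = 0

/-- In time `T`, the query program finds a vector of group `h` that is orthogonal to vector `j`, if
one exists. -/
def Answers (L N d n m k K len h T : ℕ) (w : ℤ) (fA fB : ℕ → ℕ → ℕ) (qry : RamProg)
    (σ : RamState) (j : ℕ) : Prop :=
  ∃ (u : ℕ) (τ : RamState),
    RamExec w qry (withPoints σ 4 vertexX (vertexY L len d K m (fB j)) k) u τ ∧ u ≤ T ∧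
    (GroupOrth N d n h fA fB j → ∃ i < n, τ.reg 0 = (i : ℕ) ∧
      dot d (fA ((h * n + i) % N)) (fB j) = 0)

/-- Run the query program on vector `b` for `C * r ^ e` units of time, check its answer and restore
the memory. -/
def queryStep (L B C e : ℕ) (qry : RamProg) : Cmd :=
  writeQuery L (B + 5) (qrySlot B) ;; .block [.asg .clk (.lit C * (Ex.var .r).pow e)] ;;
  sim (B + 5) (qrySlot B) qry ;;
  .block [.asg .idx ((.var .h * .var .n + regVal (B + 5) 0) % .var .N)] ;; verify ;; undo

theorem queryStep_not_writesVar {L B C e : ℕ} {qry : RamProg} {v : PVar}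
    (hv : v ∉ [PVar.a, .q, .acc, .l, .z, .pw, .x, .y, .top, .clk, .idx, .ans]) :
    ¬ (queryStep L B C e qry).WritesVar v := by
  simp only [List.mem_cons, List.not_mem_nil, or_false, not_or] at hv
  obtain ⟨h1, h2, h3, h4, h5, h6, h7, h8, h9, h10, h11, h12⟩ := hv
  simp [queryStep, writeQuery, writeVertex, blockStep, verify, undo, sim_not_writesVar, *]

theorem queryStep_not_writesBank {L B C e : ℕ} {qry : RamProg} {b : ℕ} (h3 : b ≠ 3) (h4 : b ≠ 4)
    (h5 : b ≠ 5) : ¬ (queryStep L B C e qry).WritesBank b := by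
  simp [queryStep, writeQuery, writeVertex, blockStep, verify, undo, sim_not_writesBank, *]

/-- The running time of `queryStep`. -/
def queryCost (qry : RamProg) (d k T : ℕ) : ℕ :=
  k * (3 * d + 10) + 2 + (1 + (simCost qry * (1 + T) + (1 + (3 * d + 5 + (2 * (4 * k + T) + 1)))))

section

variable {X X₀ w : ℤ} {B L N d n m k K len T₁ T₂ r C e h : ℕ} {fA fB : ℕ → ℕ → ℕ}

/-- Restoration and soundness hold for an arbitrary memory; only the final implication, that an
existing orthogonal vector is found, assumes that the memory holds a good preprocessed
configuration. -/
theorem queryStep_ends (hl : Limits X X₀ w B L N d n m k K len T₁ T₂) (hA : ∀ i l, fA i l ≤ 1)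
    (hB : ∀ i l, fB i l ≤ 1) {qry : RamProg} (hq : qry.mag + 8 ≤ B) (hT : T₂ = C * r ^ e)
    {s : St} (hs : Env N d fA fB n m k K len w s) (hr : s.reg .r = r) (hsh : s.reg .h = h)
    {j : ℕ} (hj : j < N) (hsj : s.reg .b = j) (hmark : s.reg .mark = s.reg .top)
    (htop : 0 ≤ s.reg .top) (htop' : s.reg .top ≤ (4 * (n * m) + 5 + T₁ : ℕ))
    (hmem : ∀ a, |s.mem 3 a| ≤ X₀) (σ : RamState) :
    Ends X (queryStep L B C e qry) s (queryCost qry d k T₂) (fun s' =>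
      s'.mem 3 = s.mem 3 ∧ s'.reg .top = s.reg .top ∧ Logged s s' ∧ AnsStep N d fA fB s s' ∧
      (Holds (B + 5) (B + 4) preSlot (s.mem 3) σ → (∀ b, B ≤ b → σ.mem b = fun _ => 0) →
        Answers L N d n m k K len h T₂ w fA fB qry σ j → GroupOrth N d n h fA fB j →
        s'.reg .ans = 1)) := by
  have hXX := hl.le
  have h2 := hl.two_le
  have hbud := hl.budget
  have hD1 := hl.mul_le
  push_cast at hbud hD1 htop'
  have hnm : (0 : ℤ) ≤ 4 * (n * m) := by positivity
  refine Ends.seq (writeQuery_ends (c := 0) (st := σ)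
    (P := Holds (B + 5) (B + 4) preSlot (s.mem 3) σ ∧ ∀ b, B ≤ b → σ.mem b = fun _ => 0)
    hB hl.len_pos hl.len_le hl.pow_le (slotsOk_qrySlot B)
    (by lia) h2 hXX hl.heights_le hl.K_eq hl.one_le_m hs hj hsj
    ⟨hmem, Logged.refl htop, by simp⟩ (by lia) ?_ fun hP => hP.1.qrySlot hP.2 _ _)
    fun s₁ hb₁ hf₁ h₁ => ?_
  · have : (k : ℤ) * (B + 5) ≤ X₀ * (B + 5) := mul_le_mul_of_nonneg_right (by lia) (by lia)
    push_cast
    lia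
  have e₁ := hs.frame hf₁ (by simp [writeQuery, writeVertex, blockStep])
    (by simp [writeQuery, writeVertex, blockStep])
  have r₁ : s₁.reg .r = r := by rw [hf₁.1 _ (by simp [writeQuery, writeVertex, blockStep]), hr]
  have k₁ : s₁.reg .h = h := by rw [hf₁.1 _ (by simp [writeQuery, writeVertex, blockStep]), hsh]
  have b₁ : s₁.reg .b = j := by rw [hf₁.1 _ (by simp [writeQuery, writeVertex, blockStep]), hsj]
  have m₁ : s₁.reg .mark = s.reg .top := by
    rw [hf₁.1 _ (by simp [writeQuery, writeVertex, blockStep]), hmark]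
  have n₁ : s₁.reg .ans = s.reg .ans := hf₁.1 _ (by simp [writeQuery, writeVertex, blockStep])
  clear hf₁ hb₁
  have hclk : (.lit C * (Ex.var .r).pow e : Ex).val s₁ = (T₂ : ℕ) := by
    simp [r₁, hT]
  refine Ends.block_seq (fun _ => ?_) fun _ => ?_
  · simp only [OkIns, Ins.Ok, hclk, and_true, Nat.abs_cast]
    lia
  set s₂ := runIns [.asg .clk (.lit C * (Ex.var .r).pow e)] s₁ with hs₂
  have c₂ : s₂.reg .clk = T₂ := by simp only [hs₂, runIns, Ins.run, hclk]; simp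
  have v₂ : ∀ v, v ≠ .clk → s₂.reg v = s₁.reg v := fun v hv => by simp [hs₂, hv]
  have g₂ : s₂.mem = s₁.mem := rfl
  clear_value s₂
  have e₂ : Env N d fA fB n m k K len w s₂ := e₁.congr
    (fun v hv => v₂ v (by rintro rfl; simp at hv)) (fun b _ => by rw [g₂])
  have l₂ : LogOk X₀ s s₂ (0 + 4 * k) :=
    h₁.1.congr (v₂ _ (by simp)) (by rw [g₂]) (by rw [g₂]) (by rw [g₂])
  have t₂ := l₂.top
  push_cast at t₂
  refine Ends.seq (sim_ends (Y := s.reg .top + 4 * k + T₂) (w := w) (X₀ := X₀) (slotsOk_qrySlot B)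
    (by lia) (by lia) (by lia) hl.word_nonneg hl.word_le (by push_cast; exact hD1) hl.sq_le
    (p := qry) (by lia) (le_trans (by exact_mod_cast Nat.mul_le_mul_right _ (by lia)) hl.slots_le)
    ⟨l₂.mem, by lia, by lia, by lia, e₂.W_eq⟩ (T := T₂) (by lia)) fun s₃ hb₃ hf₃ h₃ => ?_
  have e₃ := e₂.frame hf₃ (by simp [sim_not_writesVar]) (by simp [sim_not_writesBank])
  have v₃ : ∀ v, v ≠ .clk → v ≠ .x → v ≠ .y → v ≠ .top → s₃.reg v = s₁.reg v :=
    fun v a1 a2 a3 a4 => by rw [hf₃.1 _ (sim_not_writesVar a1 a2 a3 a4), v₂ v a1]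
  -- Reduction modulo `N` makes the answer a valid index even if the simulation has left garbage in
  -- register `0`.
  have hidx : ((.var .h * .var .n + regVal (B + 5) 0) % .var .N : Ex).val s₃ =
      (((h * n + s₃.mem 3 0) % N).toNat : ℕ) := by
    have : (0 : ℤ) < N := by exact_mod_cast hl.pos
    rw [Int.toNat_of_nonneg (Int.emod_nonneg _ this.ne')]
    simp [regVal, regCell, e₃.n_eq, e₃.N_eq, v₃, k₁]
  set i := ((h * n + s₃.mem 3 0) % N).toNat with hi
  have hiN : i < N := by
    have : (0 : ℤ) < N := by exact_mod_cast hl.pos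
    have := Int.emod_lt_of_pos (h * n + s₃.mem 3 0) this
    lia
  refine Ends.block_seq (fun hb => ?_) fun _ => ?_
  · have := hb.1 .N
    rw [e₃.N_eq, Nat.abs_cast] at this
    simp only [OkIns, Ins.Ok, hidx, and_true, Nat.abs_cast]
    lia
  set s₄ := runIns [.asg .idx ((.var .h * .var .n + regVal (B + 5) 0) % .var .N)] s₃ with hs₄
  have i₄ : s₄.reg .idx = i := by simp only [hs₄, runIns, Ins.run, hidx]; simp
  have v₄ : ∀ v, v ≠ .idx → s₄.reg v = s₃.reg v := fun v hv => by simp [hs₄, hv]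
  have g₄ : s₄.mem = s₃.mem := rfl
  clear_value s₄
  have l₄ : Logged s s₄ := l₂.logged.trans (h₃.ext.congr rfl rfl rfl rfl (v₄ _ (by simp))
    (by rw [g₄]) (by rw [g₄]) (by rw [g₄]))
  refine Ends.seq (verify_ends (by lia) hA hB (i := i) (j := j) (e₃.toData.congr (v₄ _ (by simp))
    (v₄ _ (by simp)) (by rw [g₄]) (by rw [g₄])) hiN hj i₄ (by simp [v₄, v₃, b₁]))
    fun s₅ hb₅ hf₅ h₅ => ?_
  have top₅ : s₅.reg .top = s₃.reg .top := by
    rw [hf₅.1 _ (by simp [verify]), v₄ _ (by simp)]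
  have l₅ : Logged s s₅ := l₄.congr rfl rfl rfl rfl (hf₅.1 _ (by simp [verify]))
    (hf₅.2 _ (by simp [verify])) (hf₅.2 _ (by simp [verify])) (hf₅.2 _ (by simp [verify]))
  have ans₅ : s₅.reg .ans = if dot d (fA i) (fB j) = 0 then 1 else s.reg .ans := by
    rw [h₅, v₄ _ (by simp), v₃ _ (by simp) (by simp) (by simp) (by simp), n₁]
  have hok := h₃.ok.add
  have hclk0 := h₃.ok.clk
  have hl5 := l₅.top_nonneg
  refine (undo_ends l₅ ?_ (T := 2 * (4 * k + T₂) + 1) (by lia)).mono le_rfl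
    fun s₆ _ hf₆ h₆ => ⟨h₆.1, h₆.2.1, h₆.2.2, ?_, fun hV h0 hans horth => ?_⟩
  · rw [hf₅.1 _ (by simp [verify]), v₄ _ (by simp), v₃ _ (by simp) (by simp) (by simp) (by simp), m₁]
  · unfold AnsStep
    rw [hf₆.1 _ (by simp [undo]), ans₅]
    split_ifs with hd
    · exact Or.inr ⟨rfl, i, hiN, j, hj, hd⟩
    · exact Or.inl rfl
  · rw [hf₆.1 _ (by simp [undo]), ans₅, if_pos]
    obtain ⟨u, τ, hu, huT, hτ⟩ := hans
    obtain ⟨i', hi'n, hτ0, hdot⟩ := hτ horth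
    have hH := (h₃.exec _ _ _ (by rw [g₂]; exact h₁.2 ⟨hV, h0⟩) hu (by lia)).1.1 0
    rw [hτ0, zero_mul, Nat.cast_zero] at hH
    have : i = (h * n + i') % N := by
      rw [hi, hH]
      exact_mod_cast Int.toNat_natCast _
    rw [this]
    exact hdot

end

/-! ### The program for one data structure -/

/-- Store the value of `e` into register `r` of the simulated machine. -/
def writeReg (D r : ℕ) (e : Ex) : Cmd := .block (loggedStore (regCell D r) e)

theorem writeReg_ends {D B : ℕ} {sl : ℕ → ℕ} {X X₀ : ℤ} (hsl : SlotsOk D B sl) (hD : 0 < D)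
    (hXX : X₀ ≤ X) {e : Ex} {z : ℤ} {s₀ s : St} {c : ℕ} (hs : LogOk X₀ s₀ s c)
    (ht : s₀.reg .top + c + 1 ≤ X) {r : ℕ} (hr : (r * D : ℕ) ≤ X)
    (he : ∀ u, e.val (s.set .x u) = z) (hz : |z| ≤ X₀) {st : RamState}
    (hst : Holds D B sl (s.mem 3) st) :
    Ends X (writeReg D r e) s 1 (fun s' => LogOk X₀ s₀ s' (c + 1) ∧
      Holds D B sl (s'.mem 3) (st.setReg r z)) := by
  refine (loggedStore_ends hXX hs ht (a := ((r * D : ℕ) : ℤ)) (by simp [regCell]) he ?_ hz).mono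
    le_rfl fun s' _ _ h => ⟨h.1, ?_⟩
  · rwa [Nat.abs_cast]
  · rw [h.2]
    exact hst.setReg hsl hD _ _

/-- Write the parameters of a data structure with threshold `1`. -/
def writeParams (D : ℕ) : Cmd :=
  writeReg D 0 (.var .n) ;; writeReg D 1 (.var .m) ;; writeReg D 2 (.var .k) ;;
    writeReg D 3 (.lit 1) ;; writeReg D 4 (.lit 1)

/-- The input configuration for the preprocessing of `n` curves, where the coordinates of the
vertices are in `f` and `g`, with threshold `1`. -/
def annState (n m k : ℕ) (f g : ℕ → ℤ) : RamState :=
  (((((withPoints ⟨fun _ => 0, fun _ _ => 0⟩ 0 f g (n * m)).setReg 0 n).setReg 1 m).setReg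
    2 k).setReg 3 1).setReg 4 1

theorem writeParams_ends {D B : ℕ} {sl : ℕ → ℕ} {X X₀ : ℤ} (hsl : SlotsOk D B sl) (hD : 4 < D)
    (hXX : X₀ ≤ X) (hX₀ : 1 ≤ X₀) {n m k : ℕ} {s₀ s : St} {c : ℕ} (hs : LogOk X₀ s₀ s c)
    (ht : s₀.reg .top + c + 5 ≤ X) (hDX : (D * D : ℕ) ≤ X) (hn : s.reg .n = n) (hm : s.reg .m = m)
    (hk : s.reg .k = k) (hn' : (n : ℤ) ≤ X₀) (hm' : (m : ℤ) ≤ X₀) (hk' : (k : ℤ) ≤ X₀)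
    {f g : ℕ → ℤ}
    (hst : Holds D B sl (s.mem 3) (withPoints ⟨fun _ => 0, fun _ _ => 0⟩ 0 f g (n * m))) :
    Ends X (writeParams D) s 5 (fun s' => LogOk X₀ s₀ s' (c + 5) ∧
      Holds D B sl (s'.mem 3) (annState n m k f g)) := by
  have hr : ∀ r ≤ 4, ((r * D : ℕ) : ℤ) ≤ X := fun r hr =>
    le_trans (by exact_mod_cast Nat.mul_le_mul_right _ (by lia)) hDX
  refine (Ends.seq (U := 1 + (1 + (1 + 1))) (writeReg_ends hsl (by lia) hXX hs (by lia)
    (hr 0 (by lia)) (z := n) (by simpa using hn) (by rwa [Nat.abs_cast]) hst)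
    fun s₁ _ f₁ h₁ => ?_).mono le_rfl fun _ _ _ h => h
  have v₁ : ∀ v, v ≠ .x → v ≠ .y → v ≠ .top → s₁.reg v = s.reg v :=
    fun v h1 h2 h3 => f₁.1 v (by simp [writeReg, loggedStore, logStore, *])
  refine Ends.seq (writeReg_ends hsl (by lia) hXX h₁.1 (by push_cast; lia)
    (hr 1 (by lia)) (z := m) (by simpa [v₁] using hm) (by rwa [Nat.abs_cast]) h₁.2)
    fun s₂ _ f₂ h₂ => ?_
  have v₂ : ∀ v, v ≠ .x → v ≠ .y → v ≠ .top → s₂.reg v = s.reg v :=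
    fun v h1 h2 h3 => (f₂.1 v (by simp [writeReg, loggedStore, logStore, *])).trans (v₁ v h1 h2 h3)
  refine Ends.seq (writeReg_ends hsl (by lia) hXX h₂.1 (by push_cast; lia)
    (hr 2 (by lia)) (z := k) (by simpa [v₂] using hk) (by rwa [Nat.abs_cast]) h₂.2)
    fun s₃ _ f₃ h₃ => ?_
  refine Ends.seq (writeReg_ends hsl (by lia) hXX h₃.1 (by push_cast; lia)
    (hr 3 (by lia)) (z := 1) (by simp) (by simpa using hX₀) h₃.2) fun s₄ _ f₄ h₄ => ?_
  exact writeReg_ends hsl (by lia) hXX h₄.1 (by push_cast; lia)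
    (hr 4 (by lia)) (z := 1) (by simp) (by simpa using hX₀) h₄.2

/-- Build a data structure for the vectors of group `h` within `C * r ^ Q` units of time, ask it for
all vectors of the second set and restore the memory. -/
def groupStep (L B C Q e : ℕ) (pre qry : RamProg) : Cmd :=
  writeCurves L (B + 5) preSlot ;; writeParams (B + 5) ;;
  .block [.asg .clk (.lit C * (Ex.var .r).pow Q)] ;; sim (B + 5) preSlot pre ;;
  .block [.asg .mark (.var .top)] ;; forLoop .b .N (queryStep L B C e qry) ;;
  .block [.asg .mark (.lit 0)] ;; undo

theorem groupStep_not_writesVar {L B C Q e : ℕ} {pre qry : RamProg} {v : PVar}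
    (hv : v ∉ [PVar.a, .q, .acc, .l, .z, .pw, .x, .y, .top, .clk, .idx, .ans, .nm, .j, .mark, .b]) :
    ¬ (groupStep L B C Q e pre qry).WritesVar v := by
  have h0 : ¬ (queryStep L B C e qry).WritesVar v := queryStep_not_writesVar fun h => hv (by
    simp only [List.mem_cons, List.not_mem_nil, or_false] at h ⊢; tauto)
  simp only [List.mem_cons, List.not_mem_nil, or_false, not_or] at hv
  obtain ⟨h1, h2, h3, h4, h5, h6, h7, h8, h9, h10, h11, h12, h13, h14, h15, h16⟩ := hv
  simp [groupStep, writeCurves, writeTooth, toothStep, writeParams, writeReg, loggedStore, logStore,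
    undo, sim_not_writesVar, *]

theorem groupStep_not_writesBank {L B C Q e : ℕ} {pre qry : RamProg} {b : ℕ} (h3 : b ≠ 3)
    (h4 : b ≠ 4) (h5 : b ≠ 5) : ¬ (groupStep L B C Q e pre qry).WritesBank b := by
  simp [groupStep, writeCurves, writeTooth, toothStep, writeParams, writeReg, loggedStore, logStore,
    undo, sim_not_writesBank, queryStep_not_writesBank, *]

/-- The running time of `groupStep`. -/
def groupCost (pre qry : RamProg) (N d n m k T₁ T₂ : ℕ) : ℕ :=
  n * m * (3 * d + 10) + 3 + (5 + (1 + (simCost pre * (1 + T₁) + (1 +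
    ((N * (queryCost qry d k T₂ + 2) + 2) + (1 + (2 * (4 * (n * m) + 5 + T₁) + 1)))))))

/-- The preprocessing of group `h` takes time at most `T₁`, and after it all queries are answered in
time `T₂`. -/
def GroupOk (L N d n m k K len h T₁ T₂ : ℕ) (w : ℤ) (fA fB : ℕ → ℕ → ℕ) (pre qry : RamProg) :
    Prop :=
  ∃ (t : ℕ) (σ : RamState),
    RamExec w pre (annState n m k (groupTooth len d N n m h fA) (groupHeight L m)) t σ ∧ t ≤ T₁ ∧
    ∀ j < N, Answers L N d n m k K len h T₂ w fA fB qry σ j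

section

variable {X X₀ w : ℤ} {B L N d n m k K len T₁ T₂ r C Q e h : ℕ} {fA fB : ℕ → ℕ → ℕ}

theorem groupStep_ends (hl : Limits X X₀ w B L N d n m k K len T₁ T₂) (hA : ∀ i l, fA i l ≤ 1)
    (hB : ∀ i l, fB i l ≤ 1) {pre qry : RamProg} (hp : pre.mag < B) (hq : qry.mag + 8 ≤ B)
    (hT₁ : T₁ = C * r ^ Q) (hT₂ : T₂ = C * r ^ e) {s : St} (hs : Env N d fA fB n m k K len w s)
    (hr : s.reg .r = r) (hsh : s.reg .h = h) (htop : s.reg .top = 0)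
    (hmem : s.mem 3 = fun _ => 0) (hn : 1 ≤ n) :
    Ends X (groupStep L B C Q e pre qry) s (groupCost pre qry N d n m k T₁ T₂) (fun s' =>
      s'.mem 3 = (fun _ => 0) ∧ s'.reg .top = 0 ∧ AnsStep N d fA fB s s' ∧
      (GroupOk L N d n m k K len h T₁ T₂ w fA fB pre qry → ∀ j < N,
        GroupOrth N d n h fA fB j → s'.reg .ans = 1)) := by
  have hXX := hl.le
  have h2 := hl.two_le
  have hbud := hl.budget
  have hD1 := hl.mul_le
  have hm := hl.one_le_m
  push_cast at hbud hD1
  have hnm : (n : ℤ) ≤ n * m ∧ (m : ℤ) ≤ n * m := by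
    constructor <;> nlinarith
  -- The configuration that a correct preprocessing produces; an arbitrary one if there is none.
  -- Fixing it in advance lets the loop invariant be stated without assuming correctness.
  obtain ⟨σ, hσ⟩ : ∃ σ : RamState, GroupOk L N d n m k K len h T₁ T₂ w fA fB pre qry →
      ∃ t, RamExec w pre (annState n m k (groupTooth len d N n m h fA) (groupHeight L m)) t σ ∧
        t ≤ T₁ ∧ ∀ j < N, Answers L N d n m k K len h T₂ w fA fB qry σ j := by
    by_cases hG : GroupOk L N d n m k K len h T₁ T₂ w fA fB pre qry
    · obtain ⟨t, σ, h⟩ := hG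
      exact ⟨σ, fun _ => ⟨t, h⟩⟩
    · exact ⟨⟨fun _ => 0, fun _ _ => 0⟩, fun h => absurd h hG⟩
  refine Ends.seq (writeCurves_ends (c := 0) (h := h) (s₀ := s) (X₀ := X₀) (B := B + 4) (P := True)
    (st := ⟨fun _ => 0, fun _ _ => 0⟩) (fA := fA)
    hA hl.len_pos hl.len_le hl.pos (slotsOk_preSlot B)
    (by lia) (by lia) hXX (le_trans ?_ hl.heights_le) hs hsh
    ⟨by simp [hmem]; lia, Logged.refl htop.ge, by simp⟩ (by rw [htop]; push_cast; lia) (by lia) ?_ fun _ => ?_)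
    fun s₁ hb₁ hf₁ h₁ => ?_
  · exact_mod_cast Nat.mul_le_mul_left _ (by lia)
  · have : (n * m : ℤ) * (B + 5) ≤ X₀ * (B + 5) := mul_le_mul_of_nonneg_right (by lia) (by lia)
    push_cast
    lia
  · refine ⟨fun r => by simp [hmem, withPoints], fun b hb a => ?_⟩
    simp only [hmem, withPoints, partTable_zero, ite_self]
  have e₁ := hs.frame hf₁ (by simp [writeCurves, writeTooth, toothStep])
    (by simp [writeCurves, writeTooth, toothStep])
  have v₁ : ∀ v ∈ [PVar.r, .h, .ans], s₁.reg v = s.reg v := fun v hv => hf₁.1 _ (by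
    simp only [List.mem_cons, List.not_mem_nil, or_false] at hv
    rcases hv with rfl | rfl | rfl <;> simp [writeCurves, writeTooth, toothStep])
  refine Ends.seq (writeParams_ends (slotsOk_preSlot B) (by lia) hXX (by lia) h₁.1
    (by rw [htop]; push_cast; lia) hl.slots_le e₁.n_eq e₁.m_eq e₁.k_eq (by lia) (by lia) (by lia)
    (h₁.2 trivial)) fun s₂ hb₂ hf₂ h₂ => ?_
  have e₂ := e₁.frame hf₂ (by simp [writeParams, writeReg, loggedStore, logStore])
    (by simp [writeParams, writeReg, loggedStore, logStore])
  have v₂ : ∀ v ∈ [PVar.r, .h, .ans], s₂.reg v = s.reg v := fun v hv => (hf₂.1 _ (by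
    simp only [List.mem_cons, List.not_mem_nil, or_false] at hv
    rcases hv with rfl | rfl | rfl <;>
      simp [writeParams, writeReg, loggedStore, logStore])).trans (v₁ v hv)
  have hclk : (.lit C * (Ex.var .r).pow Q : Ex).val s₂ = (T₁ : ℕ) := by
    simp [v₂, hr, hT₁]
  refine Ends.block_seq (fun _ => ?_) fun _ => ?_
  · simp only [OkIns, Ins.Ok, hclk, and_true, Nat.abs_cast]
    lia
  set s₃ := runIns [.asg .clk (.lit C * (Ex.var .r).pow Q)] s₂ with hs₃
  have c₃ : s₃.reg .clk = T₁ := by simp only [hs₃, runIns, Ins.run, hclk]; simp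
  have v₃ : ∀ v, v ≠ .clk → s₃.reg v = s₂.reg v := fun v hv => by simp [hs₃, hv]
  have g₃ : s₃.mem = s₂.mem := rfl
  clear_value s₃
  have e₃ : Env N d fA fB n m k K len w s₃ := e₂.congr
    (fun v hv => v₃ v (by rintro rfl; simp at hv)) (fun b _ => by rw [g₃])
  have l₃ : LogOk X₀ s s₃ (0 + 4 * (n * m) + 5) :=
    h₂.1.congr (v₃ _ (by simp)) (by rw [g₃]) (by rw [g₃]) (by rw [g₃])
  have t₃ := l₃.top
  rw [htop] at t₃
  push_cast at t₃
  refine Ends.seq (sim_ends (Y := 4 * (n * m) + 5 + T₁) (w := w) (X₀ := X₀) (slotsOk_preSlot B)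
    (by lia) (by lia) (by lia) hl.word_nonneg hl.word_le (by push_cast; exact hD1) hl.sq_le
    (p := pre) (by lia) (le_trans (by exact_mod_cast Nat.mul_le_mul_right _ (by lia)) hl.slots_le)
    ⟨l₃.mem, by lia, by lia, by lia, e₃.W_eq⟩ (T := T₁) (by lia)) fun s₄ hb₄ hf₄ h₄ => ?_
  have e₄ := e₃.frame hf₄ (by simp [sim_not_writesVar]) (by simp [sim_not_writesBank])
  have v₄ : ∀ v ∈ [PVar.r, .h, .ans], s₄.reg v = s.reg v := fun v hv => by
    have h5 : v ≠ .clk ∧ v ≠ .x ∧ v ≠ .y ∧ v ≠ .top := by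
      simp only [List.mem_cons, List.not_mem_nil, or_false] at hv
      rcases hv with rfl | rfl | rfl <;> simp
    rw [hf₄.1 _ (sim_not_writesVar h5.1 h5.2.1 h5.2.2.1 h5.2.2.2), v₃ v h5.1, v₂ v hv]
  have l₄ : Logged s s₄ := l₃.logged.trans h₄.ext
  have clk₄ := h₄.ok.clk
  have add₄ := h₄.ok.add
  have top₄ := h₄.ok.top
  refine Ends.block_seq (fun hb => ⟨hb.1 _, trivial⟩) fun _ => ?_
  set s₅ := runIns [.asg .mark (.var .top)] s₄ with hs₅
  have m₅ : s₅.reg .mark = s₄.reg .top := by simp [hs₅]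
  have v₅ : ∀ v, v ≠ .mark → s₅.reg v = s₄.reg v := fun v hv => by simp [hs₅, hv]
  have g₅ : s₅.mem = s₄.mem := rfl
  clear_value s₅
  have e₅ : Env N d fA fB n m k K len w s₅ := e₄.congr
    (fun v hv => v₅ v (by rintro rfl; simp at hv)) (fun b _ => by rw [g₅])
  have l₅ : Logged s s₅ := l₄.congr rfl rfl rfl rfl (v₅ _ (by simp))
    (by rw [g₅]) (by rw [g₅]) (by rw [g₅])
  have hgood : GroupOk L N d n m k K len h T₁ T₂ w fA fB pre qry →
      Holds (B + 5) (B + 4) preSlot (s₅.mem 3) σ ∧ (∀ b, B ≤ b → σ.mem b = fun _ => 0) ∧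
      ∀ j < N, Answers L N d n m k K len h T₂ w fA fB qry σ j := fun hG => by
    obtain ⟨t, ht, htT, hans⟩ := hσ hG
    refine ⟨?_, fun b hb => ?_, hans⟩
    · rw [g₅]
      exact (h₄.exec _ _ _ (by rw [g₃]; exact h₂.2) ht (by lia)).1
    · rw [ht.mem_eq (by lia)]
      simp [annState, RamState.setReg, withPoints, show b ≠ 0 by lia, show b ≠ 1 by lia,
        show b ≠ 2 by lia, show b ≠ 3 by lia]
  refine Ends.seq (R := fun s' => Logged s s' ∧ s'.reg .top = s₄.reg .top ∧ AnsStep N d fA fB s s' ∧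
      (GroupOk L N d n m k K len h T₁ T₂ w fA fB pre qry → ∀ j < N,
        GroupOrth N d n h fA fB j → s'.reg .ans = 1)) ((Ends.forLoop (n := N)
      (I := fun c s' => s'.mem 3 = s₅.mem 3 ∧ Logged s s' ∧ s'.reg .top = s₄.reg .top ∧
      AnsStep N d fA fB s s' ∧ (GroupOk L N d n m k K len h T₁ T₂ w fA fB pre qry → ∀ j < c,
        GroupOrth N d n h fA fB j → s'.reg .ans = 1)) (T := queryCost qry d k T₂) (by lia) (by simp)
      (queryStep_not_writesVar (by simp)) (queryStep_not_writesVar (by simp)) e₅.N_eq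
      ⟨rfl, l₅.congr rfl rfl rfl rfl (by simp) (by simp) (by simp) (by simp), ?_, Or.inl ?_,
        by simp⟩ fun j hj s' _ hf' hsj hI => ?_).mono le_rfl fun _ _ _ h => h.2)
    fun s₆ hb₆ hf₆ h₆ => ?_
  · simp [v₅]
  · simp [v₅, v₄]
  · obtain ⟨i3, il, it, ia, ig⟩ := hI
    have hnv : ∀ v, v ≠ .b → v ∉ [PVar.a, .q, .acc, .l, .z, .pw, .x, .y, .top, .clk, .idx, .ans] →
        s'.reg v = s₅.reg v := fun v h1 h2 => hf'.1 v (by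
      rw [forLoop_writesVar, not_or]; exact ⟨h1, queryStep_not_writesVar h2⟩)
    have hnb : ∀ b, b ≠ 3 → b ≠ 4 → b ≠ 5 → s'.mem b = s₅.mem b := fun b h3 h4 h5 => hf'.2 b (by
      rw [forLoop_writesBank]; exact queryStep_not_writesBank h3 h4 h5)
    have e' : Env N d fA fB n m k K len w s' := e₅.congr
      (fun v hv => hnv v (by rintro rfl; simp at hv) (by
        simp only [List.mem_cons, List.not_mem_nil, or_false] at hv
        rcases hv with rfl | rfl | rfl | rfl | rfl | rfl | rfl | rfl | rfl <;> simp))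
      (fun b hb => by
        simp only [List.mem_cons, List.not_mem_nil, or_false] at hb
        exact hnb b (by lia) (by lia) (by lia))
    refine (queryStep_ends hl hA hB hq hT₂ (r := r) (h := h) (j := j) e' ?_ ?_ hj hsj ?_ ?_ ?_ ?_
      σ).mono le_rfl fun s'' _ _ ⟨j3, jt, jl, ja, jg⟩ => ⟨?_, ?_, ?_, ?_, fun hG j' hj' ho => ?_⟩
    · rw [hnv _ (by simp) (by simp), v₅ _ (by simp), v₄ _ (by simp), hr]
    · rw [hnv _ (by simp) (by simp), v₅ _ (by simp), v₄ _ (by simp), hsh]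
    · rw [hnv _ (by simp) (by simp), m₅, it]
    · rwa [it]
    · rw [it]; push_cast; lia
    · rw [i3, g₅]; exact h₄.ok.mem
    · rw [St.set_mem, j3, i3]
    · exact (il.trans jl).congr rfl rfl rfl rfl (by simp) (by simp) (by simp) (by simp)
    · simp [jt, it]
    · have := ia.trans ja
      simpa [AnsStep] using this
    · have key : s''.reg .ans = 1 := by
        rcases Nat.lt_succ_iff_lt_or_eq.1 hj' with h1 | rfl
        · exact ja.one (ig hG j' h1 ho)
        · obtain ⟨h3, h4, h5⟩ := hgood hG
          exact jg (by rw [i3]; exact h3) h4 (h5 _ hj) ho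
      simpa using key
  obtain ⟨l₆, t₆, a₆, o₆⟩ := h₆
  -- Inside the loop the log was undone down to the end of the preprocessing; now everything is
  -- undone, so that the next group finds an empty memory.
  refine Ends.block_seq (fun _ => by simp; lia) fun _ => ?_
  have l₇ : Logged s (runIns [.asg .mark (.lit 0)] s₆) := l₆.congr rfl rfl rfl rfl (by simp)
    (by simp) (by simp) (by simp)
  refine (undo_ends l₇ (by simp [htop]) ?_).mono le_rfl
    fun s₈ _ hf₈ h₈ => ⟨h₈.1.trans hmem, h₈.2.1.trans htop, ?_, fun hG j hj ho => ?_⟩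
  · simp [t₆, htop]; lia
  · unfold AnsStep
    rw [hf₈.1 _ (by simp [undo])]
    simpa [AnsStep] using a₆
  · rw [hf₈.1 _ (by simp [undo])]
    simpa using o₆ hG j hj ho

end

/-! ### The program for all groups and all guesses of the parameters -/

theorem groupCost_mono {pre qry : RamProg} {N d n m m' k k' T₁ T₂ : ℕ} (hm : m ≤ m')
    (hk : k ≤ k') : groupCost pre qry N d n m k T₁ T₂ ≤ groupCost pre qry N d n m' k' T₁ T₂ := by
  unfold groupCost queryCost
  gcongr

/-- Guess the numbers `k` and `m` of vertices from `g` and handle all groups. -/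
def guessStep (L B C Q e κ : ℕ) (pre qry : RamProg) : Cmd :=
  .block [.asg .k (.var .g / .var .r + .lit 2), .asg .m (.var .g % .var .r + .lit 2),
    .asg .K ((.var .k - .lit 2) / .lit 3), .asg .len (.var .d / .var .K + .lit 1),
    .asg .S (.get 2 (.var .len)), .asg .W ((.var .n * .var .m + .lit 2 : Ex).pow κ)] ;;
  forLoop .h .H (groupStep L B C Q e pre qry)

theorem guessStep_not_writesVar {L B C Q e κ : ℕ} {pre qry : RamProg} {v : PVar}
    (hv : v ∈ [PVar.N, .d, .r, .n, .H, .g, .G]) :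
    ¬ (guessStep L B C Q e κ pre qry).WritesVar v := by
  have h0 : ¬ (groupStep L B C Q e pre qry).WritesVar v := groupStep_not_writesVar (by
    simp only [List.mem_cons, List.not_mem_nil, or_false] at hv
    rcases hv with rfl | rfl | rfl | rfl | rfl | rfl | rfl <;> simp)
  simp only [List.mem_cons, List.not_mem_nil, or_false] at hv
  rcases hv with rfl | rfl | rfl | rfl | rfl | rfl | rfl <;> simp [guessStep, h0]

theorem guessStep_not_writesBank {L B C Q e κ : ℕ} {pre qry : RamProg} {b : ℕ} (h3 : b ≠ 3)
    (h4 : b ≠ 4) (h5 : b ≠ 5) : ¬ (guessStep L B C Q e κ pre qry).WritesBank b := by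
  simp [guessStep, groupStep_not_writesBank h3 h4 h5]

/-- The tables are in place and the simulated memory is empty. -/
structure Ready (N d : ℕ) (fA fB : ℕ → ℕ → ℕ) (n r H : ℕ) (s : St) : Prop
    extends Data N d fA fB s where
  n_eq : s.reg .n = n
  r_eq : s.reg .r = r
  H_eq : s.reg .H = H
  pow_eq : ∀ t < d + 2, s.mem 2 (t : ℤ) = 2 ^ t
  top_eq : s.reg .top = 0
  mem_eq : s.mem 3 = fun _ => 0

/-- For all groups, the data structure with the given parameters works. -/
def ParamsOk (L κ N d n H T₁ T₂ : ℕ) (fA fB : ℕ → ℕ → ℕ) (pre qry : RamProg) (k m : ℕ) : Prop :=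
  ∀ h < H, GroupOk L N d n m k ((k - 2) / 3) (d / ((k - 2) / 3) + 1) h T₁ T₂
    (((n * m : ℕ) + 2 : ℤ) ^ κ) fA fB pre qry

/-- The numbers that occur for all guesses are bounded. -/
def AllLimits (X X₀ : ℤ) (B L κ N d n r T₁ T₂ : ℕ) : Prop :=
  ∀ k m, 2 ≤ k → k ≤ r + 1 → 2 ≤ m → m ≤ r + 1 → Limits X X₀ (((n * m : ℕ) + 2 : ℤ) ^ κ) B L N d n
    m k ((k - 2) / 3) (d / ((k - 2) / 3) + 1) T₁ T₂

/-- The running time of `guessStep`. -/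
def guessCost (pre qry : RamProg) (N d n r H T₁ T₂ : ℕ) : ℕ :=
  1 + (H * (groupCost pre qry N d n (r + 1) (r + 1) T₁ T₂ + 2) + 2)

section

variable {X X₀ : ℤ} {B L κ N d n r H T₁ T₂ C Q e : ℕ} {fA fB : ℕ → ℕ → ℕ} {pre qry : RamProg}

/-- A guess `g < r * r` encodes a pair in base `r`, shifted by `2` since both numbers are at least
`2`. For a wrong pair only time, restoration and soundness are claimed. -/
theorem guessStep_ends (hl : AllLimits X X₀ B L κ N d n r T₁ T₂) (hA : ∀ i l, fA i l ≤ 1)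
    (hB : ∀ i l, fB i l ≤ 1) (hp : pre.mag < B) (hq : qry.mag + 8 ≤ B)
    (hT₁ : T₁ = C * r ^ Q) (hT₂ : T₂ = C * r ^ e) {s : St} (hs : Ready N d fA fB n r H s)
    {g : ℕ} (hg : s.reg .g = g) (hgr : g < r * r) (hn : 1 ≤ n) :
    Ends X (guessStep L B C Q e κ pre qry) s (guessCost pre qry N d n r H T₁ T₂) (fun s' =>
      Ready N d fA fB n r H s' ∧ AnsStep N d fA fB s s' ∧
      (ParamsOk L κ N d n H T₁ T₂ fA fB pre qry (g / r + 2) (g % r + 2) → ∀ h < H, ∀ j < N,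
        GroupOrth N d n h fA fB j → s'.reg .ans = 1)) := by
  have hr : 0 < r := by
    rcases Nat.eq_zero_or_pos r with rfl | h
    · simp at hgr
    · exact h
  set k := g / r + 2 with hk
  set m := g % r + 2 with hm
  have hkr : g / r < r := Nat.div_lt_of_lt_mul hgr
  have hmr : g % r < r := Nat.mod_lt _ hr
  have hlim := hl k m (by lia) (by lia) (by lia) (by lia)
  have h2 := hlim.two_le
  have hXX := hlim.le
  set K := (k - 2) / 3 with hK
  set len := d / K + 1 with hlen
  set w : ℤ := ((n * m : ℕ) + 2 : ℤ) ^ κ with hw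
  have hbud := hlim.budget
  have hlenle := hlim.len_le
  have vk : (.var .g / .var .r + .lit 2 : Ex).val s = (k : ℕ) := by simp [hg, hs.r_eq, hk]
  have hmem2 := hs.pow_eq len (by lia)
  set s₁ := runIns [.asg .k (.var .g / .var .r + .lit 2), .asg .m (.var .g % .var .r + .lit 2),
    .asg .K ((.var .k - .lit 2) / .lit 3), .asg .len (.var .d / .var .K + .lit 1),
    .asg .S (.get 2 (.var .len)), .asg .W ((.var .n * .var .m + .lit 2 : Ex).pow κ)] s with hs₁
  have k₁ : s₁.reg .k = k := by simp [hs₁, hg, hs.r_eq, hk]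
  have m₁ : s₁.reg .m = m := by simp [hs₁, hg, hs.r_eq, hm]
  have K₁ : s₁.reg .K = K := by simp [hs₁, hg, hs.r_eq, hK, hk]
  have l₁ : s₁.reg .len = len := by simp [hs₁, hg, hs.r_eq, hlen, hK, hk, hs.d_eq]
  have S₁ : s₁.reg .S = 2 ^ len := by
    rw [← hmem2, ← l₁]; simp [hs₁]
  have W₁ : s₁.reg .W = w := by simp [hs₁, hw, hg, hs.r_eq, hm, hs.n_eq]
  have v₁ : ∀ v, v ∉ [PVar.k, .m, .K, .len, .S, .W] → s₁.reg v = s.reg v := fun v hv => by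
    simp only [List.mem_cons, List.not_mem_nil, or_false, not_or] at hv
    simp [hs₁, hv]
  have g₁ : s₁.mem = s.mem := rfl
  have e₁ : Env N d fA fB n m k K len w s₁ := ⟨hs.toData.congr (v₁ _ (by simp)) (v₁ _ (by simp))
    (by rw [g₁]) (by rw [g₁]), (v₁ _ (by simp)).trans hs.n_eq, m₁, k₁, K₁, l₁, S₁, W₁,
    by rw [g₁]; exact hs.pow_eq⟩
  refine Ends.block_seq (fun hb => ?_) fun hb => ?_
  · have hwX : |w| ≤ X := by rw [abs_of_nonneg hlim.word_nonneg]; exact hlim.word_le.trans hXX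
    have hdX := hb.1 .d
    rw [hs.d_eq, Nat.abs_cast] at hdX
    have hKk : K ≤ k := by lia
    have hmm : m ≤ n * m := Nat.le_mul_of_pos_left _ hn
    have a1 : (k : ℤ) ≤ X := by lia
    have a2 : (m : ℤ) ≤ X := by lia
    have a3 : (K : ℤ) ≤ X := by lia
    have a4 : (len : ℤ) ≤ X := by
      have h1 : d + 2 < 2 ^ (d + 2) := Nat.lt_two_pow_self
      have h3 : ((d + 2 : ℕ) : ℤ) < 2 ^ (d + 2) := by exact_mod_cast h1
      have := hlim.pow_le
      lia
    have b1 : s.reg .g / s.reg .r + 2 = k := by simp [hg, hs.r_eq, hk]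
    have b2 : s.reg .g % s.reg .r + 2 = m := by simp [hg, hs.r_eq, hm]
    have b3 : ((k : ℤ) - 2) / 3 = K := by rw [hK]; push_cast [show 2 ≤ k by lia]; rfl
    have b4 : (d : ℤ) / K + 1 = len := by rw [hlen]; push_cast; rfl
    have b5 : ((n : ℤ) * m + 2) ^ κ = w := by rw [hw]; push_cast; rfl
    simp [b1, b2, b3, b4, b5, hs.d_eq, hs.n_eq, hb.2, hwX, a1, a2, a3, a4]
  rw [← hs₁]
  clear_value s₁
  refine (Ends.forLoop (n := H) (T := groupCost pre qry N d n (r + 1) (r + 1) T₁ T₂)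
    (I := fun c s' => s'.mem 3 = (fun _ => 0) ∧ s'.reg .top = 0 ∧ AnsStep N d fA fB s s' ∧
      (ParamsOk L κ N d n H T₁ T₂ fA fB pre qry k m → ∀ h < c, ∀ j < N,
        GroupOrth N d n h fA fB j → s'.reg .ans = 1)) ?_ ?_ ?_ ?_ ?_ ?_
    fun h hh s' hb' hf' hsh hI => ?_).mono le_rfl fun s' _ hf' hI => ⟨?_, hI.2.2.1, hI.2.2.2⟩
  · lia
  · simp
  · exact groupStep_not_writesVar (by simp)
  · exact groupStep_not_writesVar (by simp)
  · exact (v₁ _ (by simp)).trans hs.H_eq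
  · exact ⟨by simp [g₁, hs.mem_eq], by simp [v₁, hs.top_eq], Or.inl (by simp [v₁]), by simp⟩
  · obtain ⟨i3, it, ia, io⟩ := hI
    have hnv : ∀ v ∈ [PVar.N, .d, .r, .n, .m, .k, .K, .len, .S, .W, .H], s'.reg v = s₁.reg v :=
      fun v hv => hf'.1 v (by
        simp only [List.mem_cons, List.not_mem_nil, or_false] at hv
        rw [forLoop_writesVar, not_or]
        rcases hv with rfl | rfl | rfl | rfl | rfl | rfl | rfl | rfl | rfl | rfl | rfl <;>
          exact ⟨by simp, groupStep_not_writesVar (by simp)⟩)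
    have e' : Env N d fA fB n m k K len w s' := e₁.congr
      (fun v hv => hnv v (by
        simp only [List.mem_cons, List.not_mem_nil, or_false] at hv ⊢; tauto))
      (fun b hb => hf'.2 b (by
        simp only [List.mem_cons, List.not_mem_nil, or_false] at hb
        rw [forLoop_writesBank]
        exact groupStep_not_writesBank (by lia) (by lia) (by lia)))
    refine (groupStep_ends hlim hA hB hp hq hT₁ hT₂ e' (h := h) ?_ hsh it i3 hn).mono
      (groupCost_mono (by lia) (by lia)) fun s'' _ _ ⟨j3, jt, ja, jo⟩ => ⟨?_, ?_, ?_,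
        fun hG h' hh' j hj ho => ?_⟩
    · rw [hnv _ (by simp), v₁ _ (by simp), hs.r_eq]
    · rw [St.set_mem, j3]
    · simpa using jt
    · simpa [AnsStep] using ia.trans ja
    · have key : s''.reg .ans = 1 := by
        rcases Nat.lt_succ_iff_lt_or_eq.1 hh' with h1 | rfl
        · exact ja.one (io hG h' h1 j hj ho)
        · exact jo (hG _ hh) j hj ho
      simpa using key
  · have hnv : ∀ v ∈ [PVar.N, .d, .r, .n, .H], s'.reg v = s.reg v := fun v hv => by
      rw [hf'.1 v, v₁ v]
      · simp only [List.mem_cons, List.not_mem_nil, or_false] at hv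
        rcases hv with rfl | rfl | rfl | rfl | rfl <;> simp
      · simp only [List.mem_cons, List.not_mem_nil, or_false] at hv
        rw [forLoop_writesVar, not_or]
        rcases hv with rfl | rfl | rfl | rfl | rfl <;>
          exact ⟨by simp, groupStep_not_writesVar (by simp)⟩
    have hnb : ∀ b, b ≠ 3 → b ≠ 4 → b ≠ 5 → s'.mem b = s.mem b := fun b h3 h4 h5 => by
      rw [hf'.2 b, g₁]
      rw [forLoop_writesBank]
      exact groupStep_not_writesBank h3 h4 h5
    exact ⟨hs.toData.congr (hnv _ (by simp)) (hnv _ (by simp)) (hnb _ (by simp) (by simp) (by simp))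
      (hnb _ (by simp) (by simp) (by simp)), (hnv _ (by simp)).trans hs.n_eq,
      (hnv _ (by simp)).trans hs.r_eq, (hnv _ (by simp)).trans hs.H_eq,
      by rw [hnb _ (by simp) (by simp) (by simp)]; exact hs.pow_eq, hI.2.1, hI.1⟩

/-- Try all guesses. -/
def search (L B C Q e κ : ℕ) (pre qry : RamProg) : Cmd :=
  forLoop .g .G (guessStep L B C Q e κ pre qry)

theorem search_ends (hl : AllLimits X X₀ B L κ N d n r T₁ T₂) (hA : ∀ i l, fA i l ≤ 1)
    (hB : ∀ i l, fB i l ≤ 1) (hp : pre.mag < B) (hq : qry.mag + 8 ≤ B)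
    (hT₁ : T₁ = C * r ^ Q) (hT₂ : T₂ = C * r ^ e) {s : St} (hs : Ready N d fA fB n r H s)
    (hG : s.reg .G = (r * r : ℕ)) (hn : 1 ≤ n) (hH : H = N / n + 1) (hans : s.reg .ans = 0)
    (hr : 1 ≤ r) {k m : ℕ} (hk : 2 ≤ k) (hkr : k ≤ r + 1) (hm : 2 ≤ m) (hmr : m ≤ r + 1)
    (hok : ParamsOk L κ N d n H T₁ T₂ fA fB pre qry k m) :
    Ends X (search L B C Q e κ pre qry) s
      (r * r * (guessCost pre qry N d n r H T₁ T₂ + 2) + 2)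
      (fun s' => (OrthPair N d fA fB → s'.reg .ans = 1) ∧
        (¬ OrthPair N d fA fB → s'.reg .ans = 0)) := by
  have hXX := (hl k m hk hkr hm hmr).le
  have h2 := (hl k m hk hkr hm hmr).two_le
  refine (Ends.forLoop (n := r * r) (T := guessCost pre qry N d n r H T₁ T₂)
    (I := fun c s' => Ready N d fA fB n r H s' ∧ AnsStep N d fA fB s s' ∧ ∀ g < c,
      (ParamsOk L κ N d n H T₁ T₂ fA fB pre qry (g / r + 2) (g % r + 2) → ∀ h < H, ∀ j < N,
        GroupOrth N d n h fA fB j → s'.reg .ans = 1)) ?_ ?_ ?_ ?_ hG ⟨?_, Or.inl (by simp), by simp⟩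
    fun g hg s' hb' hf' hsg hI => ?_).mono le_rfl fun s' _ hf' hI => ⟨?_, fun ho => ?_⟩
  · lia
  · simp
  · exact guessStep_not_writesVar (by simp)
  · exact guessStep_not_writesVar (by simp)
  · obtain ⟨hd, h1, h2, h3, h4, h5, h6⟩ := hs
    exact ⟨hd.congr (by simp) (by simp) rfl rfl, by simpa using h1, by simpa using h2,
      by simpa using h3, h4, by simpa using h5, h6⟩
  · obtain ⟨ir, ia, io⟩ := hI
    refine (guessStep_ends hl hA hB hp hq hT₁ hT₂ ir hsg hg hn).mono le_rfl
      fun s'' _ _ ⟨jr, ja, jo⟩ => ⟨?_, ?_, fun g' hg' hG h hh j hj ho => ?_⟩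
    · obtain ⟨hd, h1, h2, h3, h4, h5, h6⟩ := jr
      exact ⟨hd.congr (by simp) (by simp) rfl rfl, by simpa using h1, by simpa using h2,
        by simpa using h3, h4, by simpa using h5, h6⟩
    · simpa [AnsStep] using ia.trans ja
    · have key : s''.reg .ans = 1 := by
        rcases Nat.lt_succ_iff_lt_or_eq.1 hg' with h1 | rfl
        · exact ja.one (io g' h1 hG h hh j hj ho)
        · exact jo hG h hh j hj ho
      simpa using key
  · rintro ⟨i, hi, j, hj, hd⟩
    have e1 : ((k - 2) * r + (m - 2)) / r = k - 2 := by
      rw [Nat.add_comm, Nat.add_mul_div_right _ _ (by lia), Nat.div_eq_of_lt (by lia), zero_add]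
    have e2 : ((k - 2) * r + (m - 2)) % r = m - 2 := by
      rw [Nat.add_comm, Nat.add_mul_mod_self_right, Nat.mod_eq_of_lt (by lia)]
    -- The iteration with the right pair; vector `i` has offset `i % n` in group `i / n`, and this
    -- group is among the `H = N / n + 1` groups.
    refine hI.2.2 ((k - 2) * r + (m - 2)) ?_ ?_ (i / n) ?_ j hj ⟨i % n, Nat.mod_lt _ hn, ?_⟩
    · have : (k - 2 + 1) * r ≤ r * r := Nat.mul_le_mul_right _ (by lia)
      rw [add_mul] at this
      lia
    · rwa [e1, e2, Nat.sub_add_cancel hk, Nat.sub_add_cancel hm]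
    · rw [hH]
      exact Nat.lt_succ_of_le (Nat.div_le_div_right hi.le)
    · rwa [Nat.div_add_mod', Nat.mod_eq_of_lt hi]
  · rcases hI.2.1 with h | h
    · rw [h, hans]
    · exact absurd h.2 ho

end

/-! ### The program for orthogonal vectors -/

/-- Test all pairs. -/
def bruteForce : Cmd :=
  .block [.asg .NN (.var .N * .var .N)] ;;
  forLoop .a .NN (.block [.asg .idx (.var .a / .var .N), .asg .b (.var .a % .var .N)] ;; verify)

theorem bruteForce_ends {X : ℤ} (hX : 1 ≤ X) {N d : ℕ} (hN : ((N * N : ℕ) : ℤ) ≤ X)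
    {fA fB : ℕ → ℕ → ℕ} (hA : ∀ i l, fA i l ≤ 1) (hB : ∀ i l, fB i l ≤ 1) {s : St}
    (hs : Data N d fA fB s) (hans : s.reg .ans = 0) :
    Ends X bruteForce s (N * N * (3 * d + 8) + 3)
      (fun s' => (OrthPair N d fA fB → s'.reg .ans = 1) ∧
        (¬ OrthPair N d fA fB → s'.reg .ans = 0)) := by
  have vNN : (Ex.var .N * .var .N).val s = (N * N : ℕ) := by simp [hs.N_eq]
  refine (Ends.block_seq (U := N * N * (1 + (3 * d + 5) + 2) + 2) (fun hb => ?_) fun _ =>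
    (Ends.forLoop (n := N * N) (I := fun c s' => AnsStep N d fA fB s s' ∧ ∀ a < c,
      dot d (fA (a / N)) (fB (a % N)) = 0 → s'.reg .ans = 1) (by lia) ?_ ?_ ?_ ?_ ?_
      fun a ha s' _ hf hsa hI => ?_).mono le_rfl fun s' _ _ hI => ⟨?_, fun ho => ?_⟩).mono
    (by lia) fun _ _ _ h => h
  · simp only [OkIns, Ins.Ok, vNN, and_true, Nat.abs_cast]
    exact hN
  · simp
  · simp [verify]
  · simp [verify]
  · simp only [runIns, Ins.run, vNN]; simp
  · exact ⟨Or.inl (by simp), by simp⟩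
  · have hNpos : 0 < N := by
      rcases Nat.eq_zero_or_pos N with rfl | h
      · simp at ha
      · exact h
    have hd : Data N d fA fB s' :=
      Data.frame (s := runIns [.asg .NN (.var .N * .var .N)] s)
        (hs.congr (by simp) (by simp) rfl rfl) hf (by simp [verify]) (by simp [verify])
        (by simp [verify]) (by simp [verify])
    have hi : a / N < N := Nat.div_lt_of_lt_mul ha
    have hj : a % N < N := Nat.mod_lt _ hNpos
    have v1 : (Ex.var .a / .var .N).val s' = (a / N : ℕ) := by simp [hsa, hd.N_eq]
    have v2 : ∀ z, (Ex.var .a % .var .N).val (s'.set .idx z) = (a % N : ℕ) := fun z => by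
      simp [hsa, hd.N_eq]
    refine Ends.block_seq (fun hb => ?_) fun _ => ?_
    · have := hb.1 .N
      rw [hd.N_eq, Nat.abs_cast] at this
      simp only [OkIns, Ins.Ok, Ins.run, v1, v2, and_true, Nat.abs_cast]
      lia
    set s₁ := runIns [.asg .idx (.var .a / .var .N), .asg .b (.var .a % .var .N)] s' with hs₁
    have i₁ : s₁.reg .idx = (a / N : ℕ) := by simp only [hs₁, runIns, Ins.run, v1, v2]; simp
    have b₁ : s₁.reg .b = (a % N : ℕ) := by simp only [hs₁, runIns, Ins.run, v1, v2]; simp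
    have a₁ : s₁.reg .ans = s'.reg .ans := by simp [hs₁]
    have d₁ : Data N d fA fB s₁ := hd.congr (by simp [hs₁]) (by simp [hs₁]) rfl rfl
    clear_value s₁
    refine (verify_ends hX hA hB d₁ hi hj i₁ b₁).mono le_rfl
      fun s'' _ _ h => ⟨?_, fun a' ha' h0 => ?_⟩
    · unfold AnsStep
      rw [St.set_reg, if_neg (by simp), h, a₁]
      split_ifs with h1
      · exact Or.inr ⟨rfl, _, hi, _, hj, h1⟩
      · exact hI.1
    · rw [St.set_reg, if_neg (by simp), h, a₁]
      rcases Nat.lt_succ_iff_lt_or_eq.1 ha' with h1 | rfl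
      · rw [hI.2 a' h1 h0, ite_self]
      · rw [if_pos h0]
  · rintro ⟨i, hi, j, hj, hd⟩
    refine hI.2 (i * N + j) ?_ ?_
    · have : (i + 1) * N ≤ N * N := Nat.mul_le_mul_right _ hi
      rw [add_mul] at this
      lia
    · rwa [Nat.add_comm, Nat.add_mul_div_right _ _ (by lia), Nat.div_eq_of_lt hj, zero_add,
        Nat.add_mul_mod_self_right, Nat.mod_eq_of_lt hj]
  · rcases hI.1 with h | h
    · rw [h, hans]
    · exact absurd h.2 ho

/-- Compute the integer part of the `Q`-th root of `N`. -/
def findRoot (Q : ℕ) : Cmd :=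
  .block [.asg .r (.lit 0)] ;;
  forLoop .g .N (.ite (.var .N + .lit 1 - (.var .r + .lit 1 : Ex).pow Q)
    (.block [.asg .r (.var .r + .lit 1)]) (.block []))

/-- After `c` rounds the counter is `c` or has reached the root. Since `N < (N + 1) ^ Q`, it has
reached the root after `N` rounds in either case, and linear time is affordable. -/
theorem findRoot_ends {X : ℤ} (hX : 1 ≤ X) {N Q r : ℕ} (hQ : Q ≠ 0) (hr : r ^ Q ≤ N)
    (hr' : N < (r + 1) ^ Q) {s : St} (hs : s.reg .N = N) :
    Ends X (findRoot Q) s (4 * N + 3) (fun s' => s'.reg .r = r) := by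
  refine (Ends.block_seq (U := N * ((1 + 1) + 2) + 2) (fun hb => by simp; lia) fun _ =>
    (Ends.forLoop (n := N) (I := fun c s' => ∃ t : ℕ, s'.reg .r = t ∧ t ^ Q ≤ N ∧
      (t = c ∨ N < (t + 1) ^ Q)) (by lia) ?_ ?_ ?_ ?_ ?_
      fun a ha s' _ hf hsa hI => ?_).mono le_rfl fun s' _ _ hI => ?_).mono
    (by lia) fun _ _ _ h => h
  · simp
  · simp
  · simp
  · simpa using hs
  · exact ⟨0, by simp, by simp [hQ], Or.inl rfl⟩
  · obtain ⟨t, h1, h2, h3⟩ := hI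
    have hN' : s'.reg .N = N := by rw [hf.1 _ (by simp)]; simpa using hs
    have hv : (.var .N + .lit 1 - (.var .r + .lit 1 : Ex).pow Q : Ex).val s' =
        ((N : ℤ) + 1 - ((t + 1) ^ Q : ℕ)) := by
      simp [hN', h1]
    refine Ends.ite (fun h => Ends.block (fun hb => ?_) ?_) fun h => Ends.block (fun _ => trivial) ?_
    · have h4 := hb.1 .N
      rw [hN', Nat.abs_cast] at h4
      rw [hv] at h
      have h5 : t + 1 ≤ (t + 1) ^ Q := Nat.le_self_pow hQ _
      simp only [OkIns, Ins.Ok, Ex.val_add, Ex.val_var, Ex.val_lit, h1, and_true]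
      rw [abs_of_nonneg (by lia)]
      lia
    · rw [hv] at h
      refine ⟨t + 1, by simp [h1], by lia, ?_⟩
      rcases h3 with rfl | h3
      · exact Or.inl rfl
      · lia
    · rw [hv] at h
      exact ⟨t, by simp [h1], h2, Or.inr (by lia)⟩
  · obtain ⟨t, h1, h2, h3⟩ := hI
    have h4 : N < (t + 1) ^ Q := by
      rcases h3 with rfl | h3
      · exact (Nat.lt_succ_self _).trans_le (Nat.le_self_pow hQ _)
      · exact h3
    have h5 : t < r + 1 := lt_of_pow_lt_pow_left₀ Q (by lia) (h2.trans_lt hr')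
    have h6 : r < t + 1 := lt_of_pow_lt_pow_left₀ Q (by lia) (hr.trans_lt h4)
    rw [h1, show t = r by lia]

/-- Find the parameters, the tables and then the answer with the help of the data structure. -/
def reduction (L B C Q σ e κ : ℕ) (pre qry : RamProg) : Cmd :=
  findRoot Q ;;
  .block [.asg .n ((Ex.var .r).pow σ), .asg .H (.var .N / .var .n + .lit 1),
    .asg .G (.var .r * .var .r)] ;;
  powTable ;; search L B C Q e κ pre qry

/-- The running time of `reduction`. -/
def reductionCost (pre qry : RamProg) (N d n r H T₁ T₂ : ℕ) : ℕ :=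
  4 * N + 3 + (1 + (3 * d + 9 + (r * r * (guessCost pre qry N d n r H T₁ T₂ + 2) + 2)))

theorem reduction_ends {X X₀ : ℤ} {B L κ N d n r H T₁ T₂ C Q σ e : ℕ} {fA fB : ℕ → ℕ → ℕ}
    {pre qry : RamProg} (hl : AllLimits X X₀ B L κ N d n r T₁ T₂) (hA : ∀ i l, fA i l ≤ 1)
    (hB : ∀ i l, fB i l ≤ 1) (hp : pre.mag < B) (hq : qry.mag + 8 ≤ B) (hQ : 2 ≤ Q) (hσQ : σ ≤ Q)
    (hr1 : 1 ≤ r) (hr : r ^ Q ≤ N) (hr' : N < (r + 1) ^ Q)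
    (hT₁ : T₁ = C * r ^ Q) (hT₂ : T₂ = C * r ^ e) (hn : n = r ^ σ) (hH : H = N / n + 1)
    {s : St} (hs : Data N d fA fB s) (hans : s.reg .ans = 0) (htop : s.reg .top = 0)
    (hmem : s.mem 3 = fun _ => 0) (hNX : (N : ℤ) + 1 ≤ X) {k m : ℕ} (hk : 2 ≤ k) (hkr : k ≤ r + 1)
    (hm : 2 ≤ m) (hmr : m ≤ r + 1) (hok : ParamsOk L κ N d n H T₁ T₂ fA fB pre qry k m) :
    Ends X (reduction L B C Q σ e κ pre qry) s (reductionCost pre qry N d n r H T₁ T₂)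
      (fun s' => (OrthPair N d fA fB → s'.reg .ans = 1) ∧
        (¬ OrthPair N d fA fB → s'.reg .ans = 0)) := by
  refine Ends.seq (findRoot_ends (by lia) (by lia) hr hr' hs.N_eq) fun s₁ _ hf₁ hr₁ => ?_
  have d₁ : Data N d fA fB s₁ := hs.frame hf₁ (by simp [findRoot]) (by simp [findRoot])
    (by simp [findRoot]) (by simp [findRoot])
  have ans₁ : s₁.reg .ans = 0 := by rw [hf₁.1 _ (by simp [findRoot]), hans]
  have top₁ : s₁.reg .top = 0 := by rw [hf₁.1 _ (by simp [findRoot]), htop]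
  have mem₁ : s₁.mem 3 = fun _ => 0 := by rw [hf₁.2 _ (by simp [findRoot]), hmem]
  have hn1 : 1 ≤ n := by rw [hn]; exact Nat.one_le_pow _ _ hr1
  have hnN : n ≤ N := by
    rw [hn]; exact (Nat.pow_le_pow_right hr1 hσQ).trans hr
  have hG : r * r ≤ N := by
    rw [← pow_two]; exact (Nat.pow_le_pow_right hr1 hQ).trans hr
  have vn : ((r : ℤ)) ^ σ = n := by rw [hn]; push_cast; rfl
  have vH : ((N : ℤ)) / n + 1 = H := by rw [hH]; push_cast; rfl
  have vG : (r : ℤ) * r = (r * r : ℕ) := by push_cast; rfl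
  have hHN : H ≤ N + 1 := by rw [hH]; exact Nat.succ_le_succ (Nat.div_le_self _ _)
  set l : List Ins := [.asg .n ((Ex.var .r).pow σ), .asg .H (.var .N / .var .n + .lit 1),
    .asg .G (.var .r * .var .r)] with hldef
  refine Ends.block_seq (fun hb => ?_) fun _ => ?_
  · have h1 : (n : ℤ) ≤ X := by lia
    have h2 : (H : ℤ) ≤ X := by lia
    have h3 : ((r * r : ℕ) : ℤ) ≤ X := by lia
    simp only [hldef, OkIns, Ins.Ok, Ins.run, Ex.val_pow, Ex.val_var, Ex.val_lit, Ex.val_add,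
      Ex.val_div, Ex.val_mul, hr₁, vn, d₁.N_eq, St.set_reg, reduceCtorEq, if_false, if_true, vH, vG,
      Nat.abs_cast, and_true]
    exact ⟨h1, h2, h3⟩
  set s₂ := runIns l s₁ with hs₂
  have n₂ : s₂.reg .n = n := by simp [hs₂, hldef, hr₁, vn]
  have H₂ : s₂.reg .H = H := by simp [hs₂, hldef, hr₁, vn, d₁.N_eq, vH]
  have G₂ : s₂.reg .G = (r * r : ℕ) := by simp [hs₂, hldef, hr₁]
  have v₂ : ∀ v, v ∉ [PVar.n, .H, .G] → s₂.reg v = s₁.reg v := fun v hv => by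
    simp only [List.mem_cons, List.not_mem_nil, or_false, not_or] at hv
    simp [hs₂, hldef, hv]
  have g₂ : s₂.mem = s₁.mem := rfl
  clear_value s₂
  have d₂ : Data N d fA fB s₂ := d₁.congr (v₂ _ (by simp)) (v₂ _ (by simp)) (by rw [g₂]) (by rw [g₂])
  refine Ends.seq (powTable_ends (hl k m hk hkr hm hmr).pow_le d₂.d_eq) fun s₃ _ hf₃ h₃ => ?_
  have v₃ : ∀ v ∈ [PVar.N, .d, .n, .r, .H, .G, .top, .ans], s₃.reg v = s₂.reg v := fun v hv => by
    simp only [List.mem_cons, List.not_mem_nil, or_false] at hv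
    refine hf₃.1 v ?_
    rcases hv with rfl | rfl | rfl | rfl | rfl | rfl | rfl | rfl <;> simp [powTable]
  refine search_ends hl hA hB hp hq hT₁ hT₂ (s := s₃) ⟨d₂.congr (v₃ _ (by simp)) (v₃ _ (by simp))
    (hf₃.2 _ (by simp [powTable])) (hf₃.2 _ (by simp [powTable])), ?_, ?_, ?_, h₃, ?_, ?_⟩ ?_ hn1 hH
    ?_ hr1 hk hkr hm hmr hok
  · rw [v₃ _ (by simp), n₂]
  · rw [v₃ _ (by simp), v₂ _ (by simp), hr₁]
  · rw [v₃ _ (by simp), H₂]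
  · rw [v₃ _ (by simp), v₂ _ (by simp), top₁]
  · rw [hf₃.2 _ (by simp [powTable]), g₂, mem₁]
  · rw [v₃ _ (by simp), G₂]
  · rw [v₃ _ (by simp), v₂ _ (by simp), ans₁]

/-- The program for orthogonal vectors. -/
def ovProgram (N₀ L B C Q σ e κ : ℕ) (pre qry : RamProg) : Cmd :=
  .ite (.lit N₀ - .var .N) bruteForce (reduction L B C Q σ e κ pre qry) ;;
  .block [.asg .N (.var .ans)]

theorem ovProgram_ends {X : ℤ} {N₀ L B C Q σ e κ N T : ℕ} {pre qry : RamProg}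
    {P : Prop} {s : St} (hN : s.reg .N = N)
    (h1 : N < N₀ → Ends X bruteForce s T
      (fun s' => (P → s'.reg .ans = 1) ∧ (¬ P → s'.reg .ans = 0)))
    (h2 : N₀ ≤ N → Ends X (reduction L B C Q σ e κ pre qry) s T
      (fun s' => (P → s'.reg .ans = 1) ∧ (¬ P → s'.reg .ans = 0))) :
    Ends X (ovProgram N₀ L B C Q σ e κ pre qry) s (T + 2)
      (fun s' => (P → s'.reg .N = 1) ∧ (¬ P → s'.reg .N = 0)) := by
  refine (Ends.seq (Ends.ite (fun h => h1 ?_) fun h => h2 ?_) (U := 1) fun s' _ _ h' =>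
    Ends.block (fun hb => (?_ : OkIns X [.asg .N (.var .ans)] s')) ?_).mono (by lia)
      fun _ _ _ h => h
  · simp [hN] at h; exact h
  · simp [hN] at h; exact h
  · exact ⟨hb.1 _, trivial⟩
  · simpa using h'

/-! ### The data structure answers the queries of the reduction -/

theorem memTable_eq_partTable {n m : ℕ} (f : Fin n → Fin m → ℤ) {g : ℕ → ℤ}
    (h : ∀ i j, f i j = g (i * m + j)) : memTable f = partTable g (n * m) := by
  ext a
  simp only [memTable, partTable]
  by_cases ha : 0 ≤ a ∧ a.toNat < n * m
  · rw [dif_pos ha, if_pos (by lia), h]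
    have h1 := congrArg Fin.val (finProdFinEquiv.apply_symm_apply (⟨a.toNat, ha.2⟩ : Fin (n * m)))
    rw [finProdFinEquiv_apply_val] at h1
    simp only at h1
    exact congrArg g (by rw [Nat.mul_comm, Nat.add_comm]; exact h1)
  · rw [dif_neg ha, if_neg (by lia)]

theorem annInit_eq_annState {n m : ℕ} (k : ℕ) (P : Fin n → Fin m → RatPoint) {f g : ℕ → ℤ}
    (hf : ∀ i j, (P i j).num 0 = f (i * m + j)) (hg : ∀ i j, (P i j).num 1 = g (i * m + j))
    (hd : ∀ i j t, (P i j).den t = 1) : annInit k P 1 1 = annState n m k f g := by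
  simp only [annInit, annState, RamState.setReg, withPoints, RamState.mk.injEq]
  constructor
  · funext r
    simp only [Function.update_apply]
    split <;> simp_all
  · funext b
    split
    · simpa using memTable_eq_partTable _ hf
    · simpa using memTable_eq_partTable (g := fun _ => 1) (fun i j => ((P i j).den 0 : ℤ))
        (by simp [hd])
    · simpa using memTable_eq_partTable _ hg
    · simpa using memTable_eq_partTable (g := fun _ => 1) (fun i j => ((P i j).den 1 : ℤ))
        (by simp [hd])
    · simp_all

theorem loadQuery_eq_withPoints {k : ℕ} (σ : RamState) (Q : Fin k → RatPoint) {f g : ℕ → ℤ}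
    (hf : ∀ j, (Q j).num 0 = f j) (hg : ∀ j, (Q j).num 1 = g j)
    (hd : ∀ j t, (Q j).den t = 1) : loadQuery σ Q = withPoints σ 4 f g k := by
  simp only [loadQuery, withPoints, RamState.mk.injEq, true_and]
  funext b
  split
  · simpa using memTable_eq_partTable (fun (_ : Fin 1) j => (Q j).num 0) (g := f) (by simp [hf])
  · simpa using memTable_eq_partTable (g := fun _ => 1) (fun (_ : Fin 1) j => ((Q j).den 0 : ℤ))
      (by simp [hd])
  · simpa using memTable_eq_partTable (fun (_ : Fin 1) j => (Q j).num 1) (g := g) (by simp [hg])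
  · simpa using memTable_eq_partTable (g := fun _ => 1) (fun (_ : Fin 1) j => ((Q j).den 1 : ℤ))
      (by simp [hd])
  · simp_all

theorem dot_eq_zero_iff {d : ℕ} {α β : ℕ → ℕ} : dot d α β = 0 ↔ ∀ l < d, α l * β l = 0 := by
  simp [dot, Finset.sum_eq_zero_iff]

theorem latticePoint_bounded {x y : ℤ} {R : ℕ} (hx : |x| ≤ R) (hy : |y| ≤ R) (hR : 1 ≤ R) :
    (latticePoint x y).Bounded R := by
  intro i
  refine ⟨?_, hR⟩
  simp only [latticePoint]
  split_ifs
  · exact hx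
  · exact hy

/-- With threshold `1`, an orthogonal vector puts its comb within the threshold, so some comb within
`3 - ε` is returned, and the gap lemma makes its vector orthogonal too. Only the first clause of a
correct answer matters, as answers are verified anyway. -/
theorem groupOk_of_isPlanarANN {pre qry : RamProg} {κ ρ n m k K len d N L T₁ T₂ : ℕ} {α δ Tp Tq : ℝ}
    (hann : IsPlanarANN pre qry κ ρ α n m k Tp Tq) (hc : CombOk k m len d K) (hρ : 1 ≤ ρ)
    (hL : 3 ≤ L) (hLn : L ≤ n) (hnN : n ≤ N) (hδ0 : 0 < δ) (hα : α < δ)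
    (hδ : δ ^ 2 * (4 + (L : ℝ) ^ 2) ≤ 9 * (L : ℝ) ^ 2) {fA fB : ℕ → ℕ → ℕ}
    (hA : ∀ i l, fA i l ≤ 1) (hB : ∀ i l, fB i l ≤ 1)
    (hinj : ∀ i < N, ∀ i' < N, (∀ l < d, fA i l = fA i' l) → i = i')
    (hT₁ : Tp ≤ T₁) (hT₂ : Tq ≤ T₂) (h : ℕ) :
    GroupOk L N d n m k K len h T₁ T₂ (((n * m : ℕ) + 2 : ℤ) ^ κ) fA fB pre qry := by
  have hm := hc.two_le_m
  have hN : 0 < N := by lia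
  have hnm1 : 1 ≤ n * m := Nat.mul_pos (by lia) (by lia)
  have hR : n * m ≤ (n * m) ^ ρ := Nat.le_self_pow (by lia) _
  have hLm : L * m ≤ n * m := Nat.mul_le_mul_right _ hLn
  have h6 : 3 * 2 ≤ n * m := Nat.mul_le_mul (by lia) hm
  set P : Fin n → Fin m → RatPoint := fun i => combCurve L m len d (fA ((h * n + i) % N)) with hP
  have hbdd : ∀ i j, (P i j).Bounded ((n * m) ^ ρ) := fun i j => by
    refine latticePoint_bounded ?_ ?_ (by lia)
    · rcases tooth_eq len d (fA ((h * n + i) % N)) j with h | h <;> rw [h] <;> simp <;>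
        exact_mod_cast hnm1.trans hR
    · have h1 : L * (j : ℕ) ≤ L * m := Nat.mul_le_mul_left _ j.2.le
      rw [← Nat.cast_mul, Nat.abs_cast]
      exact_mod_cast h1.trans (hLm.trans hR)
  have hPinj : Function.Injective fun i => planeVertices (P i) := by
    intro i i' he
    have h1 := hinj _ (Nat.mod_lt _ hN) _ (Nat.mod_lt _ hN)
      (hc.eq_of_combCurve_eq (hA _) (hA _) he)
    -- As `n ≤ N`, the indices of a group stay distinct after wrapping around.
    have h2 : (i : ℕ) ≡ i' [MOD N] := Nat.ModEq.add_left_cancel' (h * n) h1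
    exact Fin.ext (Nat.ModEq.eq_of_lt_of_lt h2 (by lia) (by lia))
  obtain ⟨t, σ, ht, htT, hq⟩ := hann P 1 1 hbdd hPinj one_pos one_pos (by lia) (by lia)
  rw [annInit_eq_annState (f := groupTooth len d N n m h fA) (g := groupHeight L m)] at ht
  rotate_left
  · intro i j
    have h1 : (i * m + j : ℕ) / m = i := by
      rw [Nat.add_comm, Nat.add_mul_div_right _ _ (by lia), Nat.div_eq_of_lt j.2, zero_add]
    have h2 : (i * m + j : ℕ) % m = j := by
      rw [Nat.add_comm, Nat.add_mul_mod_self_right, Nat.mod_eq_of_lt j.2]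
    simp [hP, combCurve, latticePoint, groupTooth, h1, h2]
  · intro i j
    have h2 : (i * m + j : ℕ) % m = j := by
      rw [Nat.add_comm, Nat.add_mul_mod_self_right, Nat.mod_eq_of_lt j.2]
    simp [hP, combCurve, latticePoint, groupHeight, h2]
  · intro i j t
    rfl
  refine ⟨t, σ, ht, by exact_mod_cast htT.trans hT₁, fun j hj => ?_⟩
  have hqb : ∀ v, (queryCurve L k m len d K (fB j) v).Bounded ((n * m) ^ ρ) := fun v => by
    refine latticePoint_bounded ?_ ?_ (by lia)
    · have h1 : 2 * ((v : ℕ) % 3 / 2) ≤ n * m := by lia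
      rw [← Nat.cast_ofNat, ← Nat.cast_mul, Nat.abs_cast]
      exact_mod_cast h1.trans hR
    · have h1 : L * queryPos len d K m (fB j) v ≤ L * m :=
        Nat.mul_le_mul_left _ (by have := hc.queryPos_le (hB j) v; lia)
      rw [← Nat.cast_mul, Nat.abs_cast]
      exact_mod_cast h1.trans (hLm.trans hR)
  obtain ⟨u, τ, hu, huT, hans⟩ := hq _ hqb
  rw [loadQuery_eq_withPoints (f := vertexX) (g := vertexY L len d K m (fB j))] at hu
  rotate_left
  · intro v
    simp [queryCurve, latticePoint, vertexX]
  · intro v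
    simp [queryCurve, latticePoint, vertexY]
  · intro v t
    rfl
  refine ⟨u, τ, hu, by exact_mod_cast huT.trans hT₂, ?_⟩
  rintro ⟨i, hi, hd⟩
  obtain ⟨i', hi', hdist⟩ := hans.1 ⟨⟨i, hi⟩, by
    simpa using hc.curveDist_le_one (L := L) (hB j) (dot_eq_zero_iff.1 hd)⟩
  refine ⟨i', i'.2, hi', dot_eq_zero_iff.2 ?_⟩
  refine hc.orthogonal_of_curveDist_lt hL hδ (hB j) (hdist.trans_lt ?_)
  rw [ENNReal.ofReal_lt_ofReal_iff hδ0]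
  simpa using hα

/-! ### Bounds for numbers, running times and parameters -/

/-- `X₀ = A ^ (4 κ + 8)` bounds the simulated memory, because words there are at most `(n m + 2) ^ κ
≤ (A ^ 4) ^ κ`. The bound `X = X₀² A²` leaves room for products of such words and for interleaved
addresses. -/
theorem allLimits_of_le {A B L κ N d n r T₁ T₂ : ℕ} (hA : 2 ≤ A) (hn1 : 1 ≤ n) (hn : n ≤ A)
    (hr : r + 1 ≤ A) (hd : 2 ^ (d + 2) ≤ A) (hL : L ≤ A) (hB : B + 5 ≤ A) (hT₁ : T₁ ≤ A)
    (hT₂ : T₂ ≤ A) (hN : 0 < N) :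
    AllLimits ((A : ℤ) ^ (8 * κ + 18)) ((A : ℤ) ^ (4 * κ + 8)) B L κ N d n r T₁ T₂ := by
  intro k m hk hkr hm hmr
  have hA1 : 1 ≤ A := by lia
  have hmA : m ≤ A := hmr.trans hr
  have hkA : k ≤ A := hkr.trans hr
  have hnm : n * m ≤ A * A := Nat.mul_le_mul hn hmA
  set X₀ : ℕ := A ^ (4 * κ + 8) with hX₀
  have hX : A ^ (8 * κ + 18) = X₀ * X₀ * (A * A) := by rw [hX₀]; ring
  have h8 : A ^ 8 ≤ X₀ := Nat.pow_le_pow_right hA1 (by lia)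
  have h2A : 2 * A ≤ A * A := Nat.mul_le_mul_right _ hA
  have h4 : 4 * (A * A) ≤ A ^ 4 := by
    have := Nat.mul_le_mul (Nat.mul_le_mul hA hA) (le_refl (A * A))
    calc 4 * (A * A) ≤ A * A * (A * A) := by lia
      _ = A ^ 4 := by ring
  have h48 : 16 * A ^ 4 ≤ A ^ 8 := by
    have := Nat.pow_le_pow_left hA 4
    calc 16 * A ^ 4 ≤ A ^ 4 * A ^ 4 := Nat.mul_le_mul_right _ (by lia)
      _ = A ^ 8 := by ring
  have hX₀A : A ≤ X₀ := by lia
  have hX₀1 : 1 ≤ X₀ * X₀ := Nat.mul_pos (by lia) (by lia)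
  have hlen : d / ((k - 2) / 3) + 1 ≤ d + 1 := Nat.succ_le_succ (Nat.div_le_self _ _)
  have h2len : 2 ^ (d / ((k - 2) / 3) + 1) ≤ A :=
    (Nat.pow_le_pow_right (by lia) (by lia)).trans hd
  refine ⟨by exact_mod_cast hA.trans hX₀A, by positivity, ?_, ?_, ?_, ?_, ?_, ?_, ?_, by lia, hlen,
    rfl, by lia, hN⟩
  · have h1 : (n * m + 2) ^ κ ≤ X₀ := by
      calc (n * m + 2) ^ κ ≤ (A ^ 4) ^ κ := Nat.pow_le_pow_left (by lia) _
        _ = A ^ (4 * κ) := (pow_mul _ _ _).symm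
        _ ≤ X₀ := Nat.pow_le_pow_right hA1 (by lia)
    exact_mod_cast h1
  · have h1 : X₀ * (B + 5) + (B + 5) ≤ A ^ (8 * κ + 18) := by
      rw [hX]
      calc X₀ * (B + 5) + (B + 5) ≤ X₀ * A + X₀ * A :=
            add_le_add (Nat.mul_le_mul_left _ hB) (hB.trans (Nat.le_mul_of_pos_left _ (by lia)))
        _ = X₀ * 1 * (2 * A) := by ring
        _ ≤ X₀ * X₀ * (A * A) := Nat.mul_le_mul (Nat.mul_le_mul_left _ (by lia)) h2A
    exact_mod_cast h1
  · have h1 : 2 * (X₀ * X₀) ≤ A ^ (8 * κ + 18) := by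
      rw [hX, mul_comm 2]
      exact Nat.mul_le_mul_left _ (by lia)
    exact_mod_cast h1
  · have h1 : 2 ^ (d + 2) ≤ A ^ (8 * κ + 18) := hd.trans (Nat.le_self_pow (by lia) _)
    exact_mod_cast h1
  · have h1 : (B + 5) * (B + 5) ≤ A ^ (8 * κ + 18) := by
      rw [hX]
      exact (Nat.mul_le_mul hB hB).trans (Nat.le_mul_of_pos_left _ hX₀1)
    exact_mod_cast h1
  · have h1 : L * (((k - 2) / 3 + 1) * 2 ^ (d / ((k - 2) / 3) + 1) + m) ≤ X₀ := by
      calc _ ≤ A * (A * A + A * A) := Nat.mul_le_mul hL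
            (add_le_add (Nat.mul_le_mul (by lia) h2len) (hmA.trans (Nat.le_mul_of_pos_left _ hA1)))
        _ = 2 * A * (A * A) := by ring
        _ ≤ A * A * (A * A) := Nat.mul_le_mul_right _ h2A
        _ = A ^ 4 := by ring
        _ ≤ X₀ := by lia
    exact_mod_cast h1
  · have h1 : 4 * (n * m) + 5 + T₁ + 4 * k + T₂ ≤ X₀ := by lia
    exact_mod_cast h1

/-- The `N` queries, of cost proportional to `R` each, dominate. Writing the combs costs about `n *
r * d ≤ n * r ^ 2 ≤ N`, and the preprocessing at most `C * N`. -/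
theorem groupCost_le {pre qry : RamProg} {N d n r T₁ T₂ C R : ℕ} (hr : 1 ≤ r) (hd : d ≤ r)
    (hR : r * r ≤ R) (hnr : n * (r * r) ≤ N) (hN : 1 ≤ N) (hT₁ : T₁ ≤ C * N) (hT₂ : T₂ ≤ C * R) :
    groupCost pre qry N d n (r + 1) (r + 1) T₁ T₂ + 2 ≤
      (200 + 10 * C + simCost pre * (1 + C) + simCost qry * (1 + C)) * (N * R) := by
  have hrr : r ≤ r * r := Nat.le_mul_of_pos_left _ hr
  have hR1 : 1 ≤ R := by lia
  have hNR : N ≤ N * R := Nat.le_mul_of_pos_right _ hR1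
  have a1 : (r + 1) * (3 * d + 10) ≤ 26 * (r * r) := by
    calc (r + 1) * (3 * d + 10) ≤ (2 * r) * (13 * r) := Nat.mul_le_mul (by lia) (by lia)
      _ = 26 * (r * r) := by ring
  have a2 : n * (r + 1) * (3 * d + 10) ≤ 26 * N := by
    rw [mul_assoc]
    calc n * ((r + 1) * (3 * d + 10)) ≤ n * (26 * (r * r)) := Nat.mul_le_mul_left _ a1
      _ = 26 * (n * (r * r)) := by ring
      _ ≤ 26 * N := Nat.mul_le_mul_left _ hnr
  have a3 : n * (r + 1) ≤ 2 * N := by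
    calc n * (r + 1) ≤ n * (2 * (r * r)) := Nat.mul_le_mul_left _ (by lia)
      _ = 2 * (n * (r * r)) := by ring
      _ ≤ 2 * N := Nat.mul_le_mul_left _ hnr
  have a4 : simCost pre * (1 + T₁) ≤ simCost pre * (1 + C) * N := by
    rw [mul_assoc]
    refine Nat.mul_le_mul_left _ ?_
    rw [add_mul]; lia
  have a5 : simCost qry * (1 + T₂) ≤ simCost qry * (1 + C) * R := by
    rw [mul_assoc]
    refine Nat.mul_le_mul_left _ ?_
    rw [add_mul]; lia
  have a6 : queryCost qry d (r + 1) T₂ + 2 ≤ (70 + simCost qry * (1 + C) + 2 * C) * R := by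
    unfold queryCost
    rw [add_mul, add_mul, mul_assoc 2 C R]
    lia
  have a7 : N * (queryCost qry d (r + 1) T₂ + 2) ≤
      (70 + simCost qry * (1 + C) + 2 * C) * (N * R) := by
    calc _ ≤ N * ((70 + simCost qry * (1 + C) + 2 * C) * R) := Nat.mul_le_mul_left _ a6
      _ = _ := by ring
  have a8 : simCost pre * (1 + C) * N ≤ simCost pre * (1 + C) * (N * R) :=
    Nat.mul_le_mul_left _ hNR
  have a9 : C * N ≤ C * (N * R) := Nat.mul_le_mul_left _ hNR
  unfold groupCost
  calc _ ≤ 26 * N + 3 + (5 + (1 + (simCost pre * (1 + C) * (N * R) + (1 +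
        ((70 + simCost qry * (1 + C) + 2 * C) * (N * R) + 2 +
          (1 + (2 * (8 * N + 5 + C * (N * R)) + 1))))))) + 2 := by lia
    _ ≤ 130 * (N * R) + (simCost pre * (1 + C) * (N * R) +
        (70 + simCost qry * (1 + C) + 2 * C) * (N * R) + 8 * (C * (N * R))) := by lia
    _ = _ := by ring

/-- The balance of the reduction: `r ^ 2` guesses, `H` groups with `H * n ≤ 2 * N`, and cost `N * R`
per group. As `n = r ^ 3 * R`, multiplying by one more `r` gives `N * (H * n)`. -/
theorem reductionCost_le {pre qry : RamProg} {N d n r H T₁ T₂ C R : ℕ} (hr : 1 ≤ r) (hd : d ≤ r)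
    (hR : r * r ≤ R) (hn : n = r ^ 3 * R) (hnr : n * (r * r) ≤ N)
    (hH : H = N / n + 1) (hT₁ : T₁ ≤ C * N) (hT₂ : T₂ ≤ C * R) :
    reductionCost pre qry N d n r H T₁ T₂ * r ≤
      (450 + 20 * C + 2 * (simCost pre * (1 + C)) + 2 * (simCost qry * (1 + C))) * (N * N) := by
  have hrr : r ≤ r * r := Nat.le_mul_of_pos_left _ hr
  have hn1 : 1 ≤ n := by
    rw [hn]; exact Nat.mul_pos (by positivity) (by lia)
  have hnN : n ≤ N := le_trans (Nat.le_mul_of_pos_right _ (by lia)) hnr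
  have hrN : r ≤ N := le_trans hrr (le_trans (Nat.le_mul_of_pos_left _ hn1) hnr)
  have hN : 1 ≤ N := by lia
  have hHn : H * n ≤ 2 * N := by
    have := Nat.div_mul_le_self N n
    rw [hH, add_mul]
    lia
  have hg := groupCost_le (pre := pre) (qry := qry) hr hd hR hnr hN hT₁ hT₂
  set c := 200 + 10 * C + simCost pre * (1 + C) + simCost qry * (1 + C) with hc
  have hHNR : 1 ≤ H * (N * R) := Nat.mul_pos (by lia) (Nat.mul_pos hN (by lia))
  have h1 : guessCost pre qry N d n r H T₁ T₂ + 2 ≤ (c + 5) * (H * (N * R)) := by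
    have h2 := Nat.mul_le_mul_left H hg
    unfold guessCost
    calc _ ≤ H * (c * (N * R)) + 5 := by lia
      _ = c * (H * (N * R)) + 5 := by ring
      _ ≤ c * (H * (N * R)) + 5 * (H * (N * R)) := by lia
      _ = _ := by ring
  have h2 : r * r * (guessCost pre qry N d n r H T₁ T₂ + 2) * r ≤ (2 * c + 10) * (N * N) := by
    calc _ ≤ r * r * ((c + 5) * (H * (N * R))) * r :=
          Nat.mul_le_mul_right _ (Nat.mul_le_mul_left _ h1)
      _ = (c + 5) * N * (H * n) := by rw [hn]; ring
      _ ≤ (c + 5) * N * (2 * N) := Nat.mul_le_mul_left _ hHn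
      _ = _ := by ring
  have h3 : (4 * N + 3 + 1 + 3 * d + 9 + 2) * r ≤ 22 * (N * N) := by
    calc _ ≤ 22 * N * N := Nat.mul_le_mul (by lia) hrN
      _ = _ := by ring
  calc reductionCost pre qry N d n r H T₁ T₂ * r = (4 * N + 3 + 1 + 3 * d + 9 + 2) * r +
        r * r * (guessCost pre qry N d n r H T₁ T₂ + 2) * r := by unfold reductionCost; ring
    _ ≤ 22 * (N * N) + (2 * c + 10) * (N * N) := add_le_add h3 h2
    _ = (2 * c + 32) * (N * N) := by ring
    _ ≤ _ := Nat.mul_le_mul_right _ (by lia)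

/-! ### Growth of the parameters. -/

theorem two_pow_ceil_mul_log_le {c : ℝ} (hc : 0 < c) {N : ℕ} (hN : 1 ≤ N) :
    2 ^ ⌈c * Real.log N⌉₊ ≤ 2 * N ^ ⌈c⌉₊ := by
  have hlog : 0 ≤ Real.log N := Real.log_natCast_nonneg N
  have h1 : (⌈c * Real.log N⌉₊ : ℝ) < c * Real.log N + 1 := Nat.ceil_lt_add_one (by positivity)
  have h2 : Real.log 2 ≤ 1 := Real.log_two_lt_d9.le.trans (by norm_num)
  have h3 : c ≤ ⌈c⌉₊ := Nat.le_ceil c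
  have h5 : (0 : ℝ) < N := by exact_mod_cast hN
  have h4 : (2 : ℝ) ^ ⌈c * Real.log N⌉₊ ≤ 2 * (N : ℝ) ^ ⌈c⌉₊ := by
    rw [← Real.log_le_log_iff (by positivity) (by positivity), Real.log_pow,
      Real.log_mul (by norm_num) (by positivity), Real.log_pow]
    have h0 : 0 ≤ Real.log 2 := Real.log_nonneg (by norm_num)
    calc (⌈c * Real.log N⌉₊ : ℝ) * Real.log 2 ≤ (c * Real.log N + 1) * Real.log 2 :=
          mul_le_mul_of_nonneg_right h1.le h0
      _ = Real.log 2 + c * Real.log N * Real.log 2 := by ring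
      _ ≤ Real.log 2 + c * Real.log N * 1 := by gcongr
      _ ≤ Real.log 2 + ⌈c⌉₊ * Real.log N := by rw [mul_one]; gcongr
  exact_mod_cast h4

/-- The budget `n ^ (1 / σ)` is split into two equal factors: one dominates `k ≤ log n`, and the
other dominates `n ^ (c / k)` as soon as `k ≥ 2 σ c`. -/
theorem eventually_params {k : ℕ → ℕ} (hk : Tendsto k atTop atTop)
    (hko : (fun n => (k n : ℝ)) =o[atTop] (fun n : ℕ => Real.log n)) {c : ℝ} {σ : ℕ}
    (hσ : 1 ≤ σ) : ∀ᶠ n : ℕ in atTop, 8 ≤ k n ∧ 2 * (k n : ℝ) ≤ Real.log n ∧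
      (k n : ℝ) * (n : ℝ) ^ (c / k n) ≤ (n : ℝ) ^ (1 / σ : ℝ) := by
  have hσ' : (0 : ℝ) < σ := by exact_mod_cast hσ
  have h1 := hko.bound (c := 1 / 2) (by norm_num)
  have h2 := ((isLittleO_log_rpow_atTop (r := (1 / (2 * σ) : ℝ)) (by positivity)).comp_tendsto
    tendsto_natCast_atTop_atTop).bound (c := 1) one_pos
  filter_upwards [h1, h2, hk.eventually_ge_atTop 8, hk.eventually_ge_atTop ⌈2 * σ * c⌉₊,
    eventually_ge_atTop 1] with n h1 h2 h3 h4 h5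
  have hn : (1 : ℝ) ≤ n := by exact_mod_cast h5
  have hlog : 0 ≤ Real.log n := Real.log_natCast_nonneg n
  simp only [Function.comp_apply, Real.norm_eq_abs, Nat.abs_cast, abs_of_nonneg hlog, one_mul] at h1 h2
  rw [abs_of_nonneg (by positivity)] at h2
  have hk0 : (0 : ℝ) < k n := by
    have : 0 < k n := by lia
    exact_mod_cast this
  have h6 : 2 * σ * c ≤ k n := (Nat.le_ceil _).trans (by exact_mod_cast h4)
  refine ⟨h3, by linarith, ?_⟩
  calc (k n : ℝ) * (n : ℝ) ^ (c / k n) ≤ (n : ℝ) ^ (1 / (2 * σ) : ℝ) * (n : ℝ) ^ (1 / (2 * σ) : ℝ) := by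
        refine mul_le_mul (by linarith) (Real.rpow_le_rpow_of_exponent_le hn ?_) (by positivity)
          (by positivity)
        rw [div_le_div_iff₀ hk0 (by positivity)]
        linarith
    _ = (n : ℝ) ^ (1 / σ : ℝ) := by
        rw [← Real.rpow_add (by linarith)]
        congr 1
        field_simp
        norm_num

theorem combOk_of_log_le {k n N d r q σ : ℕ} {c : ℝ} (hc : 0 < c) (hr : 2 ≤ r) (hσ : 1 ≤ σ)
    (hn : n = r ^ σ) (hN1 : 1 ≤ N) (hN : N < (r + 1) ^ (q * σ)) (hd : d = ⌈c * Real.log N⌉₊)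
    (hk8 : 8 ≤ k) (hklog : 2 * (k : ℝ) ≤ Real.log n)
    (hkn : (k : ℝ) * (n : ℝ) ^ ((12 * q * c + 1) / k) ≤ (n : ℝ) ^ (1 / σ : ℝ)) :
    CombOk k ⌈(k : ℝ) * (n : ℝ) ^ ((12 * q * c + 1) / k)⌉₊ (d / ((k - 2) / 3) + 1) d ((k - 2) / 3) ∧
      k ≤ r ∧ ⌈(k : ℝ) * (n : ℝ) ^ ((12 * q * c + 1) / k)⌉₊ ≤ r := by
  have hk0 : (0 : ℝ) < k := by
    have : 0 < k := by lia
    exact_mod_cast this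
  have hn1 : 1 ≤ n := by rw [hn]; exact Nat.one_le_pow _ _ (by lia)
  have hn1' : (1 : ℝ) ≤ n := by exact_mod_cast hn1
  have hn0 : (0 : ℝ) < n := by linarith
  have hroot : (n : ℝ) ^ (1 / σ : ℝ) = r := by
    rw [hn, one_div]
    push_cast
    exact Real.pow_rpow_inv_natCast (by positivity) (by lia)
  rw [hroot] at hkn
  set x := Real.log n with hx
  set K := (k - 2) / 3 with hK
  have hK0 : 0 < K := by lia
  have hKk : (k : ℝ) ≤ 6 * K := by
    have : k ≤ 6 * K := by lia
    exact_mod_cast this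
  -- Since `r + 1 ≤ r ^ 2`, the number `N` is at most `n ^ (2 q)`.
  have hlogN : Real.log N ≤ 2 * q * x := by
    have h1 : N ≤ n ^ (2 * q) := by
      rw [hn, ← pow_mul]
      calc N ≤ (r + 1) ^ (q * σ) := hN.le
        _ ≤ (r ^ 2) ^ (q * σ) := Nat.pow_le_pow_left (by nlinarith) _
        _ = r ^ (σ * (2 * q)) := by rw [← pow_mul]; ring_nf
    have h2 : (N : ℝ) ≤ (n : ℝ) ^ (2 * q) := by exact_mod_cast h1
    have h3 := Real.log_le_log (by exact_mod_cast hN1) h2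
    rw [Real.log_pow] at h3
    push_cast at h3
    exact h3
  have hd' : (d : ℝ) ≤ 2 * q * c * x + 1 := by
    have hlog : 0 ≤ Real.log N := Real.log_natCast_nonneg N
    have h1 : (d : ℝ) < c * Real.log N + 1 := by
      rw [hd]; exact Nat.ceil_lt_add_one (by positivity)
    have h2 := mul_le_mul_of_nonneg_left hlogN hc.le
    linarith
  have hlen : (((d / K + 1 : ℕ) : ℝ)) ≤ (12 * q * c + 1) / k * x := by
    have h1 : ((d / K : ℕ) : ℝ) ≤ (d : ℝ) / K := Nat.cast_div_le
    have hK0' : (0 : ℝ) < K := by exact_mod_cast hK0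
    have h2 : (d : ℝ) / K ≤ 6 * d / k := by
      rw [div_le_div_iff₀ hK0' hk0]
      nlinarith [(Nat.cast_nonneg d : (0 : ℝ) ≤ d)]
    -- The origin of the constant `12 q c + 1`: `6 d` is at most `12 q c x + 6`, and the remaining
    -- `6 + k` is at most `2 k ≤ x`.
    have h3 : 6 * (d : ℝ) / k + 1 ≤ (12 * q * c + 1) / k * x := by
      have hk8' : (8 : ℝ) ≤ k := by exact_mod_cast hk8
      rw [div_add_one hk0.ne', div_mul_eq_mul_div]
      gcongr
      nlinarith
    push_cast
    linarith
  have h2len : (2 : ℝ) ^ (d / K + 1) ≤ (n : ℝ) ^ ((12 * q * c + 1) / k) := by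
    have h2 : Real.log 2 ≤ 1 := Real.log_two_lt_d9.le.trans (by norm_num)
    rw [← Real.log_le_log_iff (by positivity) (by positivity), Real.log_pow, Real.log_rpow hn0]
    refine le_trans ?_ hlen
    exact mul_le_of_le_one_right (by positivity) h2
  have hpow1 : (1 : ℝ) ≤ (n : ℝ) ^ ((12 * q * c + 1) / k) :=
    Real.one_le_rpow hn1' (by positivity)
  refine ⟨⟨by lia, rfl, by lia, (Nat.lt_mul_div_succ d hK0).le, ?_⟩, ?_, Nat.ceil_le.2 hkn⟩
  · rw [Nat.lt_ceil]
    have h1 : ((K + 1 : ℕ) : ℝ) < k := by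
      have : K + 1 < k := by lia
      exact_mod_cast this
    push_cast at h1 ⊢
    calc ((K : ℝ) + 1) * 2 ^ (d / K + 1) ≤ (K + 1) * (n : ℝ) ^ ((12 * q * c + 1) / k) := by gcongr
      _ < _ := by gcongr
  · have h1 : (k : ℝ) ≤ r := le_trans (le_mul_of_one_le_right hk0.le hpow1) hkn
    exact_mod_cast h1

/-! ### From a data structure to an algorithm for orthogonal vectors -/

/-- The entries of a Boolean matrix. -/
def boolEntry {N d : ℕ} (f : Fin N → Fin d → Bool) (i l : ℕ) : ℕ :=
  if h : i < N ∧ l < d then (f ⟨i, h.1⟩ ⟨l, h.2⟩).toNat else 0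

theorem boolEntry_le_one {N d : ℕ} (f : Fin N → Fin d → Bool) (i l : ℕ) : boolEntry f i l ≤ 1 := by
  unfold boolEntry
  split_ifs
  · exact Bool.toNat_le _
  · lia

theorem boolEntry_val {N d : ℕ} (f : Fin N → Fin d → Bool) (i : Fin N) (l : Fin d) :
    boolEntry f i l = (f i l).toNat := by
  simp [boolEntry]

theorem boolEntry_injective {N d : ℕ} {f : Fin N → Fin d → Bool} (hf : Function.Injective f)
    {i i' : ℕ} (hi : i < N) (hi' : i' < N) (h : ∀ l < d, boolEntry f i l = boolEntry f i' l) :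
    i = i' := by
  have : (⟨i, hi⟩ : Fin N) = ⟨i', hi'⟩ := hf (funext fun l => by
    have h1 := h l l.2
    rw [boolEntry_val f ⟨i, hi⟩ l, boolEntry_val f ⟨i', hi'⟩ l] at h1
    revert h1
    cases f ⟨i, hi⟩ l <;> cases f ⟨i', hi'⟩ l <;> simp)
  exact congrArg Fin.val this

theorem orthPair_iff {N d : ℕ} {f g : Fin N → Fin d → Bool} :
    OrthPair N d (boolEntry f) (boolEntry g) ↔ HasOrthogonalPair f g := by
  have key : ∀ i j : Fin N, dot d (boolEntry f i) (boolEntry g j) =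
      ∑ l, (f i l).toNat * (g j l).toNat := fun i j => by
    rw [dot, Finset.sum_range]
    simp only [boolEntry_val]
  constructor
  · rintro ⟨i, hi, j, hj, h⟩
    exact ⟨⟨i, hi⟩, ⟨j, hj⟩, by rw [← key]; exact h⟩
  · rintro ⟨i, j, h⟩
    exact ⟨i, i.2, j, j.2, by rw [key]; exact h⟩

/-- The variables and the memory for an instance of the orthogonal vectors problem. -/
def ovState {N d : ℕ} (f g : Fin N → Fin d → Bool) : St :=
  ⟨fun v => (ovInit f g).reg v.ix, (ovInit f g).mem⟩

theorem memTable_boolEntry {N d : ℕ} (f : Fin N → Fin d → Bool) :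
    memTable (fun i l => ((f i l).toNat : ℤ)) =
      partTable (fun a => (boolEntry f (a / d) (a % d) : ℕ)) (N * d) := by
  refine memTable_eq_partTable _ fun i l => ?_
  have hd : 0 < d := l.pos
  have h1 : (i * d + l : ℕ) / d = i := by
    rw [Nat.add_comm, Nat.add_mul_div_right _ _ hd, Nat.div_eq_of_lt l.2, zero_add]
  have h2 : (i * d + l : ℕ) % d = l := by
    rw [Nat.add_comm, Nat.add_mul_mod_self_right, Nat.mod_eq_of_lt l.2]
  rw [h1, h2, boolEntry_val]

theorem memTable_boolEntry_apply {N d : ℕ} (f : Fin N → Fin d → Bool) {i l : ℕ} (hi : i < N)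
    (hl : l < d) :
    memTable (fun i l => ((f i l).toNat : ℤ)) ((i * d + l : ℕ) : ℤ) = boolEntry f i l := by
  have h1 : (i * d + l : ℕ) / d = i := by
    rw [Nat.add_comm, Nat.add_mul_div_right _ _ (by lia), Nat.div_eq_of_lt hl, zero_add]
  have h2 : (i * d + l : ℕ) % d = l := by
    rw [Nat.add_comm, Nat.add_mul_mod_self_right, Nat.mod_eq_of_lt hl]
  have h3 : i * d + l < N * d := by
    have : (i + 1) * d ≤ N * d := Nat.mul_le_mul_right _ hi
    rw [add_mul] at this
    lia
  rw [memTable_boolEntry, partTable, if_pos ⟨by positivity, by exact_mod_cast h3⟩, Int.toNat_natCast,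
    h1, h2]

theorem ovState_data {N d : ℕ} (f g : Fin N → Fin d → Bool) :
    Data N d (boolEntry f) (boolEntry g) (ovState f g) :=
  ⟨rfl, rfl, fun _ hi _ hl => memTable_boolEntry_apply f hi hl,
    fun _ hi _ hl => memTable_boolEntry_apply g hi hl⟩

theorem ovState_bdd {N d : ℕ} (f g : Fin N → Fin d → Bool) {X : ℤ} (h1 : 1 ≤ X) (hN : (N : ℤ) ≤ X)
    (hd : (d : ℤ) ≤ X) : (ovState f g).Bdd X := by
  have key : ∀ (f : Fin N → Fin d → Bool) a, |memTable (fun i l => ((f i l).toNat : ℤ)) a| ≤ X := by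
    intro f a
    rw [memTable_boolEntry, partTable]
    split_ifs
    · rw [Nat.abs_cast]
      have := boolEntry_le_one f (a.toNat / d) (a.toNat % d)
      lia
    · rw [abs_zero]; lia
  constructor
  · intro v
    simp only [ovState, ovInit]
    split
    · rwa [Nat.abs_cast]
    · rwa [Nat.abs_cast]
    · rw [abs_zero]; lia
  · intro b a
    simp only [ovState, ovInit]
    split
    · exact key f a
    · exact key g a
    · rw [abs_zero]; lia

/-! ### Choice of the constants and assembly of the algorithm. -/

theorem exists_root {Q : ℕ} (hQ : Q ≠ 0) (N : ℕ) : ∃ r : ℕ, r ^ Q ≤ N ∧ N < (r + 1) ^ Q := by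
  induction N with
  | zero => exact ⟨0, by simp [hQ], by simp⟩
  | succ N ih =>
    obtain ⟨r, h1, h2⟩ := ih
    by_cases h : N + 1 < (r + 1) ^ Q
    · exact ⟨r, by lia, h⟩
    · have h3 : (r + 1) ^ Q < (r + 1 + 1) ^ Q := Nat.pow_lt_pow_left (by lia) hQ
      exact ⟨r + 1, by lia, by lia⟩

/-- The ratio `9 L² / (4 + L²)` tends to `9`, so a tall comb realizes every gap below `3`. -/
theorem exists_scale {ε : ℝ} (hε : 0 < ε) : ∃ (L : ℕ) (δ : ℝ), 3 ≤ L ∧ 0 < δ ∧ 3 - ε < δ ∧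
    δ ^ 2 * (4 + (L : ℝ) ^ 2) ≤ 9 * (L : ℝ) ^ 2 := by
  have h0 : 0 < min ε 1 := lt_min hε one_pos
  have h1 : min ε 1 ≤ 1 := min_le_right _ _
  have h2 : min ε 1 ≤ ε := min_le_left _ _
  set δ := 3 - min ε 1 / 2 with hδ
  have hδ3 : 0 < 9 - δ ^ 2 := by nlinarith
  obtain ⟨L, hL⟩ := exists_nat_ge (max 3 (36 / (9 - δ ^ 2)))
  obtain ⟨h3, h4⟩ := max_le_iff.1 hL
  refine ⟨L, δ, by exact_mod_cast h3, by linarith, by linarith, ?_⟩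
  rw [div_le_iff₀ hδ3] at h4
  have h5 : (L : ℝ) * (9 - δ ^ 2) ≤ (L : ℝ) ^ 2 * (9 - δ ^ 2) :=
    mul_le_mul_of_nonneg_right (by nlinarith) hδ3.le
  nlinarith

theorem reduction_ends_of_ann {pre qry : RamProg} {κ ρ L q σ r N d k C₀ B A : ℕ} {C ε ε' β δ c : ℝ}
    (hq : 2 ≤ q) (hβ : β ≤ q) (hσ : 5 ≤ σ) (hσε : 3 ≤ σ * ε') (hC : C ≤ C₀) (hc : 0 < c)
    (hρ : 1 ≤ ρ) (hL : 3 ≤ L) (hδ0 : 0 < δ) (hα : 3 - ε < δ)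
    (hδ : δ ^ 2 * (4 + (L : ℝ) ^ 2) ≤ 9 * (L : ℝ) ^ 2) (hr2 : 2 ≤ r) (hLr : L ≤ r)
    (hr : r ^ (q * σ) ≤ N) (hr' : N < (r + 1) ^ (q * σ)) (hd : d = ⌈c * Real.log N⌉₊)
    (hk8 : 8 ≤ k) (hklog : 2 * (k : ℝ) ≤ Real.log (r ^ σ : ℕ))
    (hkn : (k : ℝ) * ((r ^ σ : ℕ) : ℝ) ^ ((12 * q * c + 1) / k) ≤ ((r ^ σ : ℕ) : ℝ) ^ (1 / σ : ℝ))
    (hann : IsPlanarANN pre qry κ ρ (3 - ε) (r ^ σ)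
      ⌈(k : ℝ) * ((r ^ σ : ℕ) : ℝ) ^ ((12 * q * c + 1) / k)⌉₊ k
      (C * ((r ^ σ : ℕ) : ℝ) ^ β) (C * ((r ^ σ : ℕ) : ℝ) ^ (1 - ε')))
    (hpre : pre.mag < B) (hqry : qry.mag + 8 ≤ B)
    (hNA : N + 1 ≤ A) (hdA : 2 ^ (d + 2) ≤ A) (hLA : L ≤ A) (hBA : B + 5 ≤ A)
    (hCA : C₀ * N ≤ A) {f g : Fin N → Fin d → Bool} (hf : Function.Injective f) :
    Ends ((A : ℤ) ^ (8 * κ + 18)) (reduction L B C₀ (q * σ) σ (σ - 3) κ pre qry) (ovState f g)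
      (reductionCost pre qry N d (r ^ σ) r (N / r ^ σ + 1) (C₀ * r ^ (q * σ))
        (C₀ * r ^ (σ - 3)))
      (fun s' => (HasOrthogonalPair f g → s'.reg .ans = 1) ∧
        (¬ HasOrthogonalPair f g → s'.reg .ans = 0)) := by
  set n := r ^ σ with hn
  have hr1 : 1 ≤ r := by lia
  have hr0 : (0 : ℝ) < r := by exact_mod_cast hr1
  have hQ1 : σ ≤ q * σ := Nat.le_mul_of_pos_left _ (by lia)
  have hn1 : 1 ≤ n := Nat.one_le_pow _ _ hr1
  have hn1' : (1 : ℝ) ≤ n := by exact_mod_cast hn1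
  have hnN : n ≤ N := (Nat.pow_le_pow_right hr1 hQ1).trans hr
  have hrn : r ≤ n := Nat.le_self_pow (by lia) _
  have hcomb := combOk_of_log_le hc hr2 (by lia) hn (by lia) hr' hd hk8 hklog hkn
  set m := ⌈(k : ℝ) * (n : ℝ) ^ ((12 * q * c + 1) / k)⌉₊ with hm
  obtain ⟨hco, hkr, hmr⟩ := hcomb
  -- The exponent `β` is at most `q`, and `n ^ q = r ^ (q σ)`.
  have hT₁ : C * (n : ℝ) ^ β ≤ (C₀ * r ^ (q * σ) : ℕ) := by
    have h1 : (n : ℝ) ^ β ≤ ((r ^ (q * σ) : ℕ) : ℝ) := by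
      calc (n : ℝ) ^ β ≤ (n : ℝ) ^ (q : ℝ) := Real.rpow_le_rpow_of_exponent_le hn1' hβ
        _ = _ := by rw [Real.rpow_natCast, hn, mul_comm q σ, pow_mul]; push_cast; rfl
    push_cast at h1 ⊢
    exact mul_le_mul hC h1 (by positivity) (by positivity)
  -- As `n = r ^ σ` and `3 ≤ σ ε'`, the exponent of `r` is at most `σ - 3`: each query saves a
  -- factor `r ^ 3`.
  have hT₂ : C * (n : ℝ) ^ (1 - ε') ≤ (C₀ * r ^ (σ - 3) : ℕ) := by
    have h1 : (n : ℝ) ^ (1 - ε') ≤ ((r ^ (σ - 3) : ℕ) : ℝ) := by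
      have h2 : (n : ℝ) = (r : ℝ) ^ (σ : ℝ) := by rw [hn, Real.rpow_natCast]; push_cast; rfl
      have h3 : (((r ^ (σ - 3) : ℕ) : ℝ)) = (r : ℝ) ^ ((σ : ℝ) - 3) := by
        have h4 : ((σ : ℝ) - 3) = ((σ - 3 : ℕ) : ℝ) := by
          push_cast [show 3 ≤ σ by lia]; rfl
        rw [h4, Real.rpow_natCast]
        push_cast; rfl
      rw [h2, h3, ← Real.rpow_mul hr0.le]
      exact Real.rpow_le_rpow_of_exponent_le (by exact_mod_cast hr1) (by linarith)
    push_cast at h1 ⊢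
    exact mul_le_mul hC h1 (by positivity) (by positivity)
  have hl : AllLimits ((A : ℤ) ^ (8 * κ + 18)) ((A : ℤ) ^ (4 * κ + 8)) B L κ N d n r
      (C₀ * r ^ (q * σ)) (C₀ * r ^ (σ - 3)) := by
    refine allLimits_of_le (by lia) hn1 (by lia) (by lia) hdA hLA hBA ?_ ?_ (by lia)
    · exact (Nat.mul_le_mul_left _ hr).trans hCA
    · exact (Nat.mul_le_mul_left _ ((Nat.pow_le_pow_right hr1 (by lia)).trans hr)).trans hCA
  have hNX : (N : ℤ) + 1 ≤ (A : ℤ) ^ (8 * κ + 18) := by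
    have h1 : N + 1 ≤ A ^ (8 * κ + 18) := hNA.trans (Nat.le_self_pow (by lia) _)
    exact_mod_cast h1
  refine (reduction_ends hl (boolEntry_le_one f) (boolEntry_le_one g) hpre hqry (by lia) hQ1 hr1 hr
    hr' rfl rfl hn rfl (ovState_data f g) rfl rfl rfl hNX (k := k) (m := m) (by lia) (by lia)
    hco.two_le_m (by lia) fun h _ => ?_).mono le_rfl fun s' _ _ h => ?_
  · exact groupOk_of_isPlanarANN hann hco hρ hL (by lia) hnN hδ0 hα hδ (boolEntry_le_one f)
      (boolEntry_le_one g) (fun i hi i' hi' h => boolEntry_injective hf hi hi' h) hT₁ hT₂ h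
  · rwa [orthPair_iff] at h

theorem exec_of_ends {P : Prop} {c : Cmd} {X W : ℤ} {N d T : ℕ} {f g : Fin N → Fin d → Bool}
    (hX : 2 ≤ X) (hN : (N : ℤ) ≤ X) (hd : (d : ℤ) ≤ X) (hW : X ^ c.mag ≤ W) (hc : (c.mag : ℤ) ≤ X)
    (h : Ends X c (ovState f g) T (fun s' => (P → s'.reg .N = 1) ∧ (¬ P → s'.reg .N = 0))) :
    ∃ (t : ℕ) (τ : RamState), RamExec W c.comp (ovInit f g) t τ ∧ t ≤ c.mag * T ∧
      (P → τ.reg 0 = 1) ∧ (¬ P → τ.reg 0 = 0) := by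
  have hb := ovState_bdd f g (by lia) hN hd
  obtain ⟨t, s', ht, hr, h1, h2⟩ := h hb
  obtain ⟨u, τ, hu, hut, hτ⟩ := hr.comp_exec hX hb hW hc (σ := ovInit f g) ⟨fun _ => rfl, rfl⟩
  have h0 : τ.reg 0 = s'.reg .N := hτ.1 .N
  exact ⟨u, τ, hu, hut.trans (Nat.mul_le_mul_left _ ht), by rwa [h0], by rwa [h0]⟩

theorem eventually_mul_log_le (a : ℝ) :
    ∀ᶠ r : ℕ in atTop, a * Real.log ((r : ℝ) + 1) + 1 ≤ r := by
  have h1 : Tendsto (fun r : ℕ => (r : ℝ) + 1) atTop atTop :=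
    tendsto_atTop_add_const_right _ _ tendsto_natCast_atTop_atTop
  have h2 := ((Real.isLittleO_log_id_atTop.comp_tendsto h1).bound
    (c := 1 / (2 * (|a| + 1))) (by positivity))
  filter_upwards [h2, eventually_ge_atTop 3] with r h2 h3
  have h4 : (3 : ℝ) ≤ r := by exact_mod_cast h3
  have h5 : 0 ≤ Real.log ((r : ℝ) + 1) := Real.log_nonneg (by linarith)
  simp only [Function.comp_apply, Real.norm_eq_abs, id] at h2
  rw [abs_of_nonneg h5, abs_of_nonneg (by linarith : (0 : ℝ) ≤ (r : ℝ) + 1), div_mul_eq_mul_div, one_mul,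
    le_div_iff₀ (by positivity)] at h2
  have h6 : a * Real.log ((r : ℝ) + 1) ≤ |a| * Real.log ((r : ℝ) + 1) :=
    mul_le_mul_of_nonneg_right (le_abs_self a) h5
  nlinarith

theorem le_pow_of_le_mul {Y x C N : ℕ} (hY : 2 ≤ Y) (hN : N ≤ Y) (h : x ≤ C * N) :
    x ≤ Y ^ (C + 1) := by
  refine h.trans ?_
  rw [pow_succ]
  exact Nat.mul_le_mul (Nat.lt_two_pow_self.le.trans (Nat.pow_le_pow_left hY _)) hN

theorem le_pow_self_of_two_le {Y C : ℕ} (hY : 2 ≤ Y) : C ≤ Y ^ C :=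
  Nat.lt_two_pow_self.le.trans (Nat.pow_le_pow_left hY _)

/-- Running time `T` with `T * r ≤ c * N ^ 2`, where `r` is at least half of the `Q`-th root of `N`,
is at most `2 * c * N ^ (2 - 1 / Q)`. -/
theorem le_rpow_of_mul_le {T r c N Q : ℕ} (hQ : 1 ≤ Q) (hr1 : 1 ≤ r) (hr : N < (r + 1) ^ Q)
    (hN : 1 ≤ N) (h : T * r ≤ c * (N * N)) : (T : ℝ) ≤ 2 * c * (N : ℝ) ^ (2 - 1 / Q : ℝ) := by
  have hN0 : (0 : ℝ) < N := by exact_mod_cast hN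
  have h1 : (N : ℝ) ^ (1 / Q : ℝ) ≤ 2 * r := by
    have h2 : (N : ℝ) ≤ (2 * r : ℝ) ^ Q := by
      have : N ≤ (2 * r) ^ Q := hr.le.trans (Nat.pow_le_pow_left (by lia) _)
      exact_mod_cast this
    calc (N : ℝ) ^ (1 / Q : ℝ) ≤ ((2 * r : ℝ) ^ Q) ^ (1 / Q : ℝ) :=
          Real.rpow_le_rpow hN0.le h2 (by positivity)
      _ = 2 * r := by
          rw [one_div]; exact Real.pow_rpow_inv_natCast (by positivity) (by lia)
  have h3 : (T : ℝ) * r ≤ c * ((N : ℝ) * N) := by exact_mod_cast h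
  have h4 : (N : ℝ) ^ (2 - 1 / Q : ℝ) * (N : ℝ) ^ (1 / Q : ℝ) = N * N := by
    rw [← Real.rpow_add hN0, sub_add_cancel, Real.rpow_two, pow_two]
  have hr0 : (0 : ℝ) < r := by exact_mod_cast hr1
  have h5 : (T : ℝ) * r ≤ 2 * c * (N : ℝ) ^ (2 - 1 / Q : ℝ) * r := by
    rw [← h4] at h3
    refine h3.trans ?_
    have h6 : (0 : ℝ) ≤ c * (N : ℝ) ^ (2 - 1 / Q : ℝ) := by positivity
    nlinarith [mul_le_mul_of_nonneg_left h1 h6]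
  exact le_of_mul_le_mul_right h5 hr0

set_option maxHeartbeats 600000 in
theorem decidesOV_of_ann {ε ε' β c : ℝ} {q σ : ℕ} (hε : 0 < ε) (hq : 2 ≤ q) (hβ : β ≤ q)
    (hσ : 5 ≤ σ) (hσε : 3 ≤ σ * ε') (hc : 0 < c) {k : ℕ → ℕ} (hk : Tendsto k atTop atTop)
    (hko : (fun n => (k n : ℝ)) =o[atTop] (fun n : ℕ => Real.log n)) {ρ : ℕ} (hρ : 1 ≤ ρ)
    {pre qry : RamProg} {κ : ℕ} {C : ℝ}
    (hann : ∀ n : ℕ, 1 ≤ n → 2 ≤ k n → IsPlanarANN pre qry κ ρ (3 - ε) n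
      ⌈(k n : ℝ) * (n : ℝ) ^ ((12 * q * c + 1) / (k n : ℝ))⌉₊ (k n)
      (C * (n : ℝ) ^ β) (C * (n : ℝ) ^ (1 - ε'))) :
    ∃ (p : RamProg) (κ' : ℕ) (C' : ℝ), ∀ N : ℕ, 1 ≤ N →
      DecidesOV p κ' N ⌈c * Real.log N⌉₊ (C' * (N : ℝ) ^ (2 - 1 / (q * σ : ℕ) : ℝ)) := by
  obtain ⟨L, δ, hL, hδ0, hα, hδ⟩ := exists_scale hε
  obtain ⟨C₀, hC⟩ := exists_nat_ge C
  set Q := q * σ with hQ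
  have hQ1 : σ ≤ Q := Nat.le_mul_of_pos_left _ (by lia)
  have hQ2 : σ + 2 ≤ Q := by
    have : 2 * σ ≤ q * σ := Nat.mul_le_mul_right _ hq
    lia
  obtain ⟨n₀, hn₀⟩ := eventually_atTop.1
    (eventually_params hk hko (c := 12 * q * c + 1) (show 1 ≤ σ by lia))
  obtain ⟨r₁, hr₁⟩ := eventually_atTop.1 (eventually_mul_log_le (c * Q))
  set r₀ := n₀ + r₁ + L with hr₀
  set N₀ := r₀ ^ Q with hN₀
  set B := pre.mag + qry.mag + 8 with hB
  set prog := ovProgram N₀ L B C₀ Q σ (σ - 3) κ pre qry with hprog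
  set c₁ := 450 + 20 * C₀ + 2 * (simCost pre * (1 + C₀)) + 2 * (simCost qry * (1 + C₀)) with hc₁
  set c₂ := N₀ * N₀ * (3 * ⌈c * Real.log N₀⌉₊ + 8) + 3 with hc₂
  -- One exponent large enough that `Y ^ a` dominates every constant and every polynomial quantity
  -- of the algorithm.
  set a := ⌈c⌉₊ + 3 + L + (C₀ + 1) + (B + 5) + prog.mag + 2 with ha
  clear_value a c₂ c₁ prog B N₀ r₀ Q
  refine ⟨prog.comp, a * (8 * κ + 18) * prog.mag, (prog.mag * (2 * c₁ + c₂ + 2) : ℕ),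
    fun N hN => ?_⟩
  obtain ⟨d, hd⟩ : ∃ d, d = ⌈c * Real.log N⌉₊ := ⟨_, rfl⟩
  rw [← hd]
  intro f g hf _
  have hN0 : (1 : ℝ) ≤ N := by exact_mod_cast hN
  set Y := N * d + 2 with hY
  have hY2 : 2 ≤ Y := by lia
  -- Words are measured by `N * d`, which vanishes for `N = 1` as then `d = 0`; the summand `2`
  -- covers this case.
  have hNY : N ≤ Y := by
    rcases Nat.lt_or_ge N 2 with h | h
    · lia
    · have h1 : 0 < d := hd ▸ Nat.ceil_pos.2 (mul_pos hc (Real.log_pos (by exact_mod_cast h)))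
      have := Nat.le_mul_of_pos_right N h1
      lia
  set A := Y ^ a with hA
  have hpow : ∀ {x e : ℕ}, x ≤ Y ^ e → e ≤ a → x ≤ A := fun h he =>
    h.trans (Nat.pow_le_pow_right (by lia) he)
  have hNA : N + 1 ≤ A := hpow (e := 2) (by nlinarith) (by lia)
  have hNNA : N * N ≤ A := hpow (e := 2) (by rw [pow_two]; exact Nat.mul_le_mul hNY hNY) (by lia)
  have hdA : 2 ^ (d + 2) ≤ A := by
    refine hpow (e := ⌈c⌉₊ + 3) ?_ (by lia)
    calc 2 ^ (d + 2) ≤ 2 * N ^ ⌈c⌉₊ * 2 ^ 2 := by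
          rw [pow_add, hd]; exact Nat.mul_le_mul_right _ (two_pow_ceil_mul_log_le hc hN)
      _ = N ^ ⌈c⌉₊ * 2 ^ 3 := by ring
      _ ≤ Y ^ ⌈c⌉₊ * Y ^ 3 :=
          Nat.mul_le_mul (Nat.pow_le_pow_left hNY _) (Nat.pow_le_pow_left hY2 _)
      _ = _ := (pow_add _ _ _).symm
  have hLA : L ≤ A := hpow (le_pow_self_of_two_le hY2) (by lia)
  have hBA : B + 5 ≤ A := hpow (le_pow_self_of_two_le hY2) (by lia)
  have hCA : C₀ * N ≤ A := hpow (le_pow_of_le_mul hY2 hNY le_rfl) (by lia)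
  have hmA : prog.mag ≤ A := hpow (le_pow_self_of_two_le hY2) (by lia)
  have hAX : A ≤ A ^ (8 * κ + 18) := Nat.le_self_pow (by lia) _
  have hXZ : ∀ {x : ℕ}, x ≤ A → (x : ℤ) ≤ (A : ℤ) ^ (8 * κ + 18) := fun h => by
    exact_mod_cast h.trans hAX
  have hd2 : d + 2 < 2 ^ (d + 2) := Nat.lt_two_pow_self
  clear_value A Y
  have hX2 : (2 : ℤ) ≤ (A : ℤ) ^ (8 * κ + 18) := by
    exact_mod_cast hXZ (x := 2) (by lia)
  have hpow1 : (1 : ℝ) ≤ (N : ℝ) ^ (2 - 1 / Q : ℝ) := by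
    refine Real.one_le_rpow hN0 ?_
    have h1 : (1 : ℝ) ≤ Q := by
      have : 1 ≤ Q := by lia
      exact_mod_cast this
    have : 1 / (Q : ℝ) ≤ 1 := by rw [div_le_one (by linarith)]; exact h1
    linarith
  suffices h : ∃ T : ℕ, Ends ((A : ℤ) ^ (8 * κ + 18)) prog (ovState f g) (T + 2) (fun s' =>
      (HasOrthogonalPair f g → s'.reg .N = 1) ∧ (¬ HasOrthogonalPair f g → s'.reg .N = 0)) ∧
      (T : ℝ) ≤ (2 * c₁ + c₂) * (N : ℝ) ^ (2 - 1 / Q : ℝ) by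
    obtain ⟨T, hT, hTle⟩ := h
    have hW : ((A : ℤ) ^ (8 * κ + 18)) ^ prog.mag ≤
        wordBound (a * (8 * κ + 18) * prog.mag) (N * d) := by
      rw [hA, wordBound, hY]
      push_cast
      rw [← pow_mul, ← pow_mul, mul_assoc]
    obtain ⟨t, τ, ht, htT, h1⟩ := exec_of_ends hX2 (hXZ (by lia)) (hXZ (by lia)) hW (hXZ hmA) hT
    refine ⟨t, τ, ht, ?_, h1⟩
    have h2 : (t : ℝ) ≤ prog.mag * (T + 2) := by exact_mod_cast htT
    push_cast
    calc (t : ℝ) ≤ prog.mag * (T + 2) := h2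
        _ ≤ prog.mag * ((2 * c₁ + c₂ + 2) * (N : ℝ) ^ (2 - 1 / Q : ℝ)) := by
            gcongr
            linarith
        _ = _ := by ring
  -- Below `N₀` the asymptotic estimates are not available; testing all pairs takes bounded time
  -- there.
  rcases Nat.lt_or_ge N N₀ with hlt | hge
  · rw [hprog]
    refine ⟨N * N * (3 * d + 8) + 3, ovProgram_ends (N := N) rfl (fun _ => ?_)
      fun h => absurd h (by lia), ?_⟩
    · refine (bruteForce_ends (by lia) (hXZ hNNA) (boolEntry_le_one f) (boolEntry_le_one g)
        (ovState_data f g) rfl).mono le_rfl fun s' _ _ h => ?_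
      rwa [orthPair_iff] at h
    · have h1 : d ≤ ⌈c * Real.log N₀⌉₊ := by
        rw [hd]
        refine Nat.ceil_mono (mul_le_mul_of_nonneg_left ?_ hc.le)
        exact Real.log_le_log (by linarith) (by exact_mod_cast hlt.le)
      have h2 : N * N * (3 * d + 8) + 3 ≤ c₂ := by
        rw [hc₂]
        exact add_le_add (Nat.mul_le_mul (Nat.mul_le_mul hlt.le hlt.le)
          (Nat.add_le_add_right (Nat.mul_le_mul_left _ h1) _)) le_rfl
      have h3 : ((N * N * (3 * d + 8) + 3 : ℕ) : ℝ) ≤ c₂ := by exact_mod_cast h2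
      refine h3.trans ?_
      have h4 : (0 : ℝ) ≤ 2 * c₁ * (N : ℝ) ^ (2 - 1 / Q : ℝ) := by positivity
      rw [add_mul]
      exact (le_mul_of_one_le_right (Nat.cast_nonneg _) hpow1).trans (le_add_of_nonneg_left h4)
  · obtain ⟨r, hr, hr'⟩ := exists_root (show Q ≠ 0 by lia) N
    have hrr₀ : r₀ ≤ r := by
      have h1 : r₀ ^ Q < (r + 1) ^ Q := by lia
      exact Nat.lt_succ_iff.1 (lt_of_pow_lt_pow_left₀ Q (Nat.zero_le _) h1)
    have hr1 : 1 ≤ r := by lia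
    have hdr : d ≤ r := by
      have h1 := hr₁ r (by lia)
      have h2 : Real.log N ≤ Q * Real.log ((r : ℝ) + 1) := by
        rw [← Real.log_pow]
        exact Real.log_le_log (by linarith) (by exact_mod_cast hr'.le)
      have h3 : (d : ℝ) < c * Real.log N + 1 := hd ▸
        Nat.ceil_lt_add_one (mul_nonneg hc.le (Real.log_natCast_nonneg N))
      have h4 := mul_le_mul_of_nonneg_left h2 hc.le
      have h5 : (d : ℝ) ≤ r := by linarith
      exact_mod_cast h5
    have hrn : r ≤ r ^ σ := Nat.le_self_pow (by lia) _
    obtain ⟨hk8, hklog, hkn⟩ := hn₀ (r ^ σ) (by lia)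
    have hcost := reductionCost_le (pre := pre) (qry := qry) (N := N) (d := d) (n := r ^ σ)
      (H := N / r ^ σ + 1) (T₁ := C₀ * r ^ Q) (T₂ := C₀ * r ^ (σ - 3)) (C := C₀) (R := r ^ (σ - 3))
      hr1 hdr (by rw [← pow_two]; exact Nat.pow_le_pow_right hr1 (by lia))
      (by rw [← pow_add]; congr 1; lia)
      (by rw [← pow_two, ← pow_add]; exact (Nat.pow_le_pow_right hr1 hQ2).trans hr) rfl
      (Nat.mul_le_mul_left _ hr) le_rfl
    rw [hprog]
    subst hQ
    refine ⟨_, ovProgram_ends (N := N) rfl (fun h => absurd h (by lia)) fun _ =>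
      reduction_ends_of_ann hq hβ hσ hσε hC hc hρ hL hδ0 hα hδ (by lia) (by lia) hr hr' hd
        hk8 hklog hkn (hann _ (by lia) (by lia)) (by lia) (by lia) hNA hdA hLA hBA hCA hf, ?_⟩
    have h1 := le_rpow_of_mul_le (by lia) hr1 hr' hN hcost
    have h5 : (0 : ℝ) ≤ c₂ * (N : ℝ) ^ (2 - 1 / (q * σ : ℕ) : ℝ) := by positivity
    rw [← hc₁] at h1
    rw [add_mul]
    exact h1.trans (le_add_of_nonneg_right h5)

theorem theorem8 (hOVH : OVH) (ε ε' β : ℝ) (hε : 0 < ε) (hε' : 0 < ε') (hβ : 0 < β) :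
    ∃ c : ℝ, 0 < c ∧
      ∀ k : ℕ → ℕ, Tendsto k atTop atTop →
        (fun n => (k n : ℝ)) =o[atTop] (fun n : ℕ => Real.log n) →
        ∀ ρ : ℕ, 1 ≤ ρ →
          ¬ ∃ (pre qry : RamProg) (κ : ℕ) (C : ℝ), ∀ n : ℕ, 1 ≤ n → 2 ≤ k n →
            IsPlanarANN pre qry κ ρ (3 - ε) n ⌈(k n : ℝ) * (n : ℝ) ^ (c / (k n : ℝ))⌉₊ (k n)
              (C * (n : ℝ) ^ β) (C * (n : ℝ) ^ (1 - ε')) := by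
  -- `q ≥ β` makes preprocessing cost `O(N)`. Together with `σ ≥ 5`, `q ≥ 2` gives `n * r ^ 2 ≤ N`,
  -- while `σ ≥ 5` also gives `r ^ 2 ≤ r ^ (σ - 3)`.
  obtain ⟨q, hq⟩ := exists_nat_ge (max 2 β)
  obtain ⟨hq2, hqβ⟩ := max_le_iff.1 hq
  obtain ⟨σ, hσ⟩ := exists_nat_ge (max 5 (3 / ε'))
  obtain ⟨hσ5, hσε⟩ := max_le_iff.1 hσ
  rw [div_le_iff₀ hε'] at hσε
  have hq2' : 2 ≤ q := by exact_mod_cast hq2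
  have hσ5' : 5 ≤ σ := by exact_mod_cast hσ5
  have hQ : 0 < q * σ := Nat.mul_pos (by lia) (by lia)
  -- One factor `r`, about `N ^ (1 / (q σ))`, is gained. The dimension constant obtained here
  -- depends only on `ε'` and `β`, so the exponent constant below is uniform in `k` and `ρ`.
  obtain ⟨c, hc, hno⟩ := hOVH (1 / (q * σ : ℕ)) (by positivity)
  refine ⟨12 * q * c + 1, by positivity, fun k hk hko ρ hρ => ?_⟩
  rintro ⟨pre, qry, κ, C, hann⟩
  exact hno (decidesOV_of_ann hε hq2' hqβ hσ5' hσε hc hk hko hρ hann)
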